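/- Let $\mathbb S=\mathbb R/2\pi\mathbb Z$, and let $\Sigma_\infty$ be the set of configurations $\hat\eta=(\tilde\eta_x,\theta_x)_{x\in\mathbb Z^2}$ in which each site $x$ is empty (then $\theta_x=0$ by convention) or carries one particle, active ($a$) or passive ($p$), with an angle $\theta_x\in\mathbb S$. For $\sigma\in\{a,p\}$ let $\eta^\sigma_x\in\{0,1\}$ be the number of particles of type $\sigma$ at $x$, $\eta_x=\eta_x^a+\eta_x^p$, and $\eta_x^{\sigma,\Phi}=\Phi(\theta_x)\eta^\sigma_x$ for $\Phi:\mathbb S\to\mathbb R$. Let $\hat\eta^{x,y}$ be $\hat\eta$ with the states at $x$ and $y$ exchanged, and let $\tau_xf(\hat\eta)=f((\hat\eta_{y+x})_{y})$. Let $\hat{\boldsymbol\alpha}=(\hat\alpha^a,\hat\alpha^p)$ be a pair of non-negative measures on $\mathbb S$ with $\hat\alpha^a(\mathbb S)+\hat\alpha^p(\mathbb S)\le 1$, and let $\mu_{\hat{\boldsymbol\alpha}}$ be the product measure on $\Sigma_\infty$ under which each site carries a particle of type $\sigma$ with angle in $d\theta$ with probability $\hat\alpha^\sigma(d\theta)$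 and is empty otherwise. Fix $\omega\in C^2(\mathbb S)$. A cylinder function is a function $f:\Sigma_\infty\to\mathbb R$ that depends on finitely many sites and is $C^2$ in each angle. Let $T^\omega$ be the linear span of the cylinder functions of the form $\sum_{x\in\mathbb Z^2}(a\eta^a_x+b\eta^p_x+c\eta^{a,\omega}_x+d\eta^{p,\omega}_x)F_x$ with $a,b,c,d\in\mathbb R$, where every $F_x$ depends only on the occupation variables $(\eta_y)_{y}$. Let $\mathcal T^\omega_0$ be the set of those $h\in T^\omega$ such that, for every box $B_l=\{-l,\dots,l\}^2$ containing the sites on which $h$ depends, $h$ has mean zero under every canonical measure on $B_l$ with at least two empty sites, that is, under the uniform distribution over the rearrangements in $B_l$ of any given particles (types and angles) in number at most $|B_l|-2$. A differential form is a family $\mathfrak u=(\mathfrak u_{x,x+z})_{x\in\mathbb Z^2,|z|=1}$ of functions in $L^2(\mu_{\hat{\boldsymbol\alpha}})$ with $\mathfrak u_{x,x+z}=\eta_x(1-\eta_{x+z})\mathfrak u_{x,x+z}$ on $\Sigma_\infty$. It is closed if, for every $\hat\eta\in\Sigma_\infty$ and every finite sequence of nearest-neighbour jumps of particles to empty sites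 that starts from $\hat\eta$ and ends at $\hat\eta$, the sum of the values of $\mathfrak u$ along the sequence (each taken at the configuration just before the jump) is $0$. A pair $\mathfrak U=(\mathfrak u_1,\mathfrak u_2)$ of functions in $L^2(\mu_{\hat{\boldsymbol\alpha}})$ is a germ of a closed form if $\mathfrak u_{x,x+e_i}=\tau_x\mathfrak u_i$, $\mathfrak u_{x,x-e_i}(\hat\eta)=-\mathfrak u_{x-e_i,x}(\hat\eta^{x,x-e_i})$, $i=1,2$, defines a closed form. For a cylinder function $h$ put $$\boldsymbol\nabla\Sigma_h=\Big(\eta_0(1-\eta_{e_i})\sum_{x\in\mathbb Z^2}\big(\tau_xh(\hat\eta^{0,e_i})-\tau_xh(\hat\eta)\big)\Big)_{i=1,2},$$ and let $\mathfrak j^{\sigma,\Phi,i}$ be the pair with $k$-th component $\delta_{i,k}\,\eta_0^{\sigma,\Phi}(1-\eta_{e_i})$, with $\mathfrak j^{\sigma,i}=\mathfrak j^{\sigma,1,i}$. In the space of pairs with norm $\mathbb E_{\mu_{\hat{\boldsymbol\alpha}}}[\mathfrak u_1^2+\mathfrak u_2^2]^{1/2}$, let $\mathfrak T^\omega$ be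 the closure of the set of germs of closed forms with both components in $T^\omega$, let $\mathfrak E^\omega$ be the closure of $\{\boldsymbol\nabla\Sigma_h : h\in\mathcal T_0^\omega\}$, and let $\mathfrak J^\omega$ be the (finite-dimensional) span of $\mathfrak j^{a,i},\mathfrak j^{p,i},\mathfrak j^{a,\omega,i},\mathfrak j^{p,\omega,i}$, $i=1,2$. Then $\mathfrak T^\omega$ and $\mathfrak E^\omega$ are linear subspaces, and $$\mathfrak T^\omega=\mathfrak E^\omega\oplus\mathfrak J^\omega ,$$ that is, $\mathfrak T^\omega=\mathfrak E^\omega+\mathfrak J^\omega$ and $\mathfrak E^\omega\cap\mathfrak J^\omega=\{0\}$. -/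

import Mathlib

open MeasureTheory
open scoped ENNReal

noncomputable section

namespace ActivePassive

/-! ### Configurations -/

/-- The angular domain, the circle of length `2π`. -/
abbrev Angle : Type := AddCircle (2 * Real.pi)

/-- The two types of particles. -/
inductive Species
  | active
  | passive
  deriving DecidableEq

instance : MeasurableSpace (Option Species) := ⊤

/-- The state of one site: `none` (empty) or `some σ` (a particle of type `σ`), with an angle
that is `0` by convention at an empty site. -/
abbrev SiteState : Type := {s : Option Species × Angle // s.1 = none → s.2 = 0}

/-- The lattice `ℤ²`. -/
abbrev Z2 : Type := ℤ × ℤ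

/-- The space `Σ_∞` of infinite configurations. -/
abbrev Config : Type := Z2 → SiteState

/-- The canonical basis `e_1, e_2` of the lattice. -/
def e (i : Fin 2) : Z2 := if i = 0 then (1, 0) else (0, 1)

def SiteState.empty : SiteState := ⟨(none, 0), fun _ => rfl⟩

def SiteState.particle (σ : Species) (θ : Angle) : SiteState :=
  ⟨(some σ, θ), fun h => nomatch h⟩

/-- Change of the angle of the particle at a site; nothing happens at an empty site. -/
def SiteState.withAngle (s : SiteState) (θ : Angle) : SiteState :=
  match s.1.1 with
  | none => s
  | some σ => SiteState.particle σ θ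

/-- The number, `0` or `1`, of particles of type `σ` at a site. -/
def SiteState.count (s : SiteState) (σ : Species) : ℝ := if s.1.1 = some σ then 1 else 0

/-- `η_x^σ ∈ {0, 1}`. -/
def num (σ : Species) (x : Z2) (η : Config) : ℝ := (η x).count σ

/-- `η_x = η_x^a + η_x^p`. -/
def occ (x : Z2) (η : Config) : ℝ := num .active x η + num .passive x η

/-- `η_x^{σ,Φ} = Φ(θ_x) η_x^σ`. -/
def numW (σ : Species) (Φ : Angle → ℝ) (x : Z2) (η : Config) : ℝ := Φ (η x).1.2 * num σ x η

/-- The translated configuration: `τ_x f (η) = f (shift x η)`. -/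
def shift (x : Z2) (η : Config) : Config := fun y => η (y + x)

/-- `η^{x,y}`, the states of the sites `x` and `y` being exchanged. -/
def swap (x y : Z2) (η : Config) : Config :=
  fun w => η (Equiv.swap x y w)

/-- A twice continuously differentiable function on the circle. -/
def IsC2 (Φ : Angle → ℝ) : Prop := ContDiff ℝ 2 (fun t : ℝ => Φ (t : Angle))

/-! ### Grand canonical measures -/

/-- A grand canonical parameter: two non-negative measures on the circle, of total mass at
most one together. -/
structure GrandParam where
  meas : Species → Measure Angle
  mass_le_one : meas .active Set.univ + meas .passive Set.univ ≤ 1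

/-- The law of the state of one site: a particle of type `σ` with an angle in `dθ` with
probability `meas σ (dθ)`, and empty with the remaining probability. -/
def siteMeasure (α : GrandParam) : Measure SiteState :=
  (α.meas .active).map (SiteState.particle .active)
    + (α.meas .passive).map (SiteState.particle .passive)
    + (1 - (α.meas .active Set.univ + α.meas .passive Set.univ)) • Measure.dirac SiteState.empty

theorem measurable_particle (σ : Species) : Measurable (SiteState.particle σ) :=
  Measurable.subtype_mk (measurable_const.prodMk measurable_id)

instance (α : GrandParam) : IsProbabilityMeasure (siteMeasure α) := ⟨by
  simp only [siteMeasure, Measure.add_apply, Measure.smul_apply,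
    Measure.map_apply (measurable_particle _) MeasurableSet.univ, Set.preimage_univ,
    measure_univ, smul_eq_mul, mul_one]
  exact add_tsub_cancel_of_le α.mass_le_one⟩

/-- The grand canonical measure with parameter `α`: the product measure on `Σ_∞`. -/
def grandMeasure (α : GrandParam) : Measure Config :=
  Measure.infinitePi (fun _ : Z2 => siteMeasure α)

/-! ### Cylinder functions and the class `T^ω` -/

/-- A cylinder function: it depends on finitely many sites and is `C²` in each angle. -/
def IsCylinder (f : Config → ℝ) : Prop :=
  (∃ s : Finset Z2, DependsOn f (s : Set Z2)) ∧
    ∀ (η : Config) (x : Z2),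
      ContDiff ℝ 2 (fun t : ℝ => f (Function.update η x ((η x).withAngle (t : Angle))))

/-- The box `B_l = [-l, l]²`. -/
def box (l : ℕ) : Finset Z2 := Finset.Icc (-(l : ℤ), -(l : ℤ)) ((l : ℤ), (l : ℤ))

/-- Mean of `ψ` under the canonical measure on the box `B_l` with the particles (types and
angles) that `ζ` has there: all rearrangements of these particles inside the box are equally
likely. Outside the box the configuration is kept, which is irrelevant for functions that
depend on the sites of the box only. -/
def canonicalMean (l : ℕ) (ζ : Config) (ψ : Config → ℝ) : ℝ :=
  (∑ π : Equiv.Perm {x // x ∈ box l}, ψ (fun x => ζ (Equiv.Perm.ofSubtype π x))) /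
    (Fintype.card (Equiv.Perm {x // x ∈ box l}) : ℝ)

/-- The class `𝒞₀` of cylinder functions with mean zero under every canonical measure with at
least two empty sites, on every box that carries the function. -/
def IsCenteredCylinder (ψ : Config → ℝ) : Prop :=
  IsCylinder ψ ∧
    ∀ l : ℕ, DependsOn ψ (box l : Set Z2) →
      ∀ ζ : Config,
        (∃ x ∈ box l, ∃ y ∈ box l, x ≠ y ∧ (ζ x).1.1 = none ∧ (ζ y).1.1 = none) →
          canonicalMean l ζ ψ = 0

/-- Functions that see only which sites are occupied: they are blind to types and angles. -/
def IsBlind (F : Config → ℝ) : Prop :=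
  ∀ η ξ : Config, (∀ x, (η x).1.1 = none ↔ (ξ x).1.1 = none) → F η = F ξ

/-- The space `T^ω`: the span of the cylinder functions
`∑_x (a η_x^a + b η_x^p + c η_x^{a,ω} + d η_x^{p,ω}) F_x(η)` with blind `F_x`. -/
def Tω (ω : Angle → ℝ) : Submodule ℝ (Config → ℝ) :=
  Submodule.span ℝ {f | IsCylinder f ∧
    ∃ (a b c d : ℝ) (F : Z2 → Config → ℝ), (∀ x, IsBlind (F x)) ∧
      ∀ η, HasSum (fun x => (a * num .active x η + b * num .passive x η
        + c * numW .active ω x η + d * numW .passive ω x η) * F x η) (f η)}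

/-! ### Closed forms -/

/-- A nearest-neighbour jump: from the site `src` in the direction `e_i` (if `fwd` is `true`)
or `-e_i` (if `fwd` is `false`). -/
structure Jump where
  src : Z2
  dir : Fin 2
  fwd : Bool

/-- The site at which a jump ends. -/
def Jump.tgt (j : Jump) : Z2 := if j.fwd then j.src + e j.dir else j.src - e j.dir

/-- The configuration after a jump. -/
def Jump.apply (j : Jump) (η : Config) : Config := swap j.src j.tgt η

/-- A path of jumps that can be performed one after the other, starting from `η`. -/
def IsLicit : Config → List Jump → Prop
  | _, [] => True
  | η, j :: γ => occ j.src η * (1 - occ j.tgt η) = 1 ∧ IsLicit (j.apply η) γ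

/-- The final configuration of a path that starts from `η`. -/
def pathEnd : Config → List Jump → Config
  | η, [] => η
  | η, j :: γ => pathEnd (j.apply η) γ

/-- The integral of `u` along a path that starts from `η`. -/
def pathIntegral (u : Jump → Config → ℝ) : Config → List Jump → ℝ
  | _, [] => 0
  | η, j :: γ => u j η + pathIntegral u (j.apply η) γ

/-- Differential forms: collections of `L²` functions, one for each nearest-neighbour jump, that
vanish where the jump cannot be performed. -/
def IsDifferentialForm (α : GrandParam) (u : Jump → Config → ℝ) : Prop :=
  ∀ j, MemLp (u j) 2 (grandMeasure α) ∧ ∀ η, u j η = occ j.src η * (1 - occ j.tgt η) * u j η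

/-- Closed forms: the integral along every licit closed path vanishes. -/
def IsClosedForm (α : GrandParam) (u : Jump → Config → ℝ) : Prop :=
  IsDifferentialForm α u ∧
    ∀ (η : Config) (γ : List Jump), IsLicit η γ → pathEnd η γ = η → pathIntegral u η γ = 0

/-- The form generated by a pair `U = (u_1, u_2)`: `u_{x,x+e_i} = τ_x u_i` and
`u_{x,x-e_i}(η) = - u_{x-e_i,x}(η^{x,x-e_i})`. -/
def germForm (U : Config → EuclideanSpace ℝ (Fin 2)) (j : Jump) (η : Config) : ℝ :=
  if j.fwd then U (shift j.src η) j.dir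
  else - U (shift (j.src - e j.dir) (swap j.src (j.src - e j.dir) η)) j.dir

/-- Germs of closed forms. -/
def IsClosedGerm (α : GrandParam) (U : Config → EuclideanSpace ℝ (Fin 2)) : Prop :=
  MemLp U 2 (grandMeasure α) ∧ IsClosedForm α (germForm U)

/-- The pair `∇Σ_h = (∇_{0,e_1} Σ_h, ∇_{0,e_2} Σ_h)` for the formal sum `Σ_h = ∑_x τ_x h`; for
a local function `h` only finitely many differences are non-zero. -/
def gradSum (h : Config → ℝ) (η : Config) : EuclideanSpace ℝ (Fin 2) :=
  WithLp.toLp 2 fun i =>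
    occ 0 η * (1 - occ (e i) η) * ∑ᶠ x : Z2, (h (shift x (swap 0 (e i) η)) - h (shift x η))

/-- The germ of a current form: its `k`-th component is `δ_{i,k} η_0^{σ,Φ} (1 - η_{e_i})`. -/
def currentGerm (σ : Species) (Φ : Angle → ℝ) (i : Fin 2) (η : Config) :
    EuclideanSpace ℝ (Fin 2) :=
  EuclideanSpace.single i (numW σ Φ 0 η * (1 - occ (e i) η))

/-! ### The spaces of germs in `L²` -/

/-- The space of pairs of `L²(μ_α)` functions, with the norm `E[u_1² + u_2²]^{1/2}`. -/
abbrev L2 (α : GrandParam) : Type := Lp (EuclideanSpace ℝ (Fin 2)) 2 (grandMeasure α)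

/-- The classes in `L²` of the germs of closed forms with components in `T^ω`. -/
def closedGerms (α : GrandParam) (ω : Angle → ℝ) : Set (L2 α) :=
  {g | ∃ U : Config → EuclideanSpace ℝ (Fin 2), IsClosedGerm α U ∧
    (∀ i, (fun η => U η i) ∈ Tω ω) ∧ g =ᵐ[grandMeasure α] U}

/-- The classes in `L²` of the germs `∇Σ_h` with `h` in `𝒞₀ ∩ T^ω`. -/
def exactGerms (α : GrandParam) (ω : Angle → ℝ) : Set (L2 α) :=
  {g | ∃ h : Config → ℝ, IsCenteredCylinder h ∧ h ∈ Tω ω ∧ g =ᵐ[grandMeasure α] gradSum h}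

/-- The span of the germs of the current forms `j^{σ,i}` and `j^{σ,ω,i}`, for both types `σ` and
`i = 1, 2`. -/
def currentForms (α : GrandParam) (ω : Angle → ℝ) : Submodule ℝ (L2 α) :=
  Submodule.span ℝ {g | ∃ (σ : Species) (i : Fin 2),
    g =ᵐ[grandMeasure α] currentGerm σ (fun _ => 1) i ∨ g =ᵐ[grandMeasure α] currentGerm σ ω i}

end ActivePassive

end

open ActivePassive

noncomputable section

namespace ActivePassive

/-! ### Site states and relabelling of sites -/

/-! The class `Tω` is the span of the products `ψ (η y) * F η`, with `ψ` in the span of the one-site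
observables and `F` blind and local (`Tω_eq_weightedSpan`). Such functions are local, bounded and
measurable, and stable under relabelling of sites.

Algebraic part: a closed germ in this class equals `∇Σ_h` plus a current pointwise, without any
limit (`IsClosedGerm.eq_germ`). The values of the germ on a lone particle at the origin determine
the current. After subtraction of this current an isolated particle moves for free, so a particle
can be sent to infinity at a finite cost. A finite configuration is emptied by sending its particles
to the right, the lexicographically last one first. The cost of each exit depends only on the
earlier particles within a fixed range, so minus the total cost is a sum of translates of a local
function. Comparing pairs of paths with the same ends, closedness shows that this sum is a potential
(`IsIsolatedClosed.sumShift_swap`); locality extends the identity to infinite configurations.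
Conversely a current has the formal potential `∑ x_i ψ_i(η_x)`, so these sums are all closed, and
the closed germs are exactly `gradSpace ⊔ currentForms` (`closedGerms_eq`). Since the currents form
a finite-dimensional space, taking the closure only closes the first summand.

Centring: subtracting from `h` its canonical average on a box of side `2l+1` changes `∇Σ_h` by
`O(1/l)`, so the condition that `h` is centred does not affect the closure (`closure_exactGerms`).

Directness (`eq_zero_of_mem_closure`): suppose a current is approximated by exact germs, so that
some `germ h ψ` is small in `L²`. A hole moved around a plaquette rotates the states of the sites
`0`, `e_i`, `e_j`. Tested against `ψ_i(η_0)`, the change of the potential has, by exchangeability,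
no contribution from `h`, and the current contributes `(1/2) E[(ψ_i(η_0) - ψ_i(η_{e_i}))²]`. The
same quantity is at most a constant times the norm of `germ h ψ`: the nearest hole on a ray is `k`
steps away with a probability that is geometrically small in `k`, and it can be fetched and returned
in `2k+4` jumps. Hence `ψ_i(η_0) = ψ_i(η_{e_i})` almost surely, and the current vanishes because
`ψ_i` is zero at an empty site. At density one there are no holes and all currents vanish. -/

theorem SiteState.eq_empty_iff {s : SiteState} : s = SiteState.empty ↔ s.1.1 = none := by
  constructor
  · rintro rfl; rfl
  · intro h
    exact Subtype.ext (Prod.ext h (s.2 h))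

theorem SiteState.count_empty (σ : Species) : SiteState.empty.count σ = 0 := by
  simp [SiteState.count, SiteState.empty]

theorem occ_of_empty {x : Z2} {η : Config} (h : η x = SiteState.empty) : occ x η = 0 := by
  simp [occ, num, h, SiteState.count_empty]

theorem occ_of_ne_empty {x : Z2} {η : Config} (h : η x ≠ SiteState.empty) : occ x η = 1 := by
  rw [Ne, SiteState.eq_empty_iff] at h
  rcases hs : (η x).1.1 with _ | σ
  · exact absurd hs h
  · cases σ <;> simp [occ, num, SiteState.count, hs]

theorem licit_iff {x y : Z2} {η : Config} :
    occ x η * (1 - occ y η) = 1 ↔ η x ≠ SiteState.empty ∧ η y = SiteState.empty := by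
  by_cases hx : η x = SiteState.empty <;> by_cases hy : η y = SiteState.empty <;>
    simp [occ_of_empty, occ_of_ne_empty, hx, hy]

theorem licit_mul_eq_zero {x y : Z2} {η : Config}
    (h : ¬ (η x ≠ SiteState.empty ∧ η y = SiteState.empty)) :
    occ x η * (1 - occ y η) = 0 := by
  by_cases hx : η x = SiteState.empty
  · simp [occ_of_empty hx]
  · have hy : η y ≠ SiteState.empty := fun hy => h ⟨hx, hy⟩
    simp [occ_of_ne_empty hy]

/-- The configuration that has at `x` the state of `η` at `g x`, or is empty at `x` if
`g x = none`. -/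
def relabel (g : Z2 → Option Z2) (η : Config) : Config :=
  fun x => (g x).elim SiteState.empty η

theorem shift_shift (x y : Z2) (η : Config) : shift x (shift y η) = shift (x + y) η := by
  funext w; simp [shift, add_assoc]

theorem shift_zero (η : Config) : shift 0 η = η := by funext w; simp [shift]

theorem swap_swap (x y : Z2) (η : Config) : swap x y (swap x y η) = η := by
  funext w; simp [swap]

theorem swap_left (x y : Z2) (η : Config) : swap x y η x = η y := by simp [swap]

theorem swap_right (x y : Z2) (η : Config) : swap x y η y = η x := by simp [swap]

theorem swap_of_ne {x y w : Z2} (η : Config) (hx : w ≠ x) (hy : w ≠ y) :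
    swap x y η w = η w := by simp [swap, Equiv.swap_apply_of_ne_of_ne hx hy]

theorem swap_comm (x y : Z2) (η : Config) : swap x y η = swap y x η := by
  funext w; rw [swap, swap, Equiv.swap_comm]

theorem swap_shift (a b x : Z2) (η : Config) :
    swap a b (shift x η) = shift x (swap (a + x) (b + x) η) := by
  funext w
  simp only [swap, shift]
  congr 1
  rcases eq_or_ne w a with rfl | h1
  · simp
  rcases eq_or_ne w b with rfl | h2
  · simp
  rw [Equiv.swap_apply_of_ne_of_ne h1 h2, Equiv.swap_apply_of_ne_of_ne] <;> simpa

theorem swap_eq_self {x y : Z2} {η : Config} (h : η x = η y) : swap x y η = η := by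
  funext w
  rcases eq_or_ne w x with rfl | h1
  · rw [swap_left, h]
  rcases eq_or_ne w y with rfl | h2
  · rw [swap_right, h]
  exact swap_of_ne η h1 h2

theorem occ_shift (x y : Z2) (η : Config) : occ x (shift y η) = occ (x + y) η := rfl

theorem e_ne_zero (i : Fin 2) : e i ≠ 0 := by
  fin_cases i <;> simp [e, Prod.ext_iff]

/-! ### Blind local functions -/

/-- A function that depends on finitely many sites. -/
def IsLocal (f : Config → ℝ) : Prop := ∃ s : Finset Z2, DependsOn f (s : Set Z2)

theorem IsLocal.add {f g : Config → ℝ} (hf : IsLocal f) (hg : IsLocal g) : IsLocal (f + g) := by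
  obtain ⟨s, hs⟩ := hf
  obtain ⟨t, ht⟩ := hg
  refine ⟨s ∪ t, fun η ξ h => ?_⟩
  rw [Pi.add_apply, Pi.add_apply, hs fun x hx => h x (by simp [Finset.mem_coe.1 hx]),
    ht fun x hx => h x (by simp [Finset.mem_coe.1 hx])]

theorem IsLocal.mul {f g : Config → ℝ} (hf : IsLocal f) (hg : IsLocal g) : IsLocal (f * g) := by
  obtain ⟨s, hs⟩ := hf
  obtain ⟨t, ht⟩ := hg
  refine ⟨s ∪ t, fun η ξ h => ?_⟩
  rw [Pi.mul_apply, Pi.mul_apply, hs fun x hx => h x (by simp [Finset.mem_coe.1 hx]),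
    ht fun x hx => h x (by simp [Finset.mem_coe.1 hx])]

theorem IsLocal.comp_relabel {f : Config → ℝ} (hf : IsLocal f) (g : Z2 → Option Z2) :
    IsLocal fun η => f (relabel g η) := by
  obtain ⟨s, hs⟩ := hf
  refine ⟨s.biUnion fun x => (g x).toFinset, fun η ξ h => hs fun x hx => ?_⟩
  rcases hg : g x with _ | y
  · simp [relabel, hg]
  · have := h y (by simp only [Finset.coe_biUnion, Set.mem_iUnion]
                    exact ⟨x, hx, by simp [hg]⟩)
    simpa [relabel, hg] using this

theorem isLocal_apply (ψ : SiteState → ℝ) (y : Z2) : IsLocal fun η => ψ (η y) :=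
  ⟨{y}, fun η ξ h => by simp [h y (by simp)]⟩

theorem IsBlind.mul {f g : Config → ℝ} (hf : IsBlind f) (hg : IsBlind g) : IsBlind (f * g) :=
  fun η ξ h => by rw [Pi.mul_apply, Pi.mul_apply, hf η ξ h, hg η ξ h]

theorem IsBlind.comp_relabel {f : Config → ℝ} (hf : IsBlind f) (g : Z2 → Option Z2) :
    IsBlind fun η => f (relabel g η) := by
  refine fun η ξ h => hf _ _ fun x => ?_
  rcases hg : g x with _ | y <;> simp [relabel, hg, h]

theorem isBlind_occ (x : Z2) : IsBlind (occ x) := by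
  intro η ξ h
  by_cases hx : η x = SiteState.empty
  · have : ξ x = SiteState.empty := by rwa [SiteState.eq_empty_iff, ← h, ← SiteState.eq_empty_iff]
    rw [occ_of_empty hx, occ_of_empty this]
  · have : ξ x ≠ SiteState.empty := by
      rwa [Ne, SiteState.eq_empty_iff, ← h, ← SiteState.eq_empty_iff]
    rw [occ_of_ne_empty hx, occ_of_ne_empty this]

theorem isLocal_occ (x : Z2) : IsLocal (occ x) :=
  isLocal_apply (fun s => s.count .active + s.count .passive) x

theorem isBlind_licit (x y : Z2) : IsBlind fun η => occ x η * (1 - occ y η) :=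
  fun η ξ h => by simp [isBlind_occ x η ξ h, isBlind_occ y η ξ h]

theorem isLocal_licit (x y : Z2) : IsLocal fun η => occ x η * (1 - occ y η) :=
  (isLocal_occ x).mul ⟨{y}, fun η ξ h => by simp [occ, num, h y (by simp)]⟩

theorem isBlind_vacant (y : Z2) : IsBlind fun η => 1 - occ y η :=
  fun η ξ h => by simp [isBlind_occ y η ξ h]

theorem isLocal_vacant (y : Z2) : IsLocal fun η => 1 - occ y η :=
  ⟨{y}, fun η ξ h => by simp [occ, num, h y (by simp)]⟩

theorem isBlind_const (a : ℝ) : IsBlind fun _ => a := fun _ _ _ => rfl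

theorem isLocal_const (a : ℝ) : IsLocal fun _ => a := ⟨∅, fun _ _ _ => rfl⟩

instance : Finite Species :=
  Finite.of_surjective (fun b : Bool => if b then Species.active else Species.passive)
    fun σ => by cases σ; exacts [⟨true, rfl⟩, ⟨false, rfl⟩]

/-- A blind function does not notice when all angles are set to `0`, and a local one does not notice
when the sites outside its window are emptied. What remains is a function on a finite set, which
gives boundedness and measurability for free. -/
theorem blind_local_factor {F : Config → ℝ} (hF : IsBlind F) (hl : IsLocal F) :
    ∃ (s : Finset Z2) (G : (s → Option Species) → ℝ), ∀ η, F η = G fun x => (η x).1.1 := by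
  obtain ⟨s, hs⟩ := hl
  classical
  refine ⟨s, fun v => F fun x => if h : x ∈ s then
    (match v ⟨x, h⟩ with
      | none => SiteState.empty
      | some σ => SiteState.particle σ 0) else SiteState.empty, fun η => ?_⟩
  have h1 : F η = F (relabel (fun x => if x ∈ s then some x else none) η) :=
    hs fun x hx => by simp [relabel, Finset.mem_coe.1 hx]
  rw [h1]
  refine hF _ _ fun x => ?_
  by_cases hx : x ∈ s
  · rcases h : (η x).1.1 with _ | σ <;> simp [relabel, hx, h, SiteState.empty, SiteState.particle]
  · simp [relabel, hx]

theorem blind_local_bounded {F : Config → ℝ} (hF : IsBlind F) (hl : IsLocal F) :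
    ∃ C, ∀ η, |F η| ≤ C := by
  obtain ⟨s, G, hG⟩ := blind_local_factor hF hl
  obtain ⟨C, hC⟩ := (Set.finite_range fun v => |G v|).bddAbove
  exact ⟨C, fun η => by rw [hG]; exact hC ⟨_, rfl⟩⟩

theorem measurable_type (x : Z2) : Measurable fun η : Config => (η x).1.1 :=
  (measurable_fst.comp measurable_subtype_coe).comp (measurable_pi_apply x)

instance : MeasurableSingletonClass (Option Species) := ⟨fun _ => trivial⟩

theorem blind_local_measurable {F : Config → ℝ} (hF : IsBlind F) (hl : IsLocal F) :
    Measurable F := by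
  obtain ⟨s, G, hG⟩ := blind_local_factor hF hl
  have : F = G ∘ fun η (x : s) => (η x).1.1 := funext hG
  rw [this]
  exact (Measurable.of_discrete).comp (measurable_pi_lambda _ fun x => measurable_type _)

/-! ### The span of weighted blind functions -/

/-- The span of the one-site observables `η^σ` and `η^{σ,ω}`. -/
def siteSpan (ω : Angle → ℝ) : Submodule ℝ (SiteState → ℝ) :=
  Submodule.span ℝ {ψ | ∃ σ : Species, ψ = (fun s => s.count σ) ∨
    ψ = fun s => ω s.1.2 * s.count σ}

theorem siteSpan_empty {ω : Angle → ℝ} {ψ : SiteState → ℝ} (hψ : ψ ∈ siteSpan ω) :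
    ψ SiteState.empty = 0 := by
  induction hψ using Submodule.span_induction with
  | mem ψ h => obtain ⟨σ, rfl | rfl⟩ := h <;> simp [SiteState.count_empty]
  | zero => rfl
  | add f g _ _ hf hg => simp [hf, hg]
  | smul a f _ hf => simp [hf]

theorem siteSpan_coeff {ω : Angle → ℝ} {ψ : SiteState → ℝ} (hψ : ψ ∈ siteSpan ω) :
    ∃ a b c d : ℝ, ∀ s, ψ s = a * s.count .active + b * s.count .passive
      + c * (ω s.1.2 * s.count .active) + d * (ω s.1.2 * s.count .passive) := by
  induction hψ using Submodule.span_induction with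
  | mem ψ h =>
    obtain ⟨σ, rfl | rfl⟩ := h <;> cases σ
    · exact ⟨1, 0, 0, 0, fun s => by simp⟩
    · exact ⟨0, 1, 0, 0, fun s => by simp⟩
    · exact ⟨0, 0, 1, 0, fun s => by simp⟩
    · exact ⟨0, 0, 0, 1, fun s => by simp⟩
  | zero => exact ⟨0, 0, 0, 0, fun s => by simp⟩
  | add f g _ _ hf hg =>
    obtain ⟨a, b, c, d, h⟩ := hf
    obtain ⟨a', b', c', d', h'⟩ := hg
    exact ⟨a + a', b + b', c + c', d + d', fun s => by rw [Pi.add_apply, h, h']; ring⟩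
  | smul t f _ hf =>
    obtain ⟨a, b, c, d, h⟩ := hf
    exact ⟨t * a, t * b, t * c, t * d, fun s => by rw [Pi.smul_apply, h, smul_eq_mul]; ring⟩

theorem coeff_mem_siteSpan (ω : Angle → ℝ) (a b c d : ℝ) :
    (fun s : SiteState => a * s.count .active + b * s.count .passive
      + c * (ω s.1.2 * s.count .active) + d * (ω s.1.2 * s.count .passive)) ∈ siteSpan ω := by
  have h1 : ∀ σ, (fun s : SiteState => s.count σ) ∈ siteSpan ω :=
    fun σ => Submodule.subset_span ⟨σ, Or.inl rfl⟩
  have h2 : ∀ σ, (fun s : SiteState => ω s.1.2 * s.count σ) ∈ siteSpan ω :=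
    fun σ => Submodule.subset_span ⟨σ, Or.inr rfl⟩
  exact add_mem (add_mem (add_mem ((siteSpan ω).smul_mem a (h1 _))
    ((siteSpan ω).smul_mem b (h1 _))) ((siteSpan ω).smul_mem c (h2 _)))
    ((siteSpan ω).smul_mem d (h2 _))

theorem continuous_of_isC2 {ω : Angle → ℝ} (hω : IsC2 ω) : Continuous ω := by
  have h : Continuous fun t : ℝ => ω (t : Angle) := ContDiff.continuous hω
  exact (QuotientAddGroup.isQuotientMap_mk
      (AddSubgroup.zmultiples (2 * Real.pi))).continuous_iff.2 h

theorem count_le_one (s : SiteState) (σ : Species) : |s.count σ| ≤ 1 := by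
  unfold SiteState.count; split_ifs <;> simp

instance : Fact (0 < 2 * Real.pi) := ⟨by positivity⟩

theorem siteSpan_bounded {ω : Angle → ℝ} (hω : IsC2 ω) {ψ : SiteState → ℝ}
    (hψ : ψ ∈ siteSpan ω) : ∃ C, ∀ s, |ψ s| ≤ C := by
  obtain ⟨C, hC⟩ := (isCompact_univ (X := Angle)).exists_bound_of_continuousOn
    (continuous_of_isC2 hω).continuousOn
  have hC0 : 0 ≤ C := (norm_nonneg _).trans (hC 0 trivial)
  induction hψ using Submodule.span_induction with
  | mem ψ h =>
    obtain ⟨σ, rfl | rfl⟩ := h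
    · exact ⟨1, fun s => count_le_one s σ⟩
    · refine ⟨C * 1, fun s => ?_⟩
      rw [abs_mul]
      exact mul_le_mul (hC _ trivial) (count_le_one s σ) (abs_nonneg _) hC0
  | zero => exact ⟨0, fun s => by simp⟩
  | add f g _ _ hf hg =>
    obtain ⟨a, h⟩ := hf
    obtain ⟨b, h'⟩ := hg
    exact ⟨a + b, fun s => (abs_add_le _ _).trans (add_le_add (h s) (h' s))⟩
  | smul t f _ hf =>
    obtain ⟨a, h⟩ := hf
    exact ⟨|t| * a, fun s => by
      rw [Pi.smul_apply, smul_eq_mul, abs_mul]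
      exact mul_le_mul_of_nonneg_left (h s) (abs_nonneg _)⟩

theorem measurable_count (σ : Species) : Measurable fun s : SiteState => s.count σ :=
  (Measurable.of_discrete (f := fun o : Option Species => if o = some σ then (1 : ℝ) else 0)).comp
    (measurable_fst.comp measurable_subtype_coe)

theorem siteSpan_measurable {ω : Angle → ℝ} (hω : IsC2 ω) {ψ : SiteState → ℝ}
    (hψ : ψ ∈ siteSpan ω) : Measurable ψ := by
  have h2 : Measurable fun s : SiteState => ω s.1.2 :=
    (continuous_of_isC2 hω).measurable.comp (measurable_snd.comp measurable_subtype_coe)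
  obtain ⟨a, b, c, d, h⟩ := siteSpan_coeff hψ
  rw [funext h]
  have h1 := measurable_count
  exact ((((h1 _).const_mul a).add ((h1 _).const_mul b)).add
    ((h2.mul (h1 _)).const_mul c)).add ((h2.mul (h1 _)).const_mul d)

/-- The span of the products of a one-site observable with a blind local function. -/
def weightedSpan (ω : Angle → ℝ) : Submodule ℝ (Config → ℝ) :=
  Submodule.span ℝ {f | ∃ ψ ∈ siteSpan ω, ∃ (y : Z2) (F : Config → ℝ), IsBlind F ∧ IsLocal F ∧
    f = fun η => ψ (η y) * F η}

theorem mul_mem_weightedSpan {ω : Angle → ℝ} {ψ : SiteState → ℝ} (hψ : ψ ∈ siteSpan ω) (y : Z2)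
    {F : Config → ℝ} (hF : IsBlind F) (hl : IsLocal F) :
    (fun η => ψ (η y) * F η) ∈ weightedSpan ω :=
  Submodule.subset_span ⟨ψ, hψ, y, F, hF, hl, rfl⟩

/-- Relabelling covers translations, permutations and the emptying of sites at once. Where the
observed site is emptied the product is zero, because one-site observables vanish at empty sites. -/
theorem weightedSpan_comp_relabel {ω : Angle → ℝ} {f : Config → ℝ} (hf : f ∈ weightedSpan ω)
    (g : Z2 → Option Z2) : (fun η => f (relabel g η)) ∈ weightedSpan ω := by
  induction hf using Submodule.span_induction with
  | mem f h =>
    obtain ⟨ψ, hψ, y, F, hF, hl, rfl⟩ := h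
    rcases hg : g y with _ | z
    · convert (weightedSpan ω).zero_mem using 1
      funext η
      simp [relabel, hg, siteSpan_empty hψ]
    · convert mul_mem_weightedSpan hψ z (hF.comp_relabel g) (hl.comp_relabel g) using 1
      funext η
      simp [relabel, hg]
  | zero => exact (weightedSpan ω).zero_mem
  | add f₁ f₂ _ _ h₁ h₂ => exact add_mem h₁ h₂
  | smul a f _ h => exact (weightedSpan ω).smul_mem a h

theorem weightedSpan_comp_shift {ω : Angle → ℝ} {f : Config → ℝ} (hf : f ∈ weightedSpan ω)
    (x : Z2) : (fun η => f (shift x η)) ∈ weightedSpan ω :=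
  weightedSpan_comp_relabel hf fun w => some (w + x)

theorem mul_weightedSpan {ω : Angle → ℝ} {f F : Config → ℝ} (hf : f ∈ weightedSpan ω)
    (hF : IsBlind F) (hl : IsLocal F) : F * f ∈ weightedSpan ω := by
  induction hf using Submodule.span_induction with
  | mem f h =>
    obtain ⟨ψ, hψ, y, G, hG, hl', rfl⟩ := h
    convert mul_mem_weightedSpan hψ y (hF.mul hG) (hl.mul hl') using 1
    funext η
    simp only [Pi.mul_apply]
    ring
  | zero => simp
  | add f₁ f₂ _ _ h₁ h₂ => rw [mul_add]; exact add_mem h₁ h₂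
  | smul a f _ h => rw [mul_smul_comm]; exact (weightedSpan ω).smul_mem a h

theorem weightedSpan_isLocal {ω : Angle → ℝ} {f : Config → ℝ} (hf : f ∈ weightedSpan ω) :
    IsLocal f := by
  induction hf using Submodule.span_induction with
  | mem f h =>
    obtain ⟨ψ, -, y, F, -, hl, rfl⟩ := h
    exact (isLocal_apply ψ y).mul hl
  | zero => exact isLocal_const 0
  | add f₁ f₂ _ _ h₁ h₂ => exact h₁.add h₂
  | smul a f _ h => exact (isLocal_const a).mul h

theorem weightedSpan_bounded {ω : Angle → ℝ} (hω : IsC2 ω) {f : Config → ℝ}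
    (hf : f ∈ weightedSpan ω) : ∃ C, ∀ η, |f η| ≤ C := by
  induction hf using Submodule.span_induction with
  | mem f h =>
    obtain ⟨ψ, hψ, y, F, hF, hl, rfl⟩ := h
    obtain ⟨A, hA⟩ := siteSpan_bounded hω hψ
    obtain ⟨B, hB⟩ := blind_local_bounded hF hl
    refine ⟨A * B, fun η => ?_⟩
    rw [abs_mul]
    exact mul_le_mul (hA _) (hB _) (abs_nonneg _) ((abs_nonneg _).trans (hA SiteState.empty))
  | zero => exact ⟨0, fun η => by simp⟩
  | add f g _ _ hf hg =>
    obtain ⟨a, h⟩ := hf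
    obtain ⟨b, h'⟩ := hg
    exact ⟨a + b, fun s => (abs_add_le _ _).trans (add_le_add (h s) (h' s))⟩
  | smul t f _ hf =>
    obtain ⟨a, h⟩ := hf
    exact ⟨|t| * a, fun s => by
      rw [Pi.smul_apply, smul_eq_mul, abs_mul]
      exact mul_le_mul_of_nonneg_left (h s) (abs_nonneg _)⟩

theorem weightedSpan_measurable {ω : Angle → ℝ} (hω : IsC2 ω) {f : Config → ℝ}
    (hf : f ∈ weightedSpan ω) : Measurable f := by
  induction hf using Submodule.span_induction with
  | mem f h =>
    obtain ⟨ψ, hψ, y, F, hF, hl, rfl⟩ := h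
    exact ((siteSpan_measurable hω hψ).comp (measurable_pi_apply y)).mul
      (blind_local_measurable hF hl)
  | zero => exact measurable_zero
  | add f g _ _ hf hg => exact hf.add hg
  | smul t f _ hf => exact hf.const_smul t

theorem contDiff_angle {ω : Angle → ℝ} (hω : IsC2 ω) {ψ : SiteState → ℝ} (hψ : ψ ∈ siteSpan ω)
    {F : Config → ℝ} (hF : IsBlind F) (y : Z2) (η : Config) (x : Z2) :
    ContDiff ℝ 2 fun t : ℝ => ψ (Function.update η x ((η x).withAngle (t : Angle)) y)
      * F (Function.update η x ((η x).withAngle (t : Angle))) := by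
  have hFt : ∀ t : ℝ, F (Function.update η x ((η x).withAngle (t : Angle))) = F η := by
    refine fun t => hF _ _ fun z => ?_
    rcases eq_or_ne z x with rfl | hz
    · rcases h : (η z).1.1 with _ | σ <;> simp [SiteState.withAngle, h, SiteState.particle]
    · simp [hz]
  simp only [hFt]
  refine ContDiff.mul ?_ contDiff_const
  rcases eq_or_ne y x with rfl | hy
  · simp only [Function.update_self]
    rcases h : (η y).1.1 with _ | σ
    · simp only [SiteState.withAngle, h]; exact contDiff_const
    · obtain ⟨a, b, c, d, hc⟩ := siteSpan_coeff hψ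
      have hω' : ContDiff ℝ 2 fun t : ℝ => ω (t : Angle) := hω
      simp only [SiteState.withAngle, h, hc, SiteState.particle, SiteState.count]
      cases σ <;> simp only [reduceCtorEq, if_true, if_false, Option.some.injEq] <;>
        exact (contDiff_const.add (contDiff_const.mul (hω'.mul contDiff_const))).add
          (contDiff_const.mul (hω'.mul contDiff_const))
  · simp only [Function.update_of_ne hy]; exact contDiff_const

theorem weightedSpan_isCylinder {ω : Angle → ℝ} (hω : IsC2 ω) {f : Config → ℝ}
    (hf : f ∈ weightedSpan ω) : IsCylinder f := by
  refine ⟨weightedSpan_isLocal hf, ?_⟩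
  induction hf using Submodule.span_induction with
  | mem f h =>
    obtain ⟨ψ, hψ, y, F, hF, hl, rfl⟩ := h
    exact contDiff_angle hω hψ hF y
  | zero => exact fun _ _ => contDiff_const
  | add f g _ _ hf hg => exact fun η x => (hf η x).add (hg η x)
  | smul t f _ hf => exact fun η x => (hf η x).const_smul t

/-- The weights `F_x` in the definition need not be local. Evaluating at the configuration emptied
outside the window of `f` changes nothing in `f`, kills all but finitely many terms and makes the
remaining weights local. -/
theorem Tω_eq_weightedSpan {ω : Angle → ℝ} (hω : IsC2 ω) : Tω ω = weightedSpan ω := by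
  classical
  apply le_antisymm
  · refine Submodule.span_le.2 ?_
    rintro f ⟨⟨⟨s, hs⟩, -⟩, a, b, c, d, F, hF, hsum⟩
    set g : Z2 → Option Z2 := fun x => if x ∈ s then some x else none with hg
    have hψ := coeff_mem_siteSpan ω a b c d
    set ψ : SiteState → ℝ := fun s => a * s.count .active + b * s.count .passive
      + c * (ω s.1.2 * s.count .active) + d * (ω s.1.2 * s.count .passive) with hψd
    have key : f = ∑ x ∈ s, fun η => ψ (η x) * F x (relabel g η) := by
      funext η
      have h1 : f η = f (relabel g η) :=
        hs fun x hx => by simp [relabel, hg, Finset.mem_coe.1 hx]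
      have h2 : HasSum (fun x => ψ (relabel g η x) * F x (relabel g η)) (f (relabel g η)) :=
        hsum (relabel g η)
      have h3 := hasSum_sum_of_ne_finset_zero (s := s) (L := SummationFilter.unconditional Z2)
        (f := fun x => ψ (relabel g η x) * F x (relabel g η)) (fun x hx => by
          have : relabel g η x = SiteState.empty := by simp [relabel, hg, hx]
          rw [this, siteSpan_empty hψ, zero_mul])
      rw [h1, h2.unique h3, Finset.sum_apply]
      refine Finset.sum_congr rfl fun x hx => ?_
      have : relabel g η x = η x := by simp [relabel, hg, hx]
      rw [this]
    rw [key]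
    refine Submodule.sum_mem _ fun x _ => mul_mem_weightedSpan hψ x ((hF x).comp_relabel g) ?_
    refine ⟨s, fun η ξ h => ?_⟩
    have : relabel g η = relabel g ξ := by
      funext y
      by_cases hy : y ∈ s
      · simp [relabel, hg, hy, h y hy]
      · simp [relabel, hg, hy]
    simp only [this]
  · refine Submodule.span_le.2 ?_
    rintro f ⟨ψ, hψ, y, F, hF, hl, rfl⟩
    obtain ⟨a, b, c, d, hc⟩ := siteSpan_coeff hψ
    refine Submodule.subset_span ⟨weightedSpan_isCylinder hω (mul_mem_weightedSpan hψ y hF hl),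
      a, b, c, d, fun x => if x = y then F else 0, fun x => ?_, fun η => ?_⟩
    · dsimp only
      split_ifs
      exacts [hF, isBlind_const 0]
    · convert hasSum_single y ?_ using 1
      · simp only [if_true, hc]; rfl
      · intro x hx; simp [hx]

/-- With all other sites empty a blind factor takes a fixed value as soon as the origin is occupied,
so only a one-site observable is left. This is how the current contained in a closed germ is found.
-/
theorem weightedSpan_at_single {ω : Angle → ℝ} {f : Config → ℝ} (hf : f ∈ weightedSpan ω) :
    ∃ ψ ∈ siteSpan ω, ∀ η : Config,
      f (relabel (fun x => if x = 0 then some 0 else none) η) = ψ (η 0) := by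
  induction hf using Submodule.span_induction with
  | mem f h =>
    obtain ⟨ψ, hψ, y, F, hF, hl, rfl⟩ := h
    rcases eq_or_ne y 0 with rfl | hy
    · set ξ : Config := fun x => if x = 0 then SiteState.particle .active 0 else SiteState.empty
      refine ⟨F ξ • ψ, (siteSpan ω).smul_mem _ hψ, fun η => ?_⟩
      by_cases h : η 0 = SiteState.empty
      · simp [relabel, h, siteSpan_empty hψ]
      · have : F (relabel (fun x => if x = 0 then some 0 else none) η) = F ξ := by
          refine hF _ _ fun x => ?_
          rcases eq_or_ne x 0 with rfl | hx
          · simp [relabel, ξ, ← SiteState.eq_empty_iff, h]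
            simp [SiteState.particle, SiteState.empty]
          · simp [relabel, ξ, hx]
        simp only [this]
        simp [relabel, mul_comm]
    · exact ⟨0, (siteSpan ω).zero_mem, fun η => by simp [relabel, hy, siteSpan_empty hψ]⟩
  | zero => exact ⟨0, (siteSpan ω).zero_mem, fun η => rfl⟩
  | add f g _ _ hf hg =>
    obtain ⟨a, ha, h⟩ := hf
    obtain ⟨b, hb, h'⟩ := hg
    exact ⟨a + b, add_mem ha hb, fun η => by simp [h, h']⟩
  | smul t f _ hf =>
    obtain ⟨a, ha, h⟩ := hf
    exact ⟨t • a, (siteSpan ω).smul_mem t ha, fun η => by simp [h]⟩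

/-! ### Invariance of the grand canonical measures -/

/-- The configuration with permuted sites. -/
def permute (π : Equiv.Perm Z2) (η : Config) : Config := fun x => η (π x)

theorem measurePreserving_permute (α : GrandParam) (π : Equiv.Perm Z2) :
    MeasurePreserving (permute π) (grandMeasure α) (grandMeasure α) := by
  refine ⟨measurable_pi_lambda _ fun x => measurable_pi_apply _, ?_⟩
  exact Measure.map_infinitePi_infinitePi_of_inj (P := fun _ : Z2 => siteMeasure α)
    π.injective

theorem measurePreserving_shift (α : GrandParam) (x : Z2) :
    MeasurePreserving (shift x) (grandMeasure α) (grandMeasure α) :=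
  measurePreserving_permute α (Equiv.addRight x)

theorem measurePreserving_swap (α : GrandParam) (x y : Z2) :
    MeasurePreserving (swap x y) (grandMeasure α) (grandMeasure α) :=
  measurePreserving_permute α (Equiv.swap x y)

instance (α : GrandParam) : IsProbabilityMeasure (grandMeasure α) := by
  unfold grandMeasure; infer_instance

/-! ### Differences of formal sums of local functions -/

/-- The difference `∑_x (k_x(ξ) - k_x(η))` of a formal sum between two configurations. -/
def totalDiff (k : Z2 → Config → ℝ) (η ξ : Config) : ℝ := ∑ᶠ x, (k x ξ - k x η)

/-- The function `k_x` depends on the sites in a fixed finite window around `x`. -/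
def IsUniformlyLocal (k : Z2 → Config → ℝ) : Prop :=
  ∃ s : Finset Z2, ∀ (x : Z2) (η ξ : Config), (∀ y ∈ s, η (y + x) = ξ (y + x)) → k x η = k x ξ

/-- Two configurations that differ at finitely many sites only. -/
def FinDiff (η ξ : Config) : Prop := {x | η x ≠ ξ x}.Finite

theorem FinDiff.trans {η ξ ζ : Config} (h : FinDiff η ξ) (h' : FinDiff ξ ζ) : FinDiff η ζ := by
  refine (h.union h').subset fun x hx => ?_
  by_contra hc
  simp only [Set.mem_union, Set.mem_ofPred_eq, not_or, not_not] at hc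
  exact hx (hc.1.trans hc.2)

theorem finDiff_swap (x y : Z2) (η : Config) : FinDiff η (swap x y η) := by
  refine (Set.toFinite {x, y}).subset fun w hw => ?_
  by_contra hc
  simp only [Set.mem_insert_iff, Set.mem_singleton_iff, not_or] at hc
  exact hw (swap_of_ne η hc.1 hc.2).symm

theorem support_totalDiff {k : Z2 → Config → ℝ} (hk : IsUniformlyLocal k) {η ξ : Config}
    (h : FinDiff η ξ) : (Function.support fun x => k x ξ - k x η).Finite := by
  obtain ⟨s, hs⟩ := hk
  have : (⋃ y ∈ s, (fun x => y + x) ⁻¹' {x | η x ≠ ξ x}).Finite :=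
    s.finite_toSet.biUnion fun y _ => h.preimage (add_right_injective y).injOn
  refine this.subset fun x hx => ?_
  by_contra hc
  simp only [Set.mem_iUnion, Set.mem_preimage, Set.mem_ofPred_eq, not_exists, not_not] at hc
  exact hx (sub_eq_zero.2 (hs x ξ η fun y hy => (hc y hy).symm))

theorem totalDiff_trans {k : Z2 → Config → ℝ} (hk : IsUniformlyLocal k) {η ξ ζ : Config}
    (h : FinDiff η ξ) (h' : FinDiff ξ ζ) :
    totalDiff k η ζ = totalDiff k η ξ + totalDiff k ξ ζ := by
  rw [totalDiff, totalDiff, totalDiff,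
    ← finsum_add_distrib (support_totalDiff hk h) (support_totalDiff hk h')]
  exact finsum_congr fun x => by ring

theorem totalDiff_symm (k : Z2 → Config → ℝ) (η ξ : Config) :
    totalDiff k ξ η = - totalDiff k η ξ := by
  rw [totalDiff, totalDiff, ← finsum_neg_distrib]
  exact finsum_congr fun x => by ring

theorem totalDiff_self (k : Z2 → Config → ℝ) (η : Config) : totalDiff k η η = 0 := by
  simp [totalDiff]

theorem totalDiff_add {k k' : Z2 → Config → ℝ} (hk : IsUniformlyLocal k)
    (hk' : IsUniformlyLocal k') {η ξ : Config} (h : FinDiff η ξ) :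
    totalDiff (fun x ζ => k x ζ + k' x ζ) η ξ = totalDiff k η ξ + totalDiff k' η ξ := by
  rw [totalDiff, totalDiff, totalDiff,
    ← finsum_add_distrib (support_totalDiff hk h) (support_totalDiff hk' h)]
  exact finsum_congr fun x => by ring

theorem totalDiff_smul {k : Z2 → Config → ℝ} (a : ℝ) (η ξ : Config) :
    totalDiff (fun x ζ => a * k x ζ) η ξ = a * totalDiff k η ξ := by
  rw [totalDiff, totalDiff, ← smul_eq_mul, smul_finsum]
  exact finsum_congr fun x => by simp only [smul_eq_mul]; ring

theorem IsUniformlyLocal.add {k k' : Z2 → Config → ℝ} (hk : IsUniformlyLocal k)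
    (hk' : IsUniformlyLocal k') : IsUniformlyLocal fun x ζ => k x ζ + k' x ζ := by
  obtain ⟨s, hs⟩ := hk
  obtain ⟨t, ht⟩ := hk'
  refine ⟨s ∪ t, fun x η ξ h => ?_⟩
  simp only [hs x η ξ fun y hy => h y (by simp [hy]), ht x η ξ fun y hy => h y (by simp [hy])]

theorem isUniformlyLocal_shift {h : Config → ℝ} (hh : IsLocal h) :
    IsUniformlyLocal fun x η => h (shift x η) := by
  obtain ⟨s, hs⟩ := hh
  exact ⟨s, fun x η ξ he => hs fun y hy => he y hy⟩

theorem isUniformlyLocal_site (c : Z2 → SiteState → ℝ) :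
    IsUniformlyLocal fun x η => c x (η x) :=
  ⟨{0}, fun x η ξ he => by
    have := he 0 (by simp)
    rw [zero_add] at this
    simp only [this]⟩

/-! ### Germs of exact forms and of currents -/

/-- The coordinates of a lattice point. -/
def coord (x : Z2) (i : Fin 2) : ℤ := if i = 0 then x.1 else x.2

theorem coord_add_e (x : Z2) (i m : Fin 2) :
    coord (x + e i) m = coord x m + if m = i then 1 else 0 := by
  fin_cases i <;> fin_cases m <;> simp [coord, e]

/-- The moment `∑_i x_i ψ_i` of a state at the site `x`. -/
def moment (ψ : Fin 2 → SiteState → ℝ) (x : Z2) (s : SiteState) : ℝ :=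
  ∑ i, (coord x i : ℝ) * ψ i s

/-- The pair with `i`-th component `ψ_i(η_0) (1 - η_{e_i})`. -/
def flow (ψ : Fin 2 → SiteState → ℝ) (η : Config) : EuclideanSpace ℝ (Fin 2) :=
  WithLp.toLp 2 fun i => ψ i (η 0) * (1 - occ (e i) η)

theorem flow_apply (ψ : Fin 2 → SiteState → ℝ) (η : Config) (i : Fin 2) :
    flow ψ η i = ψ i (η 0) * (1 - occ (e i) η) := rfl

theorem gradSum_apply (h : Config → ℝ) (η : Config) (i : Fin 2) :
    gradSum h η i = occ 0 η * (1 - occ (e i) η) *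
      totalDiff (fun x ζ => h (shift x ζ)) η (swap 0 (e i) η) := rfl

theorem totalDiff_shift (h : Config → ℝ) (y : Z2) (η ξ : Config) :
    totalDiff (fun x ζ => h (shift x ζ)) (shift y η) (shift y ξ) =
      totalDiff (fun x ζ => h (shift x ζ)) η ξ := by
  simp only [totalDiff, shift_shift]
  exact finsum_comp_equiv (Equiv.addRight y)
    (f := fun x => h (shift x ξ) - h (shift x η))

theorem gradSum_shift_of_licit (h : Config → ℝ) {η : Config} {y : Z2} {i : Fin 2}
    (hη : η y ≠ SiteState.empty ∧ η (y + e i) = SiteState.empty) :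
    gradSum h (shift y η) i =
      totalDiff (fun x ζ => h (shift x ζ)) η (swap y (y + e i) η) := by
  rw [gradSum_apply, swap_shift, totalDiff_shift, occ_shift, occ_shift, zero_add, add_comm (e i) y,
    licit_iff.2 hη, one_mul]

theorem totalDiff_site_swap (c : Z2 → SiteState → ℝ) {a b : Z2} (hab : a ≠ b) (η : Config) :
    totalDiff (fun x ζ => c x (ζ x)) η (swap a b η) =
      (c a (η b) - c a (η a)) + (c b (η a) - c b (η b)) := by
  rw [totalDiff, finsum_eq_sum_of_support_subset (s := {a, b})]
  · rw [Finset.sum_pair hab, swap_left, swap_right]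
  · intro x hx
    by_contra hc
    simp only [Finset.coe_insert, Finset.coe_singleton, Set.mem_insert_iff,
      Set.mem_singleton_iff, not_or] at hc
    exact hx (by simp only [swap_of_ne η hc.1 hc.2, sub_self])

/-- A jump in the direction `e_i` raises only the coordinate `i`, by one. A current thus has a
potential, although it is not a sum of translates of one function: its coefficients grow with `x`.
-/
theorem flow_shift_of_licit {ψ : Fin 2 → SiteState → ℝ} (hψ : ∀ i, ψ i SiteState.empty = 0)
    {η : Config} {y : Z2} {i : Fin 2}
    (hη : η y ≠ SiteState.empty ∧ η (y + e i) = SiteState.empty) :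
    flow ψ (shift y η) i =
      totalDiff (fun x ζ => moment ψ x (ζ x)) η (swap y (y + e i) η) := by
  have hne : y ≠ y + e i := fun h => e_ne_zero i (by simpa using h.symm)
  rw [totalDiff_site_swap _ hne, hη.2, flow_apply, occ_shift, add_comm (e i) y,
    occ_of_empty hη.2]
  simp only [moment, hψ, coord_add_e, Fin.sum_univ_two, shift, zero_add]
  fin_cases i <;> simp <;> ring

/-- The local summands of the formal potential of `∇Σ_h + flow ψ`. -/
def potential (h : Config → ℝ) (ψ : Fin 2 → SiteState → ℝ) (x : Z2) (η : Config) : ℝ :=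
  h (shift x η) + moment ψ x (η x)

theorem isUniformlyLocal_potential {h : Config → ℝ} (hh : IsLocal h)
    (ψ : Fin 2 → SiteState → ℝ) : IsUniformlyLocal (potential h ψ) :=
  (isUniformlyLocal_shift hh).add (isUniformlyLocal_site (moment ψ))

/-- The pair `∇Σ_h + flow ψ`. -/
def germ (h : Config → ℝ) (ψ : Fin 2 → SiteState → ℝ) (η : Config) :
    EuclideanSpace ℝ (Fin 2) :=
  gradSum h η + flow ψ η

theorem germ_shift_of_licit {h : Config → ℝ} (hh : IsLocal h) {ψ : Fin 2 → SiteState → ℝ}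
    (hψ : ∀ i, ψ i SiteState.empty = 0) {η : Config} {y : Z2} {i : Fin 2}
    (hη : η y ≠ SiteState.empty ∧ η (y + e i) = SiteState.empty) :
    germ h ψ (shift y η) i = totalDiff (potential h ψ) η (swap y (y + e i) η) := by
  rw [germ, PiLp.add_apply, gradSum_shift_of_licit h hη, flow_shift_of_licit hψ hη]
  exact (totalDiff_add (isUniformlyLocal_shift hh) (isUniformlyLocal_site (moment ψ))
    (finDiff_swap _ _ _)).symm

theorem germForm_germ {h : Config → ℝ} (hh : IsLocal h) {ψ : Fin 2 → SiteState → ℝ}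
    (hψ : ∀ i, ψ i SiteState.empty = 0) (j : Jump) {η : Config}
    (hη : occ j.src η * (1 - occ j.tgt η) = 1) :
    germForm (germ h ψ) j η = totalDiff (potential h ψ) η (j.apply η) := by
  obtain ⟨y, i, b⟩ := j
  rw [licit_iff] at hη
  cases b
  · simp only [Jump.tgt, Bool.false_eq_true, if_false] at hη
    simp only [germForm, Jump.apply, Jump.tgt, Bool.false_eq_true, if_false]
    set ξ := swap y (y - e i) η with hξ
    have h1 : ξ (y - e i) ≠ SiteState.empty ∧ ξ (y - e i + e i) = SiteState.empty := by
      rw [sub_add_cancel, hξ, swap_left, swap_right]; exact hη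
    rw [germ_shift_of_licit hh hψ h1, sub_add_cancel, ← totalDiff_symm, hξ,
      swap_comm (y - e i) y, swap_swap]
  · simp only [Jump.tgt, if_true] at hη
    simp only [germForm, Jump.apply, Jump.tgt, if_true]
    exact germ_shift_of_licit hh hψ hη

theorem finDiff_pathEnd (η : Config) (γ : List Jump) : FinDiff η (pathEnd η γ) := by
  induction γ generalizing η with
  | nil => simp [pathEnd, FinDiff]
  | cons j γ ih => exact (finDiff_swap _ _ _).trans (ih _)

/-- Each jump contributes the difference of the formal potential, and these differences telescope.
In particular the integral over a closed path is zero. -/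
theorem pathIntegral_germ {h : Config → ℝ} (hh : IsLocal h) {ψ : Fin 2 → SiteState → ℝ}
    (hψ : ∀ i, ψ i SiteState.empty = 0) (γ : List Jump) {η : Config} (hη : IsLicit η γ) :
    pathIntegral (germForm (germ h ψ)) η γ = totalDiff (potential h ψ) η (pathEnd η γ) := by
  induction γ generalizing η with
  | nil => simp [pathIntegral, pathEnd, totalDiff_self]
  | cons j γ ih =>
    rw [pathIntegral, ih hη.2, germForm_germ hh hψ j hη.1]
    exact (totalDiff_trans (isUniformlyLocal_potential hh ψ) (finDiff_swap _ _ _)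
      (finDiff_pathEnd _ _)).symm

/-! ### Germs with components in the weighted span -/

theorem memLp_of_weightedSpan {ω : Angle → ℝ} (hω : IsC2 ω) (α : GrandParam)
    {U : Config → EuclideanSpace ℝ (Fin 2)} (hU : ∀ i, (fun η => U η i) ∈ weightedSpan ω) :
    MemLp U 2 (grandMeasure α) := by
  refine MemLp.of_eval_piLp fun i => ?_
  obtain ⟨C, hC⟩ := weightedSpan_bounded hω (hU i)
  exact MemLp.of_bound (weightedSpan_measurable hω (hU i)).aestronglyMeasurable C
    (Filter.Eventually.of_forall hC)

theorem gradSum_mem_weightedSpan {ω : Angle → ℝ} {h : Config → ℝ} (hh : h ∈ weightedSpan ω)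
    (i : Fin 2) : (fun η => gradSum h η i) ∈ weightedSpan ω := by
  classical
  obtain ⟨s, hs⟩ := weightedSpan_isLocal hh
  -- The translate by `x` observes the sites `y + x` with `y ∈ s`, so it sees the exchange of `0`
  -- and `e i` only if `-x ∈ s` or `e i - x ∈ s`.
  set X : Finset Z2 := s.image (fun y => - y) ∪ s.image fun y => e i - y with hX
  have key : (fun η => gradSum h η i) = (fun η => occ 0 η * (1 - occ (e i) η)) *
      ∑ x ∈ X, ((fun η => h (relabel (fun w => some (Equiv.swap 0 (e i) (w + x))) η)) -
        fun η => h (shift x η)) := by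
    funext η
    rw [gradSum_apply, Pi.mul_apply, Finset.sum_apply, totalDiff,
      finsum_eq_sum_of_support_subset (s := X)]
    · rfl
    · intro x hx
      by_contra hc
      refine hx (sub_eq_zero.2 (hs fun y hy => ?_))
      refine swap_of_ne η ?_ ?_
      · rintro h0
        refine hc (Finset.mem_coe.2 (Finset.mem_union_left _ (Finset.mem_image.2 ⟨y, hy, ?_⟩)))
        rw [neg_eq_iff_add_eq_zero, h0]
      · rintro h0
        refine hc (Finset.mem_coe.2 (Finset.mem_union_right _ (Finset.mem_image.2 ⟨y, hy, ?_⟩)))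
        rw [← h0, add_sub_cancel_left]
  rw [key]
  exact mul_weightedSpan (Submodule.sum_mem _ fun x _ => sub_mem
    (weightedSpan_comp_relabel hh _) (weightedSpan_comp_shift hh x))
    (isBlind_licit _ _) (isLocal_licit _ _)

theorem flow_mem_weightedSpan {ω : Angle → ℝ} {ψ : Fin 2 → SiteState → ℝ}
    (hψ : ∀ i, ψ i ∈ siteSpan ω) (i : Fin 2) : (fun η => flow ψ η i) ∈ weightedSpan ω :=
  mul_mem_weightedSpan (hψ i) 0 (isBlind_vacant _) (isLocal_vacant _)

theorem germ_mem_weightedSpan {ω : Angle → ℝ} {h : Config → ℝ} (hh : h ∈ weightedSpan ω)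
    {ψ : Fin 2 → SiteState → ℝ} (hψ : ∀ i, ψ i ∈ siteSpan ω) (i : Fin 2) :
    (fun η => germ h ψ η i) ∈ weightedSpan ω :=
  add_mem (gradSum_mem_weightedSpan hh i) (flow_mem_weightedSpan hψ i)

theorem germ_eq_zero_of_not_licit (h : Config → ℝ) {ψ : Fin 2 → SiteState → ℝ}
    (hψ : ∀ i, ψ i SiteState.empty = 0) {η : Config} {i : Fin 2}
    (hη : ¬ (η 0 ≠ SiteState.empty ∧ η (e i) = SiteState.empty)) : germ h ψ η i = 0 := by
  rw [germ, PiLp.add_apply, gradSum_apply, licit_mul_eq_zero hη, flow_apply, zero_mul, zero_add]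
  by_cases h0 : η 0 = SiteState.empty
  · rw [h0, hψ, zero_mul]
  · have : η (e i) ≠ SiteState.empty := fun h1 => hη ⟨h0, h1⟩
    rw [occ_of_ne_empty this, sub_self, mul_zero]

theorem isClosedGerm_germ {ω : Angle → ℝ} (hω : IsC2 ω) (α : GrandParam) {h : Config → ℝ}
    (hh : h ∈ weightedSpan ω) {ψ : Fin 2 → SiteState → ℝ} (hψ : ∀ i, ψ i ∈ siteSpan ω) :
    IsClosedGerm α (germ h ψ) := by
  have hψ0 : ∀ i, ψ i SiteState.empty = 0 := fun i => siteSpan_empty (hψ i)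
  have hL := memLp_of_weightedSpan hω α (germ_mem_weightedSpan hh hψ)
  have hi : ∀ i, MemLp (fun η => germ h ψ η i) 2 (grandMeasure α) := fun i => hL.eval_piLp i
  refine ⟨hL, fun j => ⟨?_, fun η => ?_⟩, fun η γ hγ hend => ?_⟩
  · obtain ⟨y, i, b⟩ := j
    cases b
    · exact ((hi i).comp_measurePreserving ((measurePreserving_shift α (y - e i)).comp
        (measurePreserving_swap α y (y - e i)))).neg
    · exact (hi i).comp_measurePreserving (measurePreserving_shift α y)
  · by_cases hl : η j.src ≠ SiteState.empty ∧ η j.tgt = SiteState.empty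
    · rw [licit_iff.2 hl, one_mul]
    · rw [licit_mul_eq_zero hl, zero_mul]
      obtain ⟨y, i, b⟩ := j
      cases b
      · simp only [Jump.tgt, Bool.false_eq_true, if_false] at hl
        simp only [germForm, Bool.false_eq_true, if_false, neg_eq_zero]
        refine germ_eq_zero_of_not_licit h hψ0 fun hc => hl ?_
        simpa [shift, swap_left, swap_right] using hc
      · simp only [Jump.tgt, if_true] at hl
        simp only [germForm, if_true]
        refine germ_eq_zero_of_not_licit h hψ0 fun hc => hl ?_
        simpa [shift, add_comm (e i)] using hc
  · rw [pathIntegral_germ (weightedSpan_isLocal hh) hψ0 γ hγ, hend, totalDiff_self]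

/-! ### Integration of closed forms along licit paths -/

/-- `Reach V η ξ c`: the configuration `ξ` can be reached from `η` by a licit path along which
the form generated by `V` has the integral `c`. -/
inductive Reach (V : Config → EuclideanSpace ℝ (Fin 2)) : Config → Config → ℝ → Prop
  | refl (η : Config) : Reach V η η 0
  | fwd (η : Config) (y : Z2) (i : Fin 2) (h : η y ≠ SiteState.empty)
      (h' : η (y + e i) = SiteState.empty) :
      Reach V η (swap y (y + e i) η) (V (shift y η) i)
  | bwd (η : Config) (y : Z2) (i : Fin 2) (h : η y ≠ SiteState.empty)
      (h' : η (y + e i) = SiteState.empty) :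
      Reach V (swap y (y + e i) η) η (- V (shift y η) i)
  | trans {η ξ ζ : Config} {c d : ℝ} (h : Reach V η ξ c) (h' : Reach V ξ ζ d) :
      Reach V η ζ (c + d)

theorem isLicit_append {η : Config} {γ δ : List Jump} (h : IsLicit η γ)
    (h' : IsLicit (pathEnd η γ) δ) : IsLicit η (γ ++ δ) := by
  induction γ generalizing η with
  | nil => exact h'
  | cons j γ ih => exact ⟨h.1, ih h.2 h'⟩

theorem pathEnd_append (η : Config) (γ δ : List Jump) :
    pathEnd η (γ ++ δ) = pathEnd (pathEnd η γ) δ := by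
  induction γ generalizing η with
  | nil => rfl
  | cons j γ ih => exact ih _

theorem pathIntegral_append (u : Jump → Config → ℝ) (η : Config) (γ δ : List Jump) :
    pathIntegral u η (γ ++ δ) = pathIntegral u η γ + pathIntegral u (pathEnd η γ) δ := by
  induction γ generalizing η with
  | nil => simp [pathIntegral, pathEnd]
  | cons j γ ih => simp only [List.cons_append, pathIntegral, pathEnd, ih, add_assoc]

namespace Reach

variable {V : Config → EuclideanSpace ℝ (Fin 2)} {η ξ ζ : Config} {c d : ℝ}

theorem cast (h : Reach V η ξ c) (hξ : ξ = ζ) (hc : c = d) : Reach V η ζ d := hξ ▸ hc ▸ h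

theorem symm (h : Reach V η ξ c) : Reach V ξ η (-c) := by
  induction h with
  | refl η => simpa using Reach.refl η
  | fwd η y i h h' => exact .bwd η y i h h'
  | bwd η y i h h' => simpa using Reach.fwd η y i h h'
  | trans _ _ h h' => exact (h'.trans h).cast rfl (by ring)

theorem exists_path (h : Reach V η ξ c) : ∃ γ, IsLicit η γ ∧ pathEnd η γ = ξ ∧
    pathIntegral (germForm V) η γ = c := by
  induction h with
  | refl η => exact ⟨[], trivial, rfl, rfl⟩
  | fwd η y i h h' =>
    exact ⟨[⟨y, i, true⟩], ⟨licit_iff.2 ⟨h, h'⟩, trivial⟩, rfl, by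
      simp [pathIntegral, germForm]⟩
  | bwd η y i h h' =>
    refine ⟨[⟨y + e i, i, false⟩], ⟨licit_iff.2 ?_, trivial⟩, ?_, ?_⟩
    · simp only [Jump.tgt, Bool.false_eq_true, if_false, add_sub_cancel_right]
      rw [swap_left, swap_right]; exact ⟨h, h'⟩
    · simp only [pathEnd, Jump.apply, Jump.tgt, Bool.false_eq_true, if_false,
        add_sub_cancel_right]
      rw [swap_comm, swap_swap]
    · simp only [pathIntegral, germForm, Bool.false_eq_true, if_false, add_sub_cancel_right]
      rw [swap_comm (y + e i), swap_swap, add_zero]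
  | trans _ _ h h' =>
    obtain ⟨γ, h1, h2, h3⟩ := h
    obtain ⟨δ, h4, h5, h6⟩ := h'
    exact ⟨γ ++ δ, isLicit_append h1 (h2 ▸ h4), by rw [pathEnd_append, h2, h5],
      by rw [pathIntegral_append, h2, h3, h6]⟩

/-- One path followed by the reverse of the other is a closed path. Every identity between costs
below comes from two paths with the same ends. -/
theorem unique (hV : ∀ (η : Config) (γ : List Jump), IsLicit η γ → pathEnd η γ = η →
    pathIntegral (germForm V) η γ = 0) (h : Reach V η ξ c) (h' : Reach V η ξ d) : c = d := by
  obtain ⟨γ, h1, h2, h3⟩ := (h.trans h'.symm).exists_path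
  have := hV η γ h1 h2
  linarith

end Reach

/-! ### Particles on a finite background -/

@[simp] theorem add_e_zero_fst (y : Z2) : (y + e 0).1 = y.1 + 1 := by simp [e]
@[simp] theorem add_e_zero_snd (y : Z2) : (y + e 0).2 = y.2 := by simp [e]
@[simp] theorem add_e_one_fst (y : Z2) : (y + e 1).1 = y.1 := by simp [e]
@[simp] theorem add_e_one_snd (y : Z2) : (y + e 1).2 = y.2 + 1 := by simp [e]
@[simp] theorem add_nsmul_e_zero_fst (y : Z2) (k : ℕ) : (y + k • e 0).1 = y.1 + k := by
  simp [e]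
@[simp] theorem add_nsmul_e_zero_snd (y : Z2) (k : ℕ) : (y + k • e 0).2 = y.2 := by simp [e]
@[simp] theorem add_nsmul_e_one_fst (y : Z2) (k : ℕ) : (y + k • e 1).1 = y.1 := by simp [e]
@[simp] theorem add_nsmul_e_one_snd (y : Z2) (k : ℕ) : (y + k • e 1).2 = y.2 + k := by
  simp [e]

theorem swap_update {ζ : Config} {a b : Z2} (ha : ζ a = SiteState.empty)
    (hb : ζ b = SiteState.empty) (t : SiteState) :
    swap a b (Function.update ζ a t) = Function.update ζ b t := by
  funext w
  rcases eq_or_ne w b with rfl | h2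
  · rw [swap_right]; simp
  rcases eq_or_ne w a with rfl | h1
  · rw [swap_left, Function.update_of_ne h2, Function.update_of_ne (Ne.symm h2), ha, hb]
  rw [swap_of_ne _ h1 h2, Function.update_of_ne h1, Function.update_of_ne h2]

theorem update_update_comm {a b : Z2} (h : a ≠ b) (s t : SiteState) (ζ : Config) :
    Function.update (Function.update ζ a s) b t = Function.update (Function.update ζ b t) a s :=
  Function.update_comm h s t ζ

/-- The sites `a` and `y` are at distance more than `r`. -/
def Far (r : ℕ) (a y : Z2) : Prop :=
  a.1 + r < y.1 ∨ y.1 + r < a.1 ∨ a.2 + r < y.2 ∨ y.2 + r < a.2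

theorem Far.ne {r : ℕ} {a y : Z2} (h : Far r a y) : y ≠ a := by
  rintro rfl; simp only [Far] at h; omega

/-- Lexicographic order of the sites, columns first. -/
def Before (x z : Z2) : Prop := x.1 < z.1 ∨ (x.1 = z.1 ∧ x.2 < z.2)

instance (x z : Z2) : Decidable (Before x z) := inferInstanceAs (Decidable (_ ∨ _))

/-- All particles of `ζ` are at sites before `z`. -/
def LeftOf (ζ : Config) (z : Z2) : Prop := ∀ x, ζ x ≠ SiteState.empty → Before x z

theorem LeftOf.empty {ζ : Config} {z : Z2} (h : LeftOf ζ z) {x : Z2} (hx : ¬ Before x z) :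
    ζ x = SiteState.empty := by
  by_contra hc; exact hx (h x hc)

theorem LeftOf.mono {ζ : Config} {y z : Z2} (h : LeftOf ζ y) (hy : Before y z) : LeftOf ζ z := by
  intro x hx
  have := h x hx
  simp only [Before] at *
  omega

theorem LeftOf.update {ζ : Config} {z y : Z2} (h : LeftOf ζ z) (hy : Before y z)
    (s : SiteState) : LeftOf (Function.update ζ y s) z := by
  intro x hx
  rcases eq_or_ne x y with rfl | hne
  · exact hy
  · exact h x (by rwa [Function.update_of_ne hne] at hx)

theorem before_add_e (y : Z2) (i : Fin 2) : Before y (y + e i) := by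
  match i with
  | 0 => simp [Before, e]
  | 1 => simp [Before, e]

/-- Closed forms of range `r` that vanish on isolated particles. -/
structure IsIsolatedClosed (V : Config → EuclideanSpace ℝ (Fin 2)) (r : ℕ) : Prop where
  loc : ∀ i η ξ, (∀ x : Z2, ¬ Far r x 0 → η x = ξ x) → V η i = V ξ i
  iso : ∀ i η, (∀ x : Z2, x ≠ 0 → ¬ Far r x 0 → η x = SiteState.empty) → V η i = 0
  closed : ∀ (η : Config) (γ : List Jump), IsLicit η γ → pathEnd η γ = η →
    pathIntegral (germForm V) η γ = 0

/-- The integral of the form along the motion of a particle of state `t` from `z` to the right. -/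
def exitCost (V : Config → EuclideanSpace ℝ (Fin 2)) (r : ℕ) (ζ : Config) (z : Z2)
    (t : SiteState) : ℝ :=
  ∑ k ∈ Finset.range (r + 1),
    V (shift (z + k • e 0) (Function.update ζ (z + k • e 0) t)) 0

theorem reach_update (V : Config → EuclideanSpace ℝ (Fin 2)) {ζ : Config} {y : Z2} {i : Fin 2}
    {t : SiteState} (ht : t ≠ SiteState.empty) (h : ζ y = SiteState.empty)
    (h' : ζ (y + e i) = SiteState.empty) :
    Reach V (Function.update ζ y t) (Function.update ζ (y + e i) t)
      (V (shift y (Function.update ζ y t)) i) := by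
  have hne : y + e i ≠ y := by simpa using e_ne_zero i
  refine (Reach.fwd (Function.update ζ y t) y i ?_ ?_).cast (swap_update h h' t) rfl
  · simpa using ht
  · rwa [Function.update_of_ne hne]

theorem reach_walk (V : Config → EuclideanSpace ℝ (Fin 2)) {ζ : Config} {y : Z2} {i : Fin 2}
    {t : SiteState} (ht : t ≠ SiteState.empty) (L : ℕ)
    (h : ∀ k ≤ L, ζ (y + k • e i) = SiteState.empty) :
    Reach V (Function.update ζ y t) (Function.update ζ (y + L • e i) t)
      (∑ k ∈ Finset.range L,
        V (shift (y + k • e i) (Function.update ζ (y + k • e i) t)) i) := by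
  induction L with
  | zero => simpa using Reach.refl (V := V) (Function.update ζ y t)
  | succ L ih =>
    rw [Finset.sum_range_succ]
    have hs : y + (L + 1) • e i = y + L • e i + e i := by rw [succ_nsmul, add_assoc]
    refine (ih fun k hk => h k (by omega)).trans ?_
    rw [hs]
    exact reach_update V ht (h L (by omega)) (hs ▸ h (L + 1) le_rfl)

namespace IsIsolatedClosed

variable {V : Config → EuclideanSpace ℝ (Fin 2)} {r : ℕ}

theorem eq_of_far (hV : IsIsolatedClosed V r) (i : Fin 2) {ζ : Config} {a y : Z2}
    (s : SiteState) (h : Far r a y) :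
    V (shift y (Function.update ζ a s)) i = V (shift y ζ) i := by
  refine hV.loc i _ _ fun x hx => ?_
  have : x + y ≠ a := by
    rintro rfl
    refine hx ?_
    simp only [Far, Prod.fst_add, Prod.snd_add, Prod.fst_zero, Prod.snd_zero] at *
    omega
  simp [shift, Function.update_of_ne this]

theorem eq_zero_of_isolated (hV : IsIsolatedClosed V r) (i : Fin 2) {ζ : Config} {y : Z2}
    (t : SiteState)
    (h : ∀ x, ζ x ≠ SiteState.empty → Far r x y) :
    V (shift y (Function.update ζ y t)) i = 0 := by
  refine hV.iso i _ fun x hx hf => ?_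
  have : x + y ≠ y := by simpa using hx
  rw [shift, Function.update_of_ne this]
  by_contra hc
  refine hf ?_
  have := h _ hc
  simp only [Far, Prod.fst_add, Prod.snd_add, Prod.fst_zero, Prod.snd_zero] at *
  omega

/-- All particles of `ζ` lie in columns up to that of `z`, so after `r + 1` steps the walker is out
of their range and moves for free; the length `L` is therefore immaterial. The extra state at `a`
stays out of range of the whole walk and does not alter its cost. -/
theorem reach_exit_far (hV : IsIsolatedClosed V r) {ζ : Config} {z a : Z2} {s t : SiteState}
    (hζ : LeftOf ζ z)
    (ht : t ≠ SiteState.empty) {L : ℕ} (hL : r + 1 ≤ L)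
    (ha : ∀ k ≤ L, Far r a (z + k • e 0)) :
    Reach V (Function.update (Function.update ζ a s) z t)
      (Function.update (Function.update ζ a s) (z + L • e 0) t) (exitCost V r ζ z t) := by
  have hemp : ∀ k : ℕ, ζ (z + k • e 0) = SiteState.empty := fun k =>
    hζ.empty (by simp only [Before, add_nsmul_e_zero_fst, add_nsmul_e_zero_snd]; omega)
  refine (reach_walk V ht L fun k hk => ?_).cast rfl ?_
  · rw [Function.update_of_ne (ha k hk).ne, hemp]
  · have h1 : ∀ k ∈ Finset.range L,
        V (shift (z + k • e 0) (Function.update (Function.update ζ a s) (z + k • e 0) t)) 0 =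
          V (shift (z + k • e 0) (Function.update ζ (z + k • e 0) t)) 0 := fun k hk => by
      have hf := ha k (Finset.mem_range.1 hk).le
      rw [update_update_comm hf.ne.symm, hV.eq_of_far 0 s hf]
    rw [Finset.sum_congr rfl h1, exitCost]
    refine (Finset.sum_subset (Finset.range_mono hL) fun k _ hk => ?_).symm
    refine hV.eq_zero_of_isolated 0 t fun x hx => ?_
    have := hζ x hx
    simp only [Finset.mem_range, Before, Far, add_nsmul_e_zero_fst] at *
    omega

theorem reach_exit (hV : IsIsolatedClosed V r) {ζ : Config} {z : Z2} {t : SiteState}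
    (hζ : LeftOf ζ z)
    (ht : t ≠ SiteState.empty) {L : ℕ} (hL : r + 1 ≤ L) :
    Reach V (Function.update ζ z t) (Function.update ζ (z + L • e 0) t)
      (exitCost V r ζ z t) := by
  -- A site beyond the reach of the walk and already empty serves as the auxiliary far site.
  have ha : ζ (z + (L + r + 1) • e 0) = SiteState.empty := hζ.empty (by
    simp only [Before, add_nsmul_e_zero_fst, add_nsmul_e_zero_snd]; omega)
  have := hV.reach_exit_far (a := z + (L + r + 1) • e 0) (s := SiteState.empty) hζ ht hL
    fun k hk => by simp only [Far, add_nsmul_e_zero_fst]; push_cast; omega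
  have hu : Function.update ζ (z + (L + r + 1) • e 0) SiteState.empty = ζ :=
    Function.update_eq_self_iff.2 ha.symm
  rwa [hu] at this

/-- A particle that is right of all the others exits at once or after one jump. -/
theorem exitCost_jump (hV : IsIsolatedClosed V r) {ζ : Config} {y : Z2} {t : SiteState}
    (hζ : LeftOf ζ y)
    (ht : t ≠ SiteState.empty) (i : Fin 2) :
    V (shift y (Function.update ζ y t)) i + exitCost V r ζ (y + e i) t =
      exitCost V r ζ y t := by
  have hy' := hζ.mono (before_add_e y i)
  -- First path: jump, then exit. Second path, `h2`: exit, then the same jump, which is free because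
  -- the particle is by then isolated. Both end at `y + (r + 1) • e 0 + e i`.
  have h1 := (reach_update V (ζ := ζ) (y := y) (i := i) ht
    (hζ.empty (by simp [Before])) (hζ.empty (by
      have := before_add_e y i
      simp only [Before] at *; omega))).trans (hV.reach_exit hy' ht le_rfl)
  have hb : ∀ x, ζ x ≠ SiteState.empty → Far r x (y + (r + 1) • e 0) := fun x hx => by
    have := hζ x hx
    simp only [Before, Far, add_nsmul_e_zero_fst] at *
    push_cast
    omega
  have h2 := (hV.reach_exit hζ ht le_rfl).trans (reach_update V (i := i) ht
    (hζ.empty (by simp only [Before, add_nsmul_e_zero_fst, add_nsmul_e_zero_snd]; omega))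
    (hζ.empty (by
      have := before_add_e (y + (r + 1) • e 0) i
      simp only [Before, add_nsmul_e_zero_fst, add_nsmul_e_zero_snd] at *; omega)))
  rw [hV.eq_zero_of_isolated i t hb] at h2
  rw [add_right_comm y] at h1
  simpa using h1.unique hV.closed h2

/-- A jump and the exit of a particle on its right commute. -/
theorem jump_exit_comm (hV : IsIsolatedClosed V r) {ζ : Config} {y z : Z2} {s t : SiteState}
    {i : Fin 2}
    (hs : s ≠ SiteState.empty) (ht : t ≠ SiteState.empty) (hζ : LeftOf ζ z)
    (hz : Before (y + e i) z) (hy : ζ y = SiteState.empty) (hy' : ζ (y + e i) = SiteState.empty) :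
    V (shift y (Function.update (Function.update ζ y s) z t)) i
        + exitCost V r (Function.update ζ (y + e i) s) z t =
      exitCost V r (Function.update ζ y s) z t + V (shift y (Function.update ζ y s)) i := by
  have hyz : Before y z := by
    have := before_add_e y i
    simp only [Before] at *; omega
  have hne : ∀ {a : Z2}, Before a z → ∀ k : ℕ, a ≠ z + k • e 0 := by
    rintro a ha k rfl
    simp only [Before, add_nsmul_e_zero_fst, add_nsmul_e_zero_snd] at ha
    omega
  have hne0 : ∀ {a : Z2}, Before a z → a ≠ z := fun ha => by simpa using hne ha 0
  have h1 := (reach_update V (ζ := Function.update ζ z t) (y := y) (i := i) hs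
    (by rwa [Function.update_of_ne (hne0 hyz)]) (by rwa [Function.update_of_ne (hne0 hz)]))
  rw [update_update_comm (hne0 hyz).symm, update_update_comm (hne0 hz).symm] at h1
  have h1' := h1.trans (hV.reach_exit (hζ.update hz s) ht le_rfl)
  have h2 := reach_update V (ζ := Function.update ζ (z + (r + 1) • e 0) t) (y := y) (i := i) hs
    (by rwa [Function.update_of_ne (hne hyz _)]) (by rwa [Function.update_of_ne (hne hz _)])
  rw [update_update_comm (hne hyz _).symm, update_update_comm (hne hz _).symm] at h2
  have h2' := (hV.reach_exit (hζ.update hyz s) ht le_rfl).trans h2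
  -- Once the particle from `z` has left, it is out of range of `y` and no longer influences the
  -- jump.
  have hf : Far r (z + (r + 1) • e 0) y := by
    simp only [Before, Far, add_nsmul_e_zero_fst] at *
    push_cast
    omega
  rw [hV.eq_of_far i t hf] at h2'
  exact h1'.unique hV.closed h2'

/-- A horizontal jump across the column order of a particle that exits. -/
theorem jump_exit_exchange (hV : IsIsolatedClosed V r) {ζ : Config} {y z : Z2} {s t : SiteState}
    (hs : s ≠ SiteState.empty) (ht : t ≠ SiteState.empty) (hζ : LeftOf ζ z)
    (hyz : Before y z) (hz : Before z (y + e 0)) (hy : ζ y = SiteState.empty) :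
    V (shift y (Function.update (Function.update ζ y s) z t)) 0
        + exitCost V r (Function.update ζ z t) (y + e 0) s + exitCost V r ζ z t =
      exitCost V r (Function.update ζ y s) z t + V (shift y (Function.update ζ y s)) 0
        + exitCost V r ζ (y + e 0) s := by
  -- A height at which the particle from `z` is out of range of the whole row of `y`.
  obtain ⟨M, hM⟩ : ∃ M : ℕ, y.2 + r < z.2 + M :=
    ⟨(y.2 + r - z.2).toNat + 1, by push_cast; have := Int.self_le_toNat (y.2 + r - z.2); omega⟩
  have hyz0 : y ≠ z := by rintro rfl; simp [Before] at hyz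
  have hzy0 : y + e 0 ≠ z := by
    intro h; rw [h] at hz; simp [Before] at hz
  have hζy' : LeftOf ζ (y + e 0) := hζ.mono hz
  have hy' : ζ (y + e 0) = SiteState.empty := hζy'.empty (by simp [Before])
  set L := r + 1 with hL
  set z' := z + L • e 0 with hz'
  set z'' := z' + M • e 1 with hz''
  set y'' := y + e 0 + (2 * L) • e 0 with hy''
  have z'1 : z'.1 = z.1 + r + 1 := by rw [hz', add_nsmul_e_zero_fst]; omega
  have z'2 : z'.2 = z.2 := by rw [hz', add_nsmul_e_zero_snd]
  have z''1 : z''.1 = z.1 + r + 1 := by rw [hz'', add_nsmul_e_one_fst, z'1]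
  have z''2 : z''.2 = z.2 + M := by rw [hz'', add_nsmul_e_one_snd, z'2]
  have y''1 : y''.1 = y.1 + 1 + 2 * (r + 1) := by
    rw [hy'', add_nsmul_e_zero_fst, add_e_zero_fst]; push_cast; omega
  have y''2 : y''.2 = y.2 := by rw [hy'', add_nsmul_e_zero_snd, add_e_zero_snd]
  simp only [Before, add_e_zero_fst, add_e_zero_snd] at hyz hz
  have ne_of_fst : ∀ {a b : Z2}, a.1 ≠ b.1 → a ≠ b := fun h h' => h (congrArg Prod.fst h')
  -- Path A: `s` jumps past `z` and exits to `y''`, then `t` exits to `z'`. Walking `2 * L` steps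
  -- instead of `L` takes `s` out of range of the exit of `t`.
  have a1 := reach_update V (ζ := Function.update ζ z t) (y := y) (i := 0) hs
    (by rwa [Function.update_of_ne hyz0]) (by rwa [Function.update_of_ne hzy0])
  have a2 := hV.reach_exit (ζ := Function.update ζ z t) (z := y + e 0) (t := s) (L := 2 * L)
    (hζy'.update (by simp only [Before, add_e_zero_fst, add_e_zero_snd]; omega) t) hs (by omega)
  have a3 := hV.reach_exit_far (a := y'') (s := s) hζ ht (L := L) le_rfl fun k hk => by
    simp only [Far, y''1, add_nsmul_e_zero_fst]; omega
  rw [← hy'', update_update_comm (a := z) (b := y'') (ne_of_fst (by omega)) t s] at a2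
  have A := (a1.trans a2).trans a3
  have hvert : ∀ {ξ : Config}, (∀ x, ξ x ≠ SiteState.empty → x.1 + r < z'.1 ∨ z'.1 + r < x.1) →
      Reach V (Function.update ξ z' t) (Function.update ξ z'' t) 0 := by
    intro ξ hξ
    refine (reach_walk V (i := 1) ht M fun k _ => ?_).cast rfl (Finset.sum_eq_zero fun k _ => ?_)
    · by_contra hc
      have := hξ _ hc
      simp only [add_nsmul_e_one_fst] at this
      omega
    · refine hV.eq_zero_of_isolated 1 t fun x hx => ?_
      have := hξ x hx
      simp only [Far, add_nsmul_e_one_fst]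
      omega
  have hζ1 : ∀ x, ζ x ≠ SiteState.empty → x.1 ≤ z.1 := fun x hx => by
    have := hζ x hx
    simp only [Before] at this
    omega
  -- Path B: `t` exits to `z'` and climbs to `z''`, clearing the way; then `s` jumps and exits to
  -- `y''`, and `t` descends to `z'`. Both vertical walks are free, since the column of `z'` is more
  -- than `r` away from every other particle.
  have b1 := hV.reach_exit (ζ := Function.update ζ y s) (z := z) (t := t) (L := L)
    (hζ.update hyz s) ht le_rfl
  have b2 := hvert (ξ := Function.update ζ y s) fun x hx => by
    rcases eq_or_ne x y with rfl | hxy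
    · omega
    · rw [Function.update_of_ne hxy] at hx
      have := hζ1 x hx
      omega
  have b3 := reach_update V (ζ := Function.update ζ z'' t) (y := y) (i := 0) hs
    (by rwa [Function.update_of_ne (ne_of_fst (by omega))])
    (by
      rw [Function.update_of_ne]
      · exact hy'
      · intro h
        have h1 := congrArg Prod.fst h
        have h2 := congrArg Prod.snd h
        simp only [add_e_zero_fst, add_e_zero_snd] at h1 h2
        omega)
  have b4 := hV.reach_exit_far (ζ := ζ) (z := y + e 0) (a := z'') (s := t) (t := s) hζy' hs
    (L := 2 * L) (by omega) fun k hk => by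
      simp only [Far, z''2, add_nsmul_e_zero_snd, add_e_zero_snd]; omega
  rw [update_update_comm (a := z'') (b := y) (ne_of_fst (by omega)), hV.eq_of_far 0 t
    (by simp only [Far, z''1]; omega)] at b3
  have b5 := (hvert (ξ := Function.update ζ y'' s) fun x hx => by
    rcases eq_or_ne x y'' with rfl | hxy
    · omega
    · rw [Function.update_of_ne hxy] at hx
      have := hζ1 x hx
      omega).symm
  rw [← hy'', update_update_comm (a := z'') (b := y'') (ne_of_fst (by omega)) t s] at b4
  have B := (((b1.trans b2).trans b3).trans b4).trans b5
  rw [update_update_comm hyz0.symm] at A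
  have := A.unique hV.closed B
  linarith

end IsIsolatedClosed

/-! ### The potential of a closed form that vanishes on isolated particles -/

/-- The part of a configuration at the sites before the origin. -/
def leftPart (η : Config) : Config := fun x => if Before x 0 then η x else SiteState.empty

/-- The local function whose translates sum up to the potential of the form. -/
def exitPotential (V : Config → EuclideanSpace ℝ (Fin 2)) (r : ℕ) (η : Config) : ℝ :=
  - exitCost V r (leftPart η) 0 (η 0)

/-- Each term of the exit cost is `V` evaluated at a rearrangement of `η` with some sites emptied,
hence a relabelling. -/
theorem exitPotential_mem_weightedSpan {ω : Angle → ℝ} {V : Config → EuclideanSpace ℝ (Fin 2)}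
    (hV : (fun η => V η 0) ∈ weightedSpan ω) (r : ℕ) : exitPotential V r ∈ weightedSpan ω := by
  have key : exitPotential V r = - ∑ k ∈ Finset.range (r + 1), fun η =>
      V (relabel (fun w => if w = 0 then some 0 else
        if Before (w + k • e 0) 0 then some (w + k • e 0) else none) η) 0 := by
    funext η
    rw [exitPotential, exitCost, Pi.neg_apply, Finset.sum_apply]
    congr 1
    refine Finset.sum_congr rfl fun k _ => ?_
    refine congrArg (fun ξ => V ξ 0) ?_
    funext w
    rw [zero_add, shift, relabel]
    rcases eq_or_ne w 0 with rfl | hw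
    · simp
    · have : w + k • e 0 ≠ k • e 0 := by simpa using hw
      rw [Function.update_of_ne this, if_neg hw, leftPart]
      split_ifs <;> rfl
  rw [key]
  exact neg_mem (Submodule.sum_mem _ fun k _ => weightedSpan_comp_relabel hV _)

/-- A configuration with finitely many particles. -/
def IsFinite (η : Config) : Prop := {x | η x ≠ SiteState.empty}.Finite

/-- The sites of the particles of a configuration with finitely many particles. -/
def IsFinite.particles {η : Config} (hη : IsFinite η) : Finset Z2 := Set.Finite.toFinset hη

theorem IsFinite.mem_particles {η : Config} (hη : IsFinite η) {x : Z2} :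
    x ∈ hη.particles ↔ η x ≠ SiteState.empty := Set.Finite.mem_toFinset hη

/-- The sum of the translates of a function, on configurations with finitely many particles. -/
def sumShift (h : Config → ℝ) (η : Config) : ℝ := ∑ᶠ x, h (shift x η)

theorem support_sumShift {h : Config → ℝ} (hh : ∀ η, η 0 = SiteState.empty → h η = 0)
    {η : Config} (hη : IsFinite η) : (Function.support fun x => h (shift x η)).Finite := by
  refine hη.subset fun x hx hc => hx (hh _ ?_)
  rw [shift, zero_add, hc]

theorem exitPotential_of_empty {V : Config → EuclideanSpace ℝ (Fin 2)}
    (hV : ∀ i η, η 0 = SiteState.empty → V η i = 0) (r : ℕ) {η : Config}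
    (hη : η 0 = SiteState.empty) : exitPotential V r η = 0 := by
  rw [exitPotential, exitCost, Finset.sum_eq_zero, neg_zero]
  intro k _
  refine hV 0 _ ?_
  rw [shift, zero_add, zero_add, Function.update_self, hη]

theorem IsFinite.update {ζ : Config} (hζ : IsFinite ζ) (z : Z2) (t : SiteState) :
    IsFinite (Function.update ζ z t) := by
  refine (hζ.insert z).subset fun x hx => ?_
  rcases eq_or_ne x z with rfl | hxz
  · simp
  · right
    simpa [Function.update_of_ne hxz] using hx

/-- The exit cost attached to a site involves only the sites before it, so a new last particle
leaves the other terms unchanged. This triangular structure allows induction on the particles. -/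
theorem sumShift_update {V : Config → EuclideanSpace ℝ (Fin 2)}
    (hV : ∀ i η, η 0 = SiteState.empty → V η i = 0) (r : ℕ) {ζ : Config} (hζ : IsFinite ζ)
    {z : Z2} (hz : LeftOf ζ z) (t : SiteState) :
    sumShift (exitPotential V r) (Function.update ζ z t) =
      sumShift (exitPotential V r) ζ - exitCost V r ζ z t := by
  have h0 : ∀ η, η 0 = SiteState.empty → exitPotential V r η = 0 :=
    fun η hη => exitPotential_of_empty hV r hη
  have hzz : ζ z = SiteState.empty := hz.empty (by simp [Before])
  rw [eq_sub_iff_add_eq', ← eq_sub_iff_add_eq, sumShift, sumShift,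
    ← finsum_sub_distrib (support_sumShift h0 hζ) (support_sumShift h0 (hζ.update z t)),
    finsum_eq_single _ z]
  · have h1 : leftPart (shift z (Function.update ζ z t)) = shift z ζ := by
      funext w
      by_cases hw : Before w 0
      · have : w + z ≠ z := by
          intro h
          rw [add_eq_right] at h
          simp [h, Before] at hw
        simp [leftPart, hw, shift, Function.update_of_ne this]
      · rw [leftPart, if_neg hw, shift, hz.empty]
        simp only [Before, Prod.fst_add, Prod.snd_add, Prod.fst_zero, Prod.snd_zero] at *
        omega
    have h2 : shift z (Function.update ζ z t) 0 = t := by simp [shift]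
    rw [h0 (shift z ζ) (by rw [shift, zero_add, hzz]), exitPotential, h1, h2, zero_sub, neg_neg,
      exitCost, exitCost]
    refine Finset.sum_congr rfl fun k _ => ?_
    refine congrArg (fun ξ => V ξ 0) ?_
    funext w
    rw [zero_add, shift, shift]
    by_cases hw : w = 0
    · subst hw
      simp [add_comm z]
    · have e1 : w + k • e 0 ≠ k • e 0 := by simpa using hw
      have e2 : w + (z + k • e 0) ≠ z + k • e 0 := by simpa using hw
      rw [Function.update_of_ne e1, Function.update_of_ne e2, shift]
      congr 1
      abel
  · intro x hx
    rw [sub_eq_zero]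
    by_cases hxz : Before x z
    · have h1 : leftPart (shift x ζ) = leftPart (shift x (Function.update ζ z t)) := by
        funext w
        by_cases hw : Before w 0
        · have : w + x ≠ z := by
            rintro rfl
            simp only [Before, Prod.fst_add, Prod.snd_add, Prod.fst_zero, Prod.snd_zero] at *
            omega
          simp [leftPart, hw, shift, Function.update_of_ne this]
        · simp [leftPart, hw]
      rw [exitPotential, exitPotential, h1]
      simp [shift, Function.update_of_ne hx]
    · rw [h0, h0]
      · rw [shift, zero_add, Function.update_of_ne hx, hz.empty hxz]
      · rw [shift, zero_add, hz.empty hxz]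

theorem exists_last {η : Config} (hη : IsFinite η) {y : Z2} (hy : η y ≠ SiteState.empty) :
    ∃ z, η z ≠ SiteState.empty ∧ ∀ x, η x ≠ SiteState.empty → x ≠ z → Before x z := by
  obtain ⟨z, hz, hmax⟩ := hη.particles.exists_max_image (fun x => toLex x)
    ⟨y, hη.mem_particles.2 hy⟩
  refine ⟨z, hη.mem_particles.1 hz, fun x hx hxz => ?_⟩
  have h := hmax x (hη.mem_particles.2 hx)
  rw [Prod.Lex.toLex_le_toLex] at h
  rcases h with h | ⟨h, h'⟩
  · exact Or.inl h
  · exact Or.inr ⟨h, lt_of_le_of_ne h' fun h'' => hxz (Prod.ext h h'')⟩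

/-- Induction on the number of particles, by removal of the last one, at `z`. If it is the one that
jumps, `exitCost_jump` applies. Otherwise the induction hypothesis handles the jump without it, and
its presence is accounted for by `jump_exit_comm` if the jump ends before `z` and by
`jump_exit_exchange` if the jump changes the order of the two particles. -/
theorem IsIsolatedClosed.sumShift_swap {V : Config → EuclideanSpace ℝ (Fin 2)} {r : ℕ}
    (hV : IsIsolatedClosed V r) (h0 : ∀ i η, η 0 = SiteState.empty → V η i = 0) {η : Config}
    (hη : IsFinite η) {y : Z2} {i : Fin 2} (hy : η y ≠ SiteState.empty)
    (hy' : η (y + e i) = SiteState.empty) :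
    sumShift (exitPotential V r) (swap y (y + e i) η) =
      sumShift (exitPotential V r) η + V (shift y η) i := by
  induction hn : hη.particles.card using Nat.strong_induction_on generalizing η with
  | _ n ih =>
  obtain ⟨z, hz, hlast⟩ := exists_last hη hy
  set t := η z with ht
  set ζ₀ := Function.update η z SiteState.empty with hζ₀
  have hfin₀ : IsFinite ζ₀ := hη.update _ _
  have hleft₀ : LeftOf ζ₀ z := by
    intro x hx
    have hxz : x ≠ z := by rintro rfl; simp [hζ₀] at hx
    exact hlast x (by rwa [hζ₀, Function.update_of_ne hxz] at hx) hxz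
  have hη₀ : η = Function.update ζ₀ z t := by simp [hζ₀, ht]
  have hyy : y + e i ≠ y := by simpa using e_ne_zero i
  rcases eq_or_ne z y with hzy | hzy
  · subst hzy
    have hl' := hleft₀.mono (before_add_e z i)
    have hsw : swap z (z + e i) η = Function.update ζ₀ (z + e i) t := by
      rw [hη₀]
      exact swap_update (by simp [hζ₀]) (by rwa [hζ₀, Function.update_of_ne hyy]) t
    have := hV.exitCost_jump hleft₀ hz i
    rw [hsw, sumShift_update h0 r hfin₀ hl', hη₀, sumShift_update h0 r hfin₀ hleft₀]
    linarith
  have hyz : Before y z := hlast y hy hzy.symm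
  have hzy' : y + e i ≠ z := by rintro h; rw [h] at hy'; exact hz hy'
  set s := η y with hs
  set ζ := Function.update ζ₀ y SiteState.empty with hζ
  have hfin : IsFinite ζ := hfin₀.update _ _
  have hleft : LeftOf ζ z := hleft₀.update hyz _
  have hζy : ζ y = SiteState.empty := by simp [hζ]
  have hζy' : ζ (y + e i) = SiteState.empty := by
    rwa [hζ, Function.update_of_ne hyy, hζ₀, Function.update_of_ne hzy']
  have hζ₀ζ : ζ₀ = Function.update ζ y s := by
    simp [hζ, hs, hζ₀, Function.update_of_ne hzy.symm]
  have hsw₀ : swap y (y + e i) ζ₀ = Function.update ζ (y + e i) s := by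
    rw [hζ₀ζ]; exact swap_update hζy hζy' s
  have hsw : swap y (y + e i) η = Function.update (Function.update ζ (y + e i) s) z t := by
    rw [hη₀, hζ₀ζ, update_update_comm hzy.symm, update_update_comm hzy']
    exact swap_update (by rwa [Function.update_of_ne hzy.symm])
      (by rwa [Function.update_of_ne hzy']) s
  have hIH : sumShift (exitPotential V r) (Function.update ζ (y + e i) s) =
      sumShift (exitPotential V r) (Function.update ζ y s)
        + V (shift y (Function.update ζ y s)) i := by
    have := ih hfin₀.particles.card ?_ (η := ζ₀) hfin₀
        (by rwa [hζ₀, Function.update_of_ne hzy.symm])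
      (by rwa [hζ₀, Function.update_of_ne hzy']) rfl
    · rwa [hsw₀, hζ₀ζ] at this
    · rw [← hn]
      refine Finset.card_lt_card (Finset.ssubset_iff_of_subset ?_ |>.2
        ⟨z, hη.mem_particles.2 hz, ?_⟩)
      · intro x hx
        rw [IsFinite.mem_particles] at hx ⊢
        have hxz : x ≠ z := by rintro rfl; simp [hζ₀] at hx
        rwa [hζ₀, Function.update_of_ne hxz] at hx
      · simp [IsFinite.mem_particles, hζ₀]
  by_cases hb : Before (y + e i) z
  · have := hV.jump_exit_comm hy hz hleft hb hζy hζy'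
    rw [hsw, sumShift_update h0 r (hfin.update _ _) (hleft.update hb s), hIH, hη₀, hζ₀ζ,
      sumShift_update h0 r (hfin.update _ _) (hleft.update hyz s)]
    linarith
  · have hi : i = 0 := by
      by_contra hi
      have hi1 : i = 1 := by omega
      subst hi1
      have hne : ¬ ((y + e 1).1 = z.1 ∧ (y + e 1).2 = z.2) := fun h => hzy' (Prod.ext h.1 h.2)
      simp only [Before, add_e_one_fst, add_e_one_snd] at hb hyz hne
      omega
    subst hi
    have hbz : Before z (y + e 0) := by
      have hne : ¬ ((y + e 0).1 = z.1 ∧ (y + e 0).2 = z.2) := fun h => hzy' (Prod.ext h.1 h.2)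
      simp only [Before] at *
      omega
    have hleft' : LeftOf ζ (y + e 0) := hleft.mono hbz
    have := hV.jump_exit_exchange hy hz hleft hyz hbz hζy
    rw [sumShift_update h0 r hfin hleft'] at hIH
    rw [hsw, update_update_comm hzy', sumShift_update h0 r (hfin.update _ _) (hleft'.update hbz t),
      sumShift_update h0 r hfin hleft, hη₀, hζ₀ζ,
      sumShift_update h0 r (hfin.update _ _) (hleft.update hyz s)]
    linarith

theorem exists_box_of_finset (s : Finset Z2) : ∃ r : ℕ, ∀ x ∈ s, ¬ Far r x 0 := by
  refine ⟨s.sup fun x => x.1.natAbs + x.2.natAbs, fun x hx => ?_⟩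
  have := Finset.le_sup (f := fun x : Z2 => x.1.natAbs + x.2.natAbs) hx
  simp only [Far, Prod.fst_zero, Prod.snd_zero] at *
  omega

/-- Both sides depend on finitely many sites, so `η` may be replaced by its restriction `ξ` to a
large window. There the sum of translates is finite and `sumShift_swap` applies. -/
theorem IsIsolatedClosed.eq_gradSum {V : Config → EuclideanSpace ℝ (Fin 2)} {r : ℕ}
    (hV : IsIsolatedClosed V r)
    (h0 : ∀ i η, ¬ (η 0 ≠ SiteState.empty ∧ η (e i) = SiteState.empty) → V η i = 0)
    (hloc : IsLocal (exitPotential V r)) (η : Config) (i : Fin 2) :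
    V η i = gradSum (exitPotential V r) η i := by
  classical
  have h00 : ∀ i η, η 0 = SiteState.empty → V η i = 0 := fun i η h => h0 i η fun hc => hc.1 h
  by_cases hη : η 0 ≠ SiteState.empty ∧ η (e i) = SiteState.empty
  swap
  · rw [h0 i η hη, gradSum_apply, licit_mul_eq_zero hη, zero_mul]
  rw [gradSum_apply, licit_iff.2 hη, one_mul]
  obtain ⟨s, hs⟩ := hloc
  set h := exitPotential V r with hh
  -- a finite window that contains all the sites involved
  set X : Finset Z2 := s.image (fun y => - y) ∪ s.image fun y => e i - y with hX
  have hXout : ∀ ξ : Config, ∀ x ∉ X, h (shift x (swap 0 (e i) ξ)) - h (shift x ξ) = 0 := by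
    intro ξ x hx
    refine sub_eq_zero.2 (hs fun y hy => swap_of_ne ξ ?_ ?_)
    · rintro h1
      refine hx (Finset.mem_union_left _ (Finset.mem_image.2 ⟨y, hy, ?_⟩))
      rw [neg_eq_iff_add_eq_zero, h1]
    · rintro h1
      refine hx (Finset.mem_union_right _ (Finset.mem_image.2 ⟨y, hy, ?_⟩))
      rw [← h1, add_sub_cancel_left]
  set b : Finset Z2 := Finset.Icc (-(r : ℤ), -(r : ℤ)) ((r : ℤ), (r : ℤ)) with hb
  set Y : Finset Z2 := {0, e i} ∪ b ∪ X.biUnion fun x => s.image fun y => y + x with hY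
  set ξ : Config := fun x => if x ∈ Y then η x else SiteState.empty with hξ
  have hξY : ∀ x ∈ Y, ξ x = η x := fun x hx => by simp [hξ, hx]
  have hsY : ∀ x ∈ Y, swap 0 (e i) ξ x = swap 0 (e i) η x := by
    intro x hx
    rcases eq_or_ne x 0 with rfl | h1
    · rw [swap_left, swap_left, hξY _ (by simp [hY])]
    rcases eq_or_ne x (e i) with rfl | h2
    · rw [swap_right, swap_right, hξY _ (by simp [hY])]
    rw [swap_of_ne _ h1 h2, swap_of_ne _ h1 h2, hξY x hx]
  have hfin : IsFinite ξ := by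
    refine Y.finite_toSet.subset fun x hx => ?_
    by_contra hc
    exact hx (by simp only [hξ, if_neg fun h => hc (Finset.mem_coe.2 h)])
  have hfin' : IsFinite (swap 0 (e i) ξ) := by
    refine Y.finite_toSet.subset fun x hx => ?_
    by_contra hc
    have h1 : x ≠ 0 := by rintro rfl; exact hc (by simp [hY])
    have h2 : x ≠ e i := by rintro rfl; exact hc (by simp [hY])
    have hc' : x ∉ Y := fun h => hc (Finset.mem_coe.2 h)
    exact hx (by rw [swap_of_ne _ h1 h2]; simp only [hξ, if_neg hc'])
  have hV1 : V η i = V ξ i := hV.loc i _ _ fun x hx => by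
    refine (hξY x ?_).symm
    simp only [hY, Finset.mem_union]
    left; right
    rw [hb, Finset.mem_Icc, Prod.le_def, Prod.le_def]
    simp only [Far, Prod.fst_zero, Prod.snd_zero] at hx
    simp only
    omega
  have hξ0 : ξ 0 = η 0 := hξY _ (by simp [hY])
  have hξe : ξ (e i) = η (e i) := hξY _ (by simp [hY])
  have key := hV.sumShift_swap h00 hfin (y := 0) (i := i) (by rw [hξ0]; exact hη.1)
    (by rw [zero_add, hξe]; exact hη.2)
  rw [zero_add, shift_zero] at key
  have hsupp : ∀ ζ, ζ 0 = SiteState.empty → h ζ = 0 :=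
    fun ζ hζ => exitPotential_of_empty h00 r hζ
  have h1 : totalDiff (fun x ζ => h (shift x ζ)) ξ (swap 0 (e i) ξ) = V ξ i := by
    rw [totalDiff, finsum_sub_distrib (support_sumShift hsupp hfin') (support_sumShift hsupp hfin)]
    exact sub_eq_of_eq_add' key
  rw [hV1, ← h1]
  refine finsum_congr fun x => ?_
  by_cases hx : x ∈ X
  · have hmem : ∀ y ∈ s, y + x ∈ Y := fun y hy => by
      simp only [hY, Finset.mem_union, Finset.mem_biUnion, Finset.mem_image]
      exact Or.inr ⟨x, hx, y, hy, rfl⟩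
    exact congrArg₂ (· - ·) (hs fun y hy => hsY _ (hmem y hy)) (hs fun y hy => hξY _ (hmem y hy))
  · exact (hXout ξ x hx).trans (hXout η x hx).symm

/-! ### Decomposition of closed germs -/

theorem germForm_sub (U W : Config → EuclideanSpace ℝ (Fin 2)) (j : Jump) (η : Config) :
    germForm (fun η => U η - W η) j η = germForm U j η - germForm W j η := by
  unfold germForm
  split_ifs
  · rfl
  · simp only [PiLp.sub_apply]; ring

theorem pathIntegral_sub (U W : Config → EuclideanSpace ℝ (Fin 2)) (η : Config) (γ : List Jump) :
    pathIntegral (germForm fun η => U η - W η) η γ =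
      pathIntegral (germForm U) η γ - pathIntegral (germForm W) η γ := by
  induction γ generalizing η with
  | nil => simp [pathIntegral]
  | cons j γ ih => simp only [pathIntegral, ih, germForm_sub]; ring

theorem gradSum_zero (η : Config) : gradSum 0 η = 0 := by
  ext i; simp [gradSum_apply, totalDiff]

theorem germ_zero (ψ : Fin 2 → SiteState → ℝ) : germ 0 ψ = flow ψ := by
  funext η; simp [germ, gradSum_zero]

/-- The current seen by a lone particle is removed; the rest is closed and free on isolated
particles, and its exit costs furnish `h`. The identity holds at every configuration, not only
almost surely. -/
theorem IsClosedGerm.eq_germ {ω : Angle → ℝ} (hω : IsC2 ω) {α : GrandParam}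
    {U : Config → EuclideanSpace ℝ (Fin 2)} (hU : IsClosedGerm α U)
    (hT : ∀ i, (fun η => U η i) ∈ weightedSpan ω) :
    ∃ h ∈ weightedSpan ω, ∃ ψ : Fin 2 → SiteState → ℝ, (∀ i, ψ i ∈ siteSpan ω) ∧
      U = germ h ψ := by
  choose ψ hψ hψU using fun i => weightedSpan_at_single (hT i)
  have hψ0 : ∀ i, ψ i SiteState.empty = 0 := fun i => siteSpan_empty (hψ i)
  set V : Config → EuclideanSpace ℝ (Fin 2) := fun η => U η - flow ψ η with hVdef
  have hVT : ∀ i, (fun η => V η i) ∈ weightedSpan ω :=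
    fun i => sub_mem (hT i) (flow_mem_weightedSpan hψ i)
  have hflow := isClosedGerm_germ hω α (weightedSpan ω).zero_mem hψ
  rw [germ_zero] at hflow
  have hU0 : ∀ i η, ¬ (η 0 ≠ SiteState.empty ∧ η (e i) = SiteState.empty) → U η i = 0 := by
    intro i η hη
    have h := (hU.2.1 ⟨0, i, true⟩).2 η
    simp only [germForm, Jump.tgt, if_true, zero_add, shift_zero] at h
    rw [h, licit_mul_eq_zero hη, zero_mul]
  have hV0 : ∀ i η, ¬ (η 0 ≠ SiteState.empty ∧ η (e i) = SiteState.empty) → V η i = 0 := by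
    intro i η hη
    have h := germ_eq_zero_of_not_licit 0 hψ0 hη
    rw [germ_zero] at h
    rw [hVdef, PiLp.sub_apply, hU0 i η hη, h, sub_zero]
  choose s hs using fun i => weightedSpan_isLocal (hVT i)
  obtain ⟨r, hr⟩ := exists_box_of_finset (s 0 ∪ s 1 ∪ {e 0, e 1})
  have hri : ∀ i, ∀ x ∈ s i, ¬ Far r x 0 := by
    intro i x hx
    refine hr x ?_
    match i with
    | 0 => simp [hx]
    | 1 => simp [hx]
  have hre : ∀ i, ¬ Far r (e i) 0 := fun i => hr _ (by match i with | 0 => simp | 1 => simp)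
  have hloc : ∀ i η ξ, (∀ x : Z2, ¬ Far r x 0 → η x = ξ x) → V η i = V ξ i :=
    fun i η ξ h => hs i fun x hx => h x (hri i x hx)
  have hiso : ∀ i η, (∀ x : Z2, x ≠ 0 → ¬ Far r x 0 → η x = SiteState.empty) → V η i = 0 := by
    intro i η h
    have h1 : V η i = V (relabel (fun x => if x = 0 then some 0 else none) η) i := by
      refine hloc i _ _ fun x hx => ?_
      rcases eq_or_ne x 0 with rfl | hx0
      · simp [relabel]
      · simp [relabel, hx0, h x hx0 hx]
    have hψU' := hψU i η
    rw [h1, hVdef, PiLp.sub_apply, hψU', flow_apply, occ_of_empty, sub_zero, mul_one]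
    · simp [relabel]
    · simp [relabel, e_ne_zero]
  have hVc : IsIsolatedClosed V r := ⟨hloc, hiso, fun η γ h1 h2 => by
    rw [hVdef, pathIntegral_sub, hU.2.2 η γ h1 h2, hflow.2.2 η γ h1 h2, sub_zero]⟩
  have hmem := exitPotential_mem_weightedSpan (hVT 0) r
  refine ⟨exitPotential V r, hmem, ψ, hψ, ?_⟩
  funext η
  ext i
  rw [germ, PiLp.add_apply, ← hVc.eq_gradSum hV0 (weightedSpan_isLocal hmem) η i, hVdef,
    PiLp.sub_apply, sub_add_cancel]

/-! ### Canonical averages -/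

theorem mem_box {l : ℕ} {x : Z2} :
    x ∈ box l ↔ -(l : ℤ) ≤ x.1 ∧ x.1 ≤ l ∧ -(l : ℤ) ≤ x.2 ∧ x.2 ≤ l := by
  rw [box, Finset.mem_Icc, Prod.le_def, Prod.le_def]
  simp only
  tauto

theorem box_mono {l m : ℕ} (h : l ≤ m) : box l ⊆ box m := by
  intro x hx
  rw [mem_box] at *
  omega

theorem card_box (l : ℕ) : (box l).card = (2 * l + 1) ^ 2 := by
  have h : box l = Finset.Icc (-(l : ℤ)) l ×ˢ Finset.Icc (-(l : ℤ)) l := by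
    ext x
    rw [mem_box, Finset.mem_product, Finset.mem_Icc, Finset.mem_Icc]
    tauto
  rw [h, Finset.card_product, Int.card_Icc, sq]
  congr 1 <;> omega

theorem permute_permute (π ρ : Equiv.Perm Z2) (η : Config) :
    permute π (permute ρ η) = permute (ρ * π) η := rfl

theorem canonicalMean_eq (l : ℕ) (ζ : Config) (ψ : Config → ℝ) :
    canonicalMean l ζ ψ = (∑ π : Equiv.Perm {x // x ∈ box l},
      ψ (permute (Equiv.Perm.ofSubtype π) ζ)) /
        (Fintype.card (Equiv.Perm {x // x ∈ box l}) : ℝ) := rfl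

theorem ofSubtype_mem_box {l : ℕ} (π : Equiv.Perm {x // x ∈ box l}) {x : Z2} (hx : x ∈ box l) :
    Equiv.Perm.ofSubtype π x ∈ box l := by
  rw [Equiv.Perm.ofSubtype_apply_of_mem π hx]
  exact (π ⟨x, hx⟩).2

theorem exists_ofSubtype_eq {l : ℕ} {σ : Equiv.Perm Z2} (h : ∀ x, σ x ∈ box l ↔ x ∈ box l)
    (h' : ∀ x, σ x ≠ x → x ∈ box l) :
    ∃ ρ : Equiv.Perm {x // x ∈ box l}, Equiv.Perm.ofSubtype ρ = σ :=
  ⟨σ.subtypePerm h, Equiv.Perm.ofSubtype_subtypePerm h h'⟩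

theorem exists_ofSubtype_eq_swap {l : ℕ} {a b : Z2} (ha : a ∈ box l) (hb : b ∈ box l) :
    ∃ ρ : Equiv.Perm {x // x ∈ box l}, Equiv.Perm.ofSubtype ρ = Equiv.swap a b := by
  have h : ∀ x, Equiv.swap a b x ≠ x → x ∈ box l := by
    intro x hx
    by_contra hc
    refine hx (Equiv.swap_apply_of_ne_of_ne ?_ ?_) <;> rintro rfl <;> exact hc ‹_›
  refine exists_ofSubtype_eq (fun x => ?_) h
  rcases eq_or_ne x a with rfl | h1
  · simp [ha, hb]
  rcases eq_or_ne x b with rfl | h2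
  · simp [ha, hb]
  rw [Equiv.swap_apply_of_ne_of_ne h1 h2]

theorem exists_ofSubtype_eq_ofSubtype {l m : ℕ} (h : l ≤ m) (ρ : Equiv.Perm {x // x ∈ box l}) :
    ∃ ρ' : Equiv.Perm {x // x ∈ box m}, Equiv.Perm.ofSubtype ρ' = Equiv.Perm.ofSubtype ρ := by
  have hout : ∀ x, x ∉ box l → Equiv.Perm.ofSubtype ρ x = x := fun x hx =>
    Equiv.Perm.ofSubtype_apply_of_not_mem ρ hx
  refine exists_ofSubtype_eq (fun x => ?_) fun x hx => ?_
  · by_cases hx : x ∈ box l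
    · exact iff_of_true (box_mono h (ofSubtype_mem_box ρ hx)) (box_mono h hx)
    · rw [hout x hx]
  · by_contra hc
    exact hx (hout x fun h' => hc (box_mono h h'))

theorem canonicalMean_permute {l : ℕ} (ρ : Equiv.Perm {x // x ∈ box l}) (ζ : Config)
    (ψ : Config → ℝ) :
    canonicalMean l (permute (Equiv.Perm.ofSubtype ρ) ζ) ψ = canonicalMean l ζ ψ := by
  rw [canonicalMean_eq, canonicalMean_eq, Fintype.sum_equiv (Equiv.mulLeft ρ) _
    (fun π => ψ (permute (Equiv.Perm.ofSubtype π) ζ)) fun π => by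
      rw [permute_permute, ← map_mul, Equiv.coe_mulLeft]]

theorem canonicalMean_comp_permute {l : ℕ} (ρ : Equiv.Perm {x // x ∈ box l}) (ζ : Config)
    (ψ : Config → ℝ) :
    canonicalMean l ζ (fun η => ψ (permute (Equiv.Perm.ofSubtype ρ) η)) =
      canonicalMean l ζ ψ := by
  rw [canonicalMean_eq, canonicalMean_eq, Fintype.sum_equiv (Equiv.mulRight ρ) _
    (fun π => ψ (permute (Equiv.Perm.ofSubtype π) ζ)) fun π => by
      rw [permute_permute, ← map_mul, Equiv.coe_mulRight]]

theorem canonicalMean_sub (l : ℕ) (ζ : Config) (ψ φ : Config → ℝ) :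
    canonicalMean l ζ (ψ - φ) = canonicalMean l ζ ψ - canonicalMean l ζ φ := by
  simp only [canonicalMean_eq, Pi.sub_apply, Finset.sum_sub_distrib, sub_div]

theorem canonicalMean_add (l : ℕ) (ζ : Config) (ψ φ : Config → ℝ) :
    canonicalMean l ζ (ψ + φ) = canonicalMean l ζ ψ + canonicalMean l ζ φ := by
  simp only [canonicalMean_eq, Pi.add_apply, Finset.sum_add_distrib, add_div]

/-- Tower property: a permutation of the small box extends to the large one, whose average is
invariant under it. -/
theorem canonicalMean_canonicalMean {l m : ℕ} (h : l ≤ m) (ζ : Config) (ψ : Config → ℝ) :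
    canonicalMean m ζ (fun η => canonicalMean l η ψ) = canonicalMean m ζ ψ := by
  have hcard : (Fintype.card (Equiv.Perm {x // x ∈ box l}) : ℝ) ≠ 0 :=
    Nat.cast_ne_zero.2 Fintype.card_ne_zero
  have h1 : ∀ ρ : Equiv.Perm {x // x ∈ box l},
      canonicalMean m ζ (fun η => ψ (permute (Equiv.Perm.ofSubtype ρ) η)) =
        canonicalMean m ζ ψ := by
    intro ρ
    obtain ⟨ρ', hρ'⟩ := exists_ofSubtype_eq_ofSubtype h ρ
    rw [← hρ', canonicalMean_comp_permute]
  have h2 : canonicalMean m ζ (fun η => canonicalMean l η ψ) =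
      (∑ ρ : Equiv.Perm {x // x ∈ box l},
        canonicalMean m ζ (fun η => ψ (permute (Equiv.Perm.ofSubtype ρ) η))) /
        (Fintype.card (Equiv.Perm {x // x ∈ box l}) : ℝ) := by
    simp only [canonicalMean_eq, ← Finset.sum_div]
    rw [Finset.sum_comm, div_right_comm]
  rw [h2, Finset.sum_congr rfl fun ρ _ => h1 ρ, Finset.sum_const, Finset.card_univ, nsmul_eq_mul,
    mul_div_cancel_left₀ _ hcard]

theorem canonicalMean_mem_weightedSpan {ω : Angle → ℝ} {h : Config → ℝ}
    (hh : h ∈ weightedSpan ω) (l : ℕ) : (fun η => canonicalMean l η h) ∈ weightedSpan ω := by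
  have : (fun η => canonicalMean l η h) =
      (Fintype.card (Equiv.Perm {x // x ∈ box l}) : ℝ)⁻¹ • ∑ π : Equiv.Perm {x // x ∈ box l},
        fun η => h (relabel (fun x => some (Equiv.Perm.ofSubtype π x)) η) := by
    funext η
    rw [Pi.smul_apply, Finset.sum_apply, smul_eq_mul, mul_comm, ← div_eq_mul_inv]
    rfl
  rw [this]
  exact (weightedSpan ω).smul_mem _ (Submodule.sum_mem _ fun π _ => weightedSpan_comp_relabel hh _)

theorem dependsOn_canonicalMean {h : Config → ℝ} {l : ℕ} (hh : DependsOn h (box l : Set Z2)) :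
    DependsOn (fun η => canonicalMean l η h) (box l : Set Z2) := by
  intro η ξ he
  simp only [canonicalMean_eq]
  congr 1
  exact Finset.sum_congr rfl fun π _ => hh fun x hx => he _ (ofSubtype_mem_box π hx)

theorem card_perm_apply_eq {β : Type*} [Fintype β] [DecidableEq β] (y z : β) :
    Fintype.card β * (Finset.univ.filter fun π : Equiv.Perm β => π y = z).card =
      Fintype.card (Equiv.Perm β) := by
  have h : ∀ w ∈ (Finset.univ : Finset β),
      (Finset.univ.filter fun π : Equiv.Perm β => π y = w).card =
        (Finset.univ.filter fun π : Equiv.Perm β => π y = z).card := by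
    intro w _
    refine Finset.card_equiv (Equiv.mulLeft (Equiv.swap w z)) fun π => ?_
    simp only [Finset.mem_filter, Finset.mem_univ, true_and, Equiv.coe_mulLeft,
      Equiv.Perm.mul_apply]
    constructor
    · intro h; rw [h, Equiv.swap_apply_left]
    · intro h; exact (Equiv.swap w z).injective (h.trans (Equiv.swap_apply_left w z).symm)
  have h' := Finset.card_eq_sum_card_fiberwise (s := Finset.univ)
    (f := fun π : Equiv.Perm β => π y) (t := Finset.univ)
    (fun _ _ => Finset.mem_coe.2 (Finset.mem_univ _))
  rw [← Finset.card_univ (α := Equiv.Perm β), h', Finset.sum_congr rfl h, Finset.sum_const,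
    Finset.card_univ, smul_eq_mul]

/-- The canonical average changes little when one site is changed. -/
theorem abs_canonicalMean_sub_le {h : Config → ℝ} {s : Finset Z2} (hs : DependsOn h (s : Set Z2))
    {C : ℝ} (hC : ∀ η, |h η| ≤ C) {l : ℕ} (hl : s ⊆ box l) {z : Z2} (hz : z ∈ box l)
    {η ξ : Config} (he : ∀ x ∈ box l, x ≠ z → η x = ξ x) :
    |canonicalMean l η h - canonicalMean l ξ h| ≤ 2 * C * s.card / ((2 * l + 1) ^ 2 : ℝ) := by
  classical
  have hC0 : 0 ≤ C := (abs_nonneg _).trans (hC η)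
  set N : ℝ := (Fintype.card (Equiv.Perm {x // x ∈ box l}) : ℝ) with hN
  have hNpos : 0 < N := Nat.cast_pos.2 Fintype.card_pos
  set n : ℝ := ((2 * l + 1) ^ 2 : ℝ) with hn
  have hnpos : 0 < n := by positivity
  have hcount : ∀ y : {x // x ∈ box l}, (((Finset.univ.filter
      fun π : Equiv.Perm {x // x ∈ box l} => π y = ⟨z, hz⟩).card : ℕ) : ℝ) = N / n := by
    intro y
    rw [eq_div_iff hnpos.ne', hN, ← card_perm_apply_eq y ⟨z, hz⟩, Fintype.card_coe, card_box]
    push_cast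
    ring
  -- A permutation matters only if it brings the state of `z` to one of the sites of `s`; for each
  -- such site this is a proportion `1 / n` of all permutations.
  have hterm : ∀ π : Equiv.Perm {x // x ∈ box l},
      |h (permute (Equiv.Perm.ofSubtype π) η) - h (permute (Equiv.Perm.ofSubtype π) ξ)| ≤
        ∑ y ∈ s.attach, if π ⟨y, hl y.2⟩ = ⟨z, hz⟩ then 2 * C else 0 := by
    intro π
    by_cases hex : ∃ y ∈ s.attach, π ⟨y, hl y.2⟩ = ⟨z, hz⟩
    · obtain ⟨y, hy, hπ⟩ := hex
      refine le_trans ?_ (Finset.single_le_sum (fun y _ => ?_) hy)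
      · rw [if_pos hπ]
        refine (abs_sub _ _).trans ?_
        linarith [hC (permute (Equiv.Perm.ofSubtype π) η), hC (permute (Equiv.Perm.ofSubtype π) ξ)]
      · split_ifs <;> linarith
    · have : h (permute (Equiv.Perm.ofSubtype π) η) = h (permute (Equiv.Perm.ofSubtype π) ξ) := by
        refine hs fun y hy => he _ (ofSubtype_mem_box π (hl hy)) fun hc => hex ?_
        refine ⟨⟨y, hy⟩, Finset.mem_attach _ _, Subtype.ext ?_⟩
        rwa [Equiv.Perm.ofSubtype_apply_of_mem π (hl hy)] at hc
      rw [this, sub_self, abs_zero]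
      exact Finset.sum_nonneg fun y _ => by split_ifs <;> linarith
  have hsum : ∑ π : Equiv.Perm {x // x ∈ box l}, ∑ y ∈ s.attach,
      (if π ⟨y, hl y.2⟩ = ⟨z, hz⟩ then 2 * C else 0) = s.card * (2 * C * (N / n)) := by
    rw [Finset.sum_comm]
    have : ∀ y ∈ s.attach, ∑ π : Equiv.Perm {x // x ∈ box l},
        (if π ⟨y, hl y.2⟩ = ⟨z, hz⟩ then 2 * C else 0) = 2 * C * (N / n) := by
      intro y _
      rw [← Finset.sum_filter, Finset.sum_const, nsmul_eq_mul, hcount, mul_comm]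
    rw [Finset.sum_congr rfl this, Finset.sum_const, Finset.card_attach, nsmul_eq_mul]
  rw [canonicalMean_eq, canonicalMean_eq, ← sub_div, ← Finset.sum_sub_distrib, abs_div,
    abs_of_pos hNpos, div_le_iff₀ hNpos]
  refine (Finset.abs_sum_le_sum_abs _ _).trans ((Finset.sum_le_sum fun π _ => hterm π).trans ?_)
  rw [hsum]
  refine le_of_eq ?_
  field_simp

/-- The translations for which exactly one end of the bond `(0, e_i)` is in the box. -/
def boundaryShifts (l : ℕ) (i : Fin 2) : Finset Z2 :=
  if i = 0 then {-(l : ℤ), (l : ℤ) + 1} ×ˢ Finset.Icc (-(l : ℤ)) l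
  else Finset.Icc (-(l : ℤ)) l ×ˢ {-(l : ℤ), (l : ℤ) + 1}

theorem card_boundaryShifts (l : ℕ) (i : Fin 2) :
    (boundaryShifts l i).card = 2 * (2 * l + 1) := by
  have h : ({-(l : ℤ), (l : ℤ) + 1} : Finset ℤ).card = 2 := Finset.card_pair (by omega)
  have h' : (Finset.Icc (-(l : ℤ)) l).card = 2 * l + 1 := by rw [Int.card_Icc]; omega
  unfold boundaryShifts
  split_ifs <;> rw [Finset.card_product, h, h']
  ring

theorem mem_box_iff_of_notMem_boundaryShifts {l : ℕ} {i : Fin 2} {x : Z2}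
    (hx : x ∉ boundaryShifts l i) : -x ∈ box l ↔ e i - x ∈ box l := by
  match i with
  | 0 =>
    simp only [boundaryShifts, if_true, Finset.mem_product, Finset.mem_insert,
      Finset.mem_singleton, Finset.mem_Icc] at hx
    simp [mem_box, e]
    omega
  | 1 =>
    simp only [boundaryShifts, one_ne_zero, if_false, Finset.mem_product, Finset.mem_insert,
      Finset.mem_singleton, Finset.mem_Icc] at hx
    simp [mem_box, e]
    omega

theorem mem_box_or_of_mem_boundaryShifts {l : ℕ} {i : Fin 2} {x : Z2}
    (hx : x ∈ boundaryShifts l i) :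
    (-x ∈ box l ∧ e i - x ∉ box l) ∨ (-x ∉ box l ∧ e i - x ∈ box l) := by
  match i with
  | 0 =>
    simp only [boundaryShifts, if_true, Finset.mem_product, Finset.mem_insert,
      Finset.mem_singleton, Finset.mem_Icc] at hx
    simp [mem_box, e]
    omega
  | 1 =>
    simp only [boundaryShifts, one_ne_zero, if_false, Finset.mem_product, Finset.mem_insert,
      Finset.mem_singleton, Finset.mem_Icc] at hx
    simp [mem_box, e]
    omega

theorem shift_swap_zero (i : Fin 2) (x : Z2) (η : Config) :
    shift x (swap 0 (e i) η) = swap (-x) (e i - x) (shift x η) := by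
  rw [swap_shift, neg_add_cancel, sub_add_cancel]

/-- An exchange inside the box leaves the average invariant, and one outside is not seen. Only the
`2(2l+1)` translates for which the bond crosses the boundary contribute, each at most
`2C|s|/(2l+1)²`. -/
theorem abs_gradSum_canonicalMean_le {h : Config → ℝ} {s : Finset Z2}
    (hs : DependsOn h (s : Set Z2)) {C : ℝ} (hC : ∀ η, |h η| ≤ C) {l : ℕ} (hl : s ⊆ box l)
    (η : Config) (i : Fin 2) :
    |gradSum (fun η => canonicalMean l η h) η i| ≤ 4 * C * s.card / (2 * l + 1 : ℝ) := by
  have hC0 : 0 ≤ C := (abs_nonneg _).trans (hC η)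
  have hpos : (0 : ℝ) < 2 * l + 1 := by positivity
  have hdep := dependsOn_canonicalMean (hs.mono (Finset.coe_subset.2 hl))
  have hbound : |totalDiff (fun x ζ => canonicalMean l (shift x ζ) h) η (swap 0 (e i) η)| ≤
      4 * C * s.card / (2 * l + 1 : ℝ) := by
    rw [totalDiff, finsum_eq_sum_of_support_subset (s := boundaryShifts l i)]
    · refine (Finset.abs_sum_le_sum_abs _ _).trans ?_
      refine (Finset.sum_le_card_nsmul _ _ (2 * C * s.card / ((2 * l + 1) ^ 2 : ℝ))
        fun x hx => ?_).trans (le_of_eq ?_)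
      · rw [shift_swap_zero]
        rcases mem_box_or_of_mem_boundaryShifts hx with ⟨h1, h2⟩ | ⟨h1, h2⟩
        · refine abs_canonicalMean_sub_le hs hC hl h1 fun y hy hne => swap_of_ne _ hne ?_
          rintro rfl; exact h2 hy
        · refine abs_canonicalMean_sub_le hs hC hl h2 fun y hy hne => swap_of_ne _ ?_ hne
          rintro rfl; exact h1 hy
      · rw [card_boundaryShifts, nsmul_eq_mul]
        push_cast
        field_simp
        ring
    · intro x hx
      by_contra hc
      refine hx (sub_eq_zero.2 ?_)
      have hiff := mem_box_iff_of_notMem_boundaryShifts fun h' => hc (Finset.mem_coe.2 h')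
      rw [shift_swap_zero]
      by_cases h1 : -x ∈ box l
      · obtain ⟨ρ, hρ⟩ := exists_ofSubtype_eq_swap h1 (hiff.1 h1)
        have := canonicalMean_permute ρ (shift x η) h
        rw [hρ] at this
        exact this
      · refine hdep fun y hy => swap_of_ne _ ?_ ?_
        · rintro rfl; exact h1 hy
        · rintro rfl; exact h1 (hiff.2 hy)
  rw [gradSum_apply, abs_mul]
  refine le_trans ?_ hbound
  by_cases hη : η 0 ≠ SiteState.empty ∧ η (e i) = SiteState.empty
  · rw [licit_iff.2 hη, abs_one, one_mul]
  · rw [licit_mul_eq_zero hη, abs_zero, zero_mul]; exact abs_nonneg _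

/-! ### Centred approximations -/

theorem gradSum_add {h k : Config → ℝ} (hh : IsLocal h) (hk : IsLocal k) (η : Config) :
    gradSum (h + k) η = gradSum h η + gradSum k η := by
  ext i
  rw [PiLp.add_apply, gradSum_apply, gradSum_apply, gradSum_apply, ← mul_add,
    ← totalDiff_add (isUniformlyLocal_shift hh) (isUniformlyLocal_shift hk) (finDiff_swap _ _ _)]
  rfl

theorem gradSum_smul (a : ℝ) (h : Config → ℝ) (η : Config) :
    gradSum (a • h) η = a • gradSum h η := by
  ext i
  rw [PiLp.smul_apply, gradSum_apply, gradSum_apply, smul_eq_mul, mul_left_comm]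
  exact congrArg _ (totalDiff_smul a η _)

/-- The translates of `occ a` and of `occ b` have the same formal sum. -/
theorem gradSum_occ_sub (a b : Z2) (η : Config) : gradSum (occ a - occ b) η = 0 := by
  ext i
  rw [gradSum_apply]
  have hfin : ∀ c : Z2, (Function.support fun x =>
      occ c (shift x (swap 0 (e i) η)) - occ c (shift x η)).Finite := fun c =>
    support_totalDiff (isUniformlyLocal_shift (isLocal_occ c)) (finDiff_swap _ _ _)
  have hsum : ∀ c : Z2, ∑ᶠ x, (occ c (shift x (swap 0 (e i) η)) - occ c (shift x η)) =
      ∑ᶠ x, (occ x (swap 0 (e i) η) - occ x η) := fun c =>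
    finsum_comp_equiv (Equiv.addLeft c) (f := fun x => occ x (swap 0 (e i) η) - occ x η)
  have : totalDiff (fun x ζ => (occ a - occ b) (shift x ζ)) η (swap 0 (e i) η) = 0 := by
    rw [totalDiff, ← sub_eq_zero.2 ((hsum a).trans (hsum b).symm),
      ← finsum_sub_distrib (hfin a) (hfin b)]
    refine finsum_congr fun x => ?_
    simp only [Pi.sub_apply]
    ring
  rw [this, mul_zero]
  rfl

theorem occ_mem_weightedSpan (ω : Angle → ℝ) (x : Z2) : occ x ∈ weightedSpan ω := by
  have h := mul_mem_weightedSpan (coeff_mem_siteSpan ω 1 1 0 0) x (isBlind_const 1)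
    (isLocal_const 1)
  convert h using 1
  funext η
  simp [occ, num]

theorem canonicalMean_occ_sub {l : ℕ} {a b : Z2} (ha : a ∈ box l) (hb : b ∈ box l)
    (ζ : Config) : canonicalMean l ζ (occ a - occ b) = 0 := by
  obtain ⟨ρ, hρ⟩ := exists_ofSubtype_eq_swap ha hb
  rw [canonicalMean_sub, sub_eq_zero, ← canonicalMean_comp_permute ρ ζ (occ b), hρ]
  congr 1
  funext η
  simp [permute, occ, num]

/-- Every function of the weighted span differs by a function with a small gradient from one
that is centred. -/
theorem exists_centered_approx {ω : Angle → ℝ} (hω : IsC2 ω) {h : Config → ℝ}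
    (hh : h ∈ weightedSpan ω) {ε : ℝ} (hε : 0 < ε) :
    ∃ f ∈ weightedSpan ω, IsCenteredCylinder f ∧
      ∀ η i, |gradSum h η i - gradSum f η i| ≤ ε := by
  obtain ⟨s, hs⟩ := weightedSpan_isLocal hh
  obtain ⟨C, hC⟩ := weightedSpan_bounded hω hh
  obtain ⟨r, hr⟩ := exists_box_of_finset s
  obtain ⟨K, hK⟩ := exists_nat_gt (4 * C * s.card / ε)
  set l : ℕ := r + K + 1 with hl
  have hsl : s ⊆ box l := fun x hx => by
    have := hr x hx
    simp only [Far, Prod.fst_zero, Prod.snd_zero] at this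
    rw [mem_box]
    omega
  have hsl' : (s : Set Z2) ⊆ box l := Finset.coe_subset.2 hsl
  set m : Config → ℝ := fun η => canonicalMean l η h with hm
  have hmT : m ∈ weightedSpan ω := canonicalMean_mem_weightedSpan hh l
  have hsmall : ∀ η i, |gradSum m η i| ≤ ε := by
    intro η i
    refine (abs_gradSum_canonicalMean_le hs hC hsl η i).trans ?_
    have hpos : (0 : ℝ) < 2 * l + 1 := by positivity
    rw [div_le_iff₀ hpos]
    rw [div_lt_iff₀ hε] at hK
    have : (K : ℝ) ≤ 2 * l + 1 := by
      have : K ≤ 2 * l + 1 := by omega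
      exact_mod_cast this
    nlinarith
  set f₀ : Config → ℝ := h - m with hf₀
  have hf₀T : f₀ ∈ weightedSpan ω := sub_mem hh hmT
  have hf₀g : ∀ η i, |gradSum h η i - gradSum f₀ η i| ≤ ε := by
    intro η i
    have h1 := gradSum_add (weightedSpan_isLocal hf₀T) (weightedSpan_isLocal hmT) η
    rw [hf₀, sub_add_cancel, ← hf₀] at h1
    rw [h1, PiLp.add_apply, add_sub_cancel_left]
    exact hsmall η i
  have hmean₀ : ∀ k, l ≤ k → ∀ ζ, canonicalMean k ζ f₀ = 0 := fun k hk ζ => by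
    rw [hf₀, canonicalMean_sub, hm, canonicalMean_canonicalMean hk, sub_self]
  -- The average over `box l` or a larger box vanishes by construction. The definition also tests
  -- any smaller box that happens to carry `f₀`, where nothing is known.
  by_cases hdep : ∃ k < l, DependsOn f₀ (box k : Set Z2)
  swap
  · refine ⟨f₀, hf₀T, ⟨weightedSpan_isCylinder hω hf₀T, fun k hk ζ _ => hmean₀ k ?_ ζ⟩, hf₀g⟩
    by_contra hc
    exact hdep ⟨k, by omega, hk⟩
  -- Adding a difference of corner occupations makes the function sensitive to the whole box.
  obtain ⟨k₀, hk₀, hdep₀⟩ := hdep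
  set a : Z2 := ((l : ℤ), (l : ℤ)) with ha
  set b : Z2 := ((l : ℤ), -(l : ℤ)) with hb
  have hab : b ≠ a := by
    intro h; have := congrArg Prod.snd h; simp only [ha, hb] at this; omega
  have hak : ∀ k < l, a ∉ box k := fun k hk h => by rw [mem_box] at h; simp only [ha] at h; omega
  have habox : ∀ k, l ≤ k → a ∈ box k := fun k hk => by rw [mem_box]; simp only [ha]; omega
  have hbbox : ∀ k, l ≤ k → b ∈ box k := fun k hk => by rw [mem_box]; simp only [hb]; omega
  set g : Config → ℝ := occ a - occ b with hg
  have hgT : g ∈ weightedSpan ω := sub_mem (occ_mem_weightedSpan ω a) (occ_mem_weightedSpan ω b)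
  have hf₁T : f₀ + g ∈ weightedSpan ω := add_mem hf₀T hgT
  have hndep : ∀ k < l, ¬ DependsOn (f₀ + g) (box k : Set Z2) := by
    intro k hk hd
    set η₀ : Config := fun _ => SiteState.empty with hη₀
    set η₁ : Config := Function.update η₀ a (SiteState.particle .active 0) with hη₁
    have hne : ∀ {k}, k < l → ∀ x ∈ (box k : Set Z2), η₁ x = η₀ x := fun {k} hk x hx => by
      have : x ≠ a := by rintro rfl; exact hak k hk hx
      rw [hη₁, Function.update_of_ne this]
    have e1 := hd (hne hk)
    rw [Pi.add_apply, Pi.add_apply, hdep₀ (hne hk₀), add_right_inj] at e1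
    have h1 : η₁ a ≠ SiteState.empty := by
      rw [hη₁, Function.update_self, Ne, SiteState.eq_empty_iff]
      simp [SiteState.particle]
    have h2 : η₁ b = SiteState.empty := by rw [hη₁, Function.update_of_ne hab]
    rw [hg, Pi.sub_apply, Pi.sub_apply, occ_of_ne_empty h1, occ_of_empty h2,
      occ_of_empty (η := η₀) rfl, occ_of_empty (η := η₀) rfl] at e1
    norm_num at e1
  refine ⟨f₀ + g, hf₁T, ⟨weightedSpan_isCylinder hω hf₁T, fun k hk ζ _ => ?_⟩, fun η i => ?_⟩
  · have hlk : l ≤ k := by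
      by_contra hc
      exact hndep k (by omega) hk
    rw [canonicalMean_add, hmean₀ k hlk, hg, canonicalMean_occ_sub (habox k hlk) (hbbox k hlk),
      add_zero]
  · rw [gradSum_add (weightedSpan_isLocal hf₀T) (weightedSpan_isLocal hgT), hg, gradSum_occ_sub,
      add_zero]
    exact hf₀g η i

/-! ### Differences of formal sums under permutations of finitely many sites -/

/-- The permutation moves finitely many sites only. -/
def FinSupp (π : Equiv.Perm Z2) : Prop := ∃ Y : Finset Z2, ∀ x ∉ Y, π x = x

theorem finSupp_swap (a b : Z2) : FinSupp (Equiv.swap a b) :=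
  ⟨{a, b}, fun x hx => by
    simp only [Finset.mem_insert, Finset.mem_singleton, not_or] at hx
    exact Equiv.swap_apply_of_ne_of_ne hx.1 hx.2⟩

theorem FinSupp.mul {π ρ : Equiv.Perm Z2} (h : FinSupp π) (h' : FinSupp ρ) :
    FinSupp (π * ρ) := by
  classical
  obtain ⟨Y, hY⟩ := h
  obtain ⟨Y', hY'⟩ := h'
  refine ⟨Y ∪ Y', fun x hx => ?_⟩
  rw [Finset.mem_union, not_or] at hx
  rw [Equiv.Perm.mul_apply, hY' x hx.2, hY x hx.1]

theorem FinSupp.finDiff {π : Equiv.Perm Z2} (h : FinSupp π) (η : Config) :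
    FinDiff η (permute π η) := by
  obtain ⟨Y, hY⟩ := h
  refine Y.finite_toSet.subset fun x hx => ?_
  by_contra hc
  exact hx (by rw [permute, hY x fun h => hc (Finset.mem_coe.2 h)])

/-- The finite window of translates is independent of the configuration, so the formal difference is
measurable and can be integrated term by term. -/
theorem FinSupp.totalDiff_eq_sum {π : Equiv.Perm Z2} (h : FinSupp π) {k : Z2 → Config → ℝ}
    (hk : IsUniformlyLocal k) :
    ∃ X₀ : Finset Z2, ∀ X, X₀ ⊆ X → ∀ η,
      totalDiff k η (permute π η) = ∑ x ∈ X, (k x (permute π η) - k x η) := by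
  classical
  obtain ⟨Y, hY⟩ := h
  obtain ⟨s, hs⟩ := hk
  refine ⟨Y.biUnion fun z => s.image fun y => z - y, fun X hX η => ?_⟩
  refine finsum_eq_sum_of_support_subset _ fun x hx => ?_
  by_contra hc
  refine hx (sub_eq_zero.2 (hs x _ _ fun y hy => ?_))
  rw [permute, hY]
  intro hmem
  refine hc (Finset.mem_coe.2 (hX ?_))
  simp only [Finset.mem_biUnion, Finset.mem_image]
  exact ⟨y + x, hmem, y, hy, add_sub_cancel_left _ _⟩

theorem totalDiff_permute_mul {k : Z2 → Config → ℝ} (hk : IsUniformlyLocal k)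
    {π ρ : Equiv.Perm Z2} (hπ : FinSupp π) (hρ : FinSupp ρ) (η : Config) :
    totalDiff k η (permute (π * ρ) η) =
      totalDiff k η (permute π η) + totalDiff k (permute π η) (permute ρ (permute π η)) := by
  rw [permute_permute]
  refine totalDiff_trans hk (hπ.finDiff η) ?_
  rw [← permute_permute]
  exact hρ.finDiff _

/-! ### Bounded measurable functions -/

/-- Bounded measurable functions. -/
def IsBM (f : Config → ℝ) : Prop := Measurable f ∧ ∃ C, ∀ η, |f η| ≤ C

theorem IsBM.add {f g : Config → ℝ} (hf : IsBM f) (hg : IsBM g) : IsBM fun η => f η + g η := by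
  obtain ⟨hf, C, hC⟩ := hf
  obtain ⟨hg, D, hD⟩ := hg
  exact ⟨hf.add hg, C + D, fun η => (abs_add_le _ _).trans (add_le_add (hC η) (hD η))⟩

theorem IsBM.mul {f g : Config → ℝ} (hf : IsBM f) (hg : IsBM g) : IsBM fun η => f η * g η := by
  obtain ⟨hf, C, hC⟩ := hf
  obtain ⟨hg, D, hD⟩ := hg
  refine ⟨hf.mul hg, C * D, fun η => ?_⟩
  rw [abs_mul]
  exact mul_le_mul (hC η) (hD η) (abs_nonneg _) ((abs_nonneg _).trans (hC η))

theorem isBM_const (a : ℝ) : IsBM fun _ => a := ⟨measurable_const, |a|, fun _ => le_rfl⟩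

theorem IsBM.sub {f g : Config → ℝ} (hf : IsBM f) (hg : IsBM g) : IsBM fun η => f η - g η := by
  have := hf.add ((isBM_const (-1)).mul hg)
  simpa [sub_eq_add_neg] using this

theorem IsBM.sum {ι : Type*} {f : ι → Config → ℝ} (hf : ∀ i, IsBM (f i)) (s : Finset ι) :
    IsBM fun η => ∑ i ∈ s, f i η := by
  classical
  induction s using Finset.induction_on with
  | empty => simpa using isBM_const 0
  | insert a s ha ih => simpa only [Finset.sum_insert ha] using (hf a).add ih

theorem measurable_permute (π : Equiv.Perm Z2) : Measurable (permute π) :=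
  measurable_pi_lambda _ fun _ => measurable_pi_apply _

theorem measurable_shift (x : Z2) : Measurable (shift x) :=
  measurable_pi_lambda _ fun _ => measurable_pi_apply _

theorem IsBM.comp {f : Config → ℝ} (hf : IsBM f) {T : Config → Config} (hT : Measurable T) :
    IsBM fun η => f (T η) :=
  ⟨hf.1.comp hT, hf.2.imp fun _ hC _ => hC _⟩

theorem IsBM.integrable {f : Config → ℝ} (hf : IsBM f) (α : GrandParam) :
    Integrable f (grandMeasure α) := by
  obtain ⟨hf, C, hC⟩ := hf
  exact Integrable.of_bound hf.aestronglyMeasurable C (Filter.Eventually.of_forall hC)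

theorem integral_permute (α : GrandParam) (π : Equiv.Perm Z2) {f : Config → ℝ} (hf : IsBM f) :
    ∫ η, f (permute π η) ∂grandMeasure α = ∫ η, f η ∂grandMeasure α := by
  have h := measurePreserving_permute α π
  conv_rhs => rw [← h.map_eq]
  rw [integral_map h.measurable.aemeasurable hf.1.aestronglyMeasurable]

theorem isBM_of_weightedSpan {ω : Angle → ℝ} (hω : IsC2 ω) {f : Config → ℝ}
    (hf : f ∈ weightedSpan ω) : IsBM f :=
  ⟨weightedSpan_measurable hω hf, weightedSpan_bounded hω hf⟩

theorem isBM_site {ω : Angle → ℝ} (hω : IsC2 ω) {ψ : SiteState → ℝ} (hψ : ψ ∈ siteSpan ω)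
    (x : Z2) : IsBM fun η => ψ (η x) :=
  ⟨(siteSpan_measurable hω hψ).comp (measurable_pi_apply x),
    (siteSpan_bounded hω hψ).imp fun _ hC _ => hC _⟩

theorem isBM_potential {ω : Angle → ℝ} (hω : IsC2 ω) {h : Config → ℝ}
    (hh : h ∈ weightedSpan ω) {ψ : Fin 2 → SiteState → ℝ} (hψ : ∀ i, ψ i ∈ siteSpan ω) (x : Z2) :
    IsBM (potential h ψ x) :=
  ((isBM_of_weightedSpan hω hh).comp (measurable_shift x)).add
    (IsBM.sum (fun i => (isBM_const _).mul (isBM_site hω (hψ i) x)) _)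

theorem isBM_totalDiff {k : Z2 → Config → ℝ} (hk : IsUniformlyLocal k) (hB : ∀ x, IsBM (k x))
    {π : Equiv.Perm Z2} (hπ : FinSupp π) : IsBM fun η => totalDiff k η (permute π η) := by
  obtain ⟨X, hX⟩ := hπ.totalDiff_eq_sum hk
  simp only [hX X subset_rfl]
  exact IsBM.sum (fun x => ((hB x).comp (measurable_permute π)).sub (hB x)) X

/-! ### Permutations realized by the motion of a hole -/

/-- The change of the formal potential under the permutation `π` of the sites is, on the
configurations with a hole at `a`, at most `N` times a jump in mean. -/
structure HoleBound (α : GrandParam) (k : Z2 → Config → ℝ) (δ : ℝ≥0∞) (π : Equiv.Perm Z2)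
    (a : Z2) (N : ℕ) : Prop where
  finSupp : FinSupp π
  bound : ∀ A : Set Config, MeasurableSet A → (∀ η ∈ A, η a = SiteState.empty) →
    eLpNorm (fun η => totalDiff k η (permute π η)) 1 ((grandMeasure α).restrict A) ≤
      N * (δ * grandMeasure α A ^ (1 / 2 : ℝ))

/-- With `permute`, the product `π * ρ` performs `π` first, which carries the hole from `a` to `b`.
The image event `A'` has the same probability because the measure is exchangeable. -/
theorem HoleBound.mul {α : GrandParam} {k : Z2 → Config → ℝ} (hk : IsUniformlyLocal k)
    (hB : ∀ x, IsBM (k x)) {δ : ℝ≥0∞} {π ρ : Equiv.Perm Z2} {a b : Z2} {N M : ℕ}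
    (h : HoleBound α k δ π a N) (h' : HoleBound α k δ ρ b M) (hb : π b = a) :
    HoleBound α k δ (π * ρ) a (N + M) := by
  refine ⟨h.finSupp.mul h'.finSupp, fun A hA hole => ?_⟩
  have hm := (isBM_totalDiff hk hB h.finSupp).1
  have hm' := (isBM_totalDiff hk hB h'.finSupp).1
  have hsplit : (fun η => totalDiff k η (permute (π * ρ) η)) =
      (fun η => totalDiff k η (permute π η)) +
        ((fun η => totalDiff k η (permute ρ η)) ∘ permute π) := by
    funext η
    exact totalDiff_permute_mul hk h.finSupp h'.finSupp η
  set A' : Set Config := permute π⁻¹ ⁻¹' A with hA'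
  have hA'm : MeasurableSet A' := measurable_permute _ hA
  have hAA' : A = permute π ⁻¹' A' := by
    ext η
    have : permute π⁻¹ (permute π η) = η := by funext x; simp [permute]
    rw [hA', Set.mem_preimage, Set.mem_preimage, this]
  have hmeas : grandMeasure α A' = grandMeasure α A :=
    (measurePreserving_permute α π⁻¹).measure_preimage hA.nullMeasurableSet
  rw [hsplit]
  refine (eLpNorm_add_le hm.aestronglyMeasurable
    (hm'.comp (measurable_permute π)).aestronglyMeasurable le_rfl).trans ?_
  have h2 : eLpNorm ((fun η => totalDiff k η (permute ρ η)) ∘ permute π) 1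
      ((grandMeasure α).restrict A) ≤ M * (δ * grandMeasure α A ^ (1 / 2 : ℝ)) := by
    rw [hAA', eLpNorm_comp_measurePreserving hm'.aestronglyMeasurable
      ((measurePreserving_permute α π).restrict_preimage hA'm), ← hAA', ← hmeas]
    refine h'.bound A' hA'm fun η hη => ?_
    have h3 : permute π⁻¹ η a = η b := by simp [permute, ← hb]
    rw [← h3]
    exact hole _ hη
  push_cast
  rw [add_mul]
  exact add_le_add (h.bound A hA hole) h2

/-- Cauchy–Schwarz on the event `A`. The factor `P(A)^{1/2}` is what later makes the sum over the
positions of the hole converge. -/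
theorem eLpNorm_restrict_le_of_measurePreserving {α : GrandParam}
    {D : Config → EuclideanSpace ℝ (Fin 2)} (hD : MemLp D 2 (grandMeasure α))
    {T : Config → Config} (hT : MeasurePreserving T (grandMeasure α) (grandMeasure α))
    {F : Config → ℝ} {A : Set Config} (hA : MeasurableSet A)
    (hF : ∀ η ∈ A, |F η| ≤ ‖D (T η)‖) :
    eLpNorm F 1 ((grandMeasure α).restrict A) ≤
      eLpNorm D 2 (grandMeasure α) * grandMeasure α A ^ (1 / 2 : ℝ) := by
  have hDT := hD.comp_measurePreserving hT
  calc eLpNorm F 1 ((grandMeasure α).restrict A)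
      ≤ eLpNorm (D ∘ T) 1 ((grandMeasure α).restrict A) :=
        eLpNorm_mono_ae ((ae_restrict_iff' hA).2 (Filter.Eventually.of_forall hF))
    _ ≤ eLpNorm (D ∘ T) 2 ((grandMeasure α).restrict A) *
          ((grandMeasure α).restrict A) Set.univ ^
              (1 / (1 : ℝ≥0∞).toReal - 1 / (2 : ℝ≥0∞).toReal) :=
        eLpNorm_le_eLpNorm_mul_rpow_measure_univ (by norm_num) hDT.1.restrict
    _ = eLpNorm (D ∘ T) 2 ((grandMeasure α).restrict A) * grandMeasure α A ^ (1 / 2 : ℝ) := by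
        rw [Measure.restrict_apply_univ]
        norm_num
    _ ≤ eLpNorm (D ∘ T) 2 (grandMeasure α) * grandMeasure α A ^ (1 / 2 : ℝ) := by
        gcongr
        exact Measure.restrict_le_self
    _ = _ := by rw [eLpNorm_comp_measurePreserving hD.1 hT]

theorem abs_apply_le_norm (v : EuclideanSpace ℝ (Fin 2)) (i : Fin 2) : |v i| ≤ ‖v‖ :=
  PiLp.norm_apply_le v i

/-- Exchanging a hole with a neighbour is a licit jump of that neighbour, or nothing if both sites
are empty. So the change of the potential is, up to sign, a value of the germ at a configuration
with the same law. -/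
theorem holeBound_swap {α : GrandParam} {h : Config → ℝ} (hh : IsLocal h)
    {ψ : Fin 2 → SiteState → ℝ} (hψ : ∀ i, ψ i SiteState.empty = 0)
    (hD : MemLp (germ h ψ) 2 (grandMeasure α)) (y : Z2) (i : Fin 2) {a : Z2}
    (ha : a = y ∨ a = y + e i) :
    HoleBound α (potential h ψ) (eLpNorm (germ h ψ) 2 (grandMeasure α))
      (Equiv.swap y (y + e i)) a 1 := by
  refine ⟨finSupp_swap _ _, fun A hA hole => ?_⟩
  rw [Nat.cast_one, one_mul]
  rcases ha with rfl | rfl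
  · refine eLpNorm_restrict_le_of_measurePreserving hD ((measurePreserving_shift α a).comp
      (measurePreserving_swap α a (a + e i))) hA fun η hη => ?_
    change |totalDiff (potential h ψ) η (swap a (a + e i) η)| ≤ _
    by_cases hb : η (a + e i) = SiteState.empty
    · rw [swap_eq_self ((hole η hη).trans hb.symm), totalDiff_self, abs_zero]
      exact norm_nonneg _
    · set ξ := swap a (a + e i) η with hξ
      have hl : ξ a ≠ SiteState.empty ∧ ξ (a + e i) = SiteState.empty := by
        rw [hξ, swap_left, swap_right]; exact ⟨hb, hole η hη⟩
      have h1 := germ_shift_of_licit hh hψ hl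
      rw [hξ, swap_swap, ← hξ] at h1
      rw [totalDiff_symm, abs_neg, ← h1]
      exact abs_apply_le_norm _ i
  · refine eLpNorm_restrict_le_of_measurePreserving hD (measurePreserving_shift α y) hA
      fun η hη => ?_
    change |totalDiff (potential h ψ) η (swap y (y + e i) η)| ≤ _
    by_cases hb : η y = SiteState.empty
    · rw [swap_eq_self (hb.trans (hole η hη).symm), totalDiff_self, abs_zero]
      exact norm_nonneg _
    · rw [← germ_shift_of_licit hh hψ ⟨hb, hole η hη⟩]
      exact abs_apply_le_norm _ i

/-- The rotation of the sites `0`, `e_i`, `e_j`, as the motion of a hole around a plaquette. -/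
def rotation (i j : Fin 2) : Equiv.Perm Z2 :=
  Equiv.swap (e j + e i) (e i) * Equiv.swap (e i) 0 * Equiv.swap 0 (e j) *
    Equiv.swap (e j) (e j + e i)

/-- The sites of the ray on which a hole is looked for. -/
def raySite (i j : Fin 2) (k : ℕ) : Z2 := e j + e i + k • e i

theorem e_ne_e {i j : Fin 2} (hij : i ≠ j) : e i ≠ e j := by
  fin_cases i <;> fin_cases j <;> simp_all [e]

theorem raySite_ne_zero {i j : Fin 2} (hij : i ≠ j) (k : ℕ) : raySite i j k ≠ 0 := by
  fin_cases i <;> fin_cases j <;> simp_all [e, raySite, Prod.ext_iff]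

theorem raySite_ne_left {i j : Fin 2} (hij : i ≠ j) (k : ℕ) : raySite i j k ≠ e i := by
  fin_cases i <;> fin_cases j <;> simp_all [e, raySite, Prod.ext_iff]

theorem raySite_ne_right {i j : Fin 2} (hij : i ≠ j) (k : ℕ) : raySite i j k ≠ e j := by
  fin_cases i <;> fin_cases j <;> simp_all [e, raySite, Prod.ext_iff] <;> omega

theorem raySite_zero (i j : Fin 2) : raySite i j 0 = e j + e i := by simp [raySite]

theorem raySite_succ (i j : Fin 2) (k : ℕ) : raySite i j (k + 1) = raySite i j k + e i := by
  rw [raySite, raySite, succ_nsmul, add_assoc (e j + e i)]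

theorem raySite_injective (i j : Fin 2) : Function.Injective (raySite i j) := by
  intro k l h
  match i with
  | 0 => simpa [raySite, e] using h
  | 1 => simpa [raySite, e] using h

variable {i j : Fin 2}

theorem rotation_left (hij : i ≠ j) : rotation i j (e i) = 0 := by
  have h1 := raySite_ne_zero hij 0
  have h2 := raySite_ne_left hij 0
  rw [raySite_zero] at h1 h2
  simp only [rotation, Equiv.Perm.mul_apply]
  rw [Equiv.swap_apply_of_ne_of_ne (e_ne_e hij) h2.symm,
    Equiv.swap_apply_of_ne_of_ne (e_ne_zero i) (e_ne_e hij), Equiv.swap_apply_left,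
    Equiv.swap_apply_of_ne_of_ne h1.symm (e_ne_zero i).symm]

theorem rotation_right (hij : i ≠ j) : rotation i j (e j) = e i := by
  have h1 := raySite_ne_zero hij 0
  have h2 := raySite_ne_left hij 0
  have h3 := raySite_ne_right hij 0
  rw [raySite_zero] at h1 h2 h3
  simp only [rotation, Equiv.Perm.mul_apply]
  rw [Equiv.swap_apply_left, Equiv.swap_apply_of_ne_of_ne h1 h3,
    Equiv.swap_apply_of_ne_of_ne h2 h1, Equiv.swap_apply_left]

theorem rotation_of_ne {x : Z2} (h0 : x ≠ 0) (hi : x ≠ e i) (hj : x ≠ e j) :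
    rotation i j x = x := by
  simp only [rotation, Equiv.Perm.mul_apply]
  rcases eq_or_ne x (e j + e i) with rfl | hc
  · rw [Equiv.swap_apply_right, Equiv.swap_apply_right,
      Equiv.swap_apply_right, Equiv.swap_apply_right]
  · rw [Equiv.swap_apply_of_ne_of_ne hj hc, Equiv.swap_apply_of_ne_of_ne h0 hj,
      Equiv.swap_apply_of_ne_of_ne hi h0, Equiv.swap_apply_of_ne_of_ne hc hi]

theorem rotation_raySite (hij : i ≠ j) (k : ℕ) : rotation i j (raySite i j k) = raySite i j k :=
  rotation_of_ne (raySite_ne_zero hij k) (raySite_ne_left hij k) (raySite_ne_right hij k)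

/-- The hole makes `k` jumps to the plaquette, four around it and `k` back. -/
theorem holeBound_rotation {ω : Angle → ℝ} (hω : IsC2 ω) (α : GrandParam) {h : Config → ℝ}
    (hh : h ∈ weightedSpan ω) {ψ : Fin 2 → SiteState → ℝ} (hψ : ∀ i, ψ i ∈ siteSpan ω)
    (hij : i ≠ j) (k : ℕ) :
    HoleBound α (potential h ψ) (eLpNorm (germ h ψ) 2 (grandMeasure α)) (rotation i j)
      (raySite i j k) (2 * k + 4) := by
  have hl := weightedSpan_isLocal hh
  have hul := isUniformlyLocal_potential hl ψ
  have hB := isBM_potential hω hh hψ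
  have hsw := fun y m {a} ha => holeBound_swap (α := α) hl (fun i => siteSpan_empty (hψ i))
    (memLp_of_weightedSpan hω α (germ_mem_weightedSpan hh hψ)) y m (a := a) ha
  induction k with
  | zero =>
    rw [raySite_zero]
    have s1 := hsw (e i) j (a := e j + e i) (Or.inr (add_comm _ _))
    have s2 := hsw 0 i (a := e i) (Or.inr (zero_add _).symm)
    have s3 := hsw 0 j (a := 0) (Or.inl rfl)
    have s4 := hsw (e j) i (a := e j) (Or.inl rfl)
    rw [add_comm (e i), Equiv.swap_comm] at s1
    rw [zero_add, Equiv.swap_comm] at s2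
    rw [zero_add] at s3
    have t2 := HoleBound.mul hul hB s1 s2 (Equiv.swap_apply_right _ _)
    have t3 := HoleBound.mul hul hB t2 s3 (by
      rw [Equiv.Perm.mul_apply, Equiv.swap_apply_right, Equiv.swap_apply_right])
    have t4 := HoleBound.mul hul hB t3 s4 (by
      rw [Equiv.Perm.mul_apply, Equiv.Perm.mul_apply, Equiv.swap_apply_right,
        Equiv.swap_apply_right, Equiv.swap_apply_right])
    exact t4
  | succ k ih =>
    have s1 := hsw (raySite i j k) i (Or.inr rfl)
    have s2 := hsw (raySite i j k) i (Or.inl rfl)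
    rw [← raySite_succ] at s1 s2
    have t1 := HoleBound.mul hul hB s1 ih (Equiv.swap_apply_left _ _)
    have t2 := HoleBound.mul hul hB t1 s2 (by
      rw [Equiv.Perm.mul_apply, rotation_raySite hij, Equiv.swap_apply_left])
    -- The rotation fixes the sites of the ray, so conjugation by the walk of the hole leaves it
    -- unchanged.
    have hcomm : Equiv.swap (raySite i j k) (raySite i j (k + 1)) * rotation i j *
        Equiv.swap (raySite i j k) (raySite i j (k + 1)) = rotation i j := by
      rw [mul_assoc, Equiv.mul_swap_eq_swap_mul, rotation_raySite hij, rotation_raySite hij,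
        ← mul_assoc, Equiv.swap_mul_self, one_mul]
    rw [hcomm] at t2
    convert t2 using 1
    ring

/-! ### Currents are not limits of exact germs -/

theorem integral_site_mul_shift {f : Config → ℝ} (hf : IsBM f) {χ : SiteState → ℝ}
    (hχ : ∀ x, IsBM fun η => χ (η x)) (α : GrandParam) (a x : Z2) :
    ∫ η, χ (η a) * f (shift x η) ∂grandMeasure α =
      ∫ η, χ (η (a - x)) * f η ∂grandMeasure α := by
  rw [← integral_permute α (Equiv.addRight x) ((hχ (a - x)).mul hf)]
  refine integral_congr_ae (Filter.Eventually.of_forall fun η => ?_)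
  simp only [permute, Equiv.coe_addRight, sub_add_cancel]
  rfl

/-- By translation and permutation invariance the term of index `x` has mean `q (b - x) - q (a -
x)`, where `q z` is the mean of `χ(η_z) h`. Summed over all `x`, the two families cancel. -/
theorem integral_site_mul_totalDiff_shift {ω : Angle → ℝ} (hω : IsC2 ω) (α : GrandParam)
    {h : Config → ℝ} (hh : h ∈ weightedSpan ω) {χ : SiteState → ℝ} (hχ : χ ∈ siteSpan ω)
    {π : Equiv.Perm Z2} (hπ : FinSupp π) (a b : Z2) (hab : π b = a) :
    ∫ η, χ (η a) * totalDiff (fun x ζ => h (shift x ζ)) η (permute π η) ∂grandMeasure α = 0 := by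
  classical
  have hB := isBM_of_weightedSpan hω hh
  have hχB := isBM_site hω hχ
  have hl := weightedSpan_isLocal hh
  obtain ⟨X₀, hX₀⟩ := hπ.totalDiff_eq_sum (isUniformlyLocal_shift hl)
  obtain ⟨s, hs⟩ := hl
  set q : Z2 → ℝ := fun z => ∫ η, χ (η z) * h η ∂grandMeasure α with hq
  -- Outside the window of `h`, `q` is constant by exchangeability. Subtracting this constant makes
  -- both sums over `x` finite.
  have hconst : ∀ z z' : Z2, z ∉ s → z' ∉ s → q z = q z' := by
    intro z z' hz hz'
    rw [hq]
    simp only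
    rw [← integral_permute α (Equiv.swap z z') ((hχB z).mul hB)]
    refine integral_congr_ae (Filter.Eventually.of_forall fun η => ?_)
    have h1 : h (permute (Equiv.swap z z') η) = h η := hs fun x hx => by
      rw [permute, Equiv.swap_apply_of_ne_of_ne]
      · rintro rfl; exact hz hx
      · rintro rfl; exact hz' hx
    simp only [h1, permute, Equiv.swap_apply_left]
  obtain ⟨z₀, hz₀⟩ := Infinite.exists_notMem_finset s
  have hterm : ∀ x, ∫ η, χ (η a) * (h (shift x (permute π η)) - h (shift x η)) ∂grandMeasure α =
      (q (b - x) - q z₀) - (q (a - x) - q z₀) := by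
    intro x
    have h1 : ∫ η, χ (η a) * h (shift x (permute π η)) ∂grandMeasure α = q (b - x) := by
      have hG : IsBM fun ζ => χ (ζ b) * h (shift x ζ) :=
        (hχB b).mul (hB.comp (measurable_shift x))
      have := integral_permute α π hG
      simp only [permute, hab] at this
      exact this.trans (integral_site_mul_shift hB hχB α b x)
    have h2 := integral_site_mul_shift hB hχB α a x
    simp only [mul_sub]
    rw [integral_sub, h1, h2]
    · ring
    · exact ((hχB a).mul (hB.comp ((measurable_shift x).comp (measurable_permute π)))).integrable α
    · exact ((hχB a).mul (hB.comp (measurable_shift x))).integrable α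
  set X := X₀ ∪ (s.image fun y => b - y) ∪ s.image fun y => a - y with hX
  have hsum : ∀ c, (∀ y ∈ s, c - y ∈ X) → ∑ x ∈ X, (q (c - x) - q z₀) = ∑ᶠ z, (q z - q z₀) := by
    intro c hc
    rw [← finsum_comp_equiv (Equiv.subLeft c) (f := fun z => q z - q z₀)]
    refine (finsum_eq_sum_of_support_subset _ fun x hx => ?_).symm
    by_contra hcx
    refine hx (sub_eq_zero.2 (hconst _ _ (fun hmem => hcx ?_) hz₀))
    have := hc _ hmem
    simpa using this
  have hexp : ∀ η, χ (η a) * totalDiff (fun x ζ => h (shift x ζ)) η (permute π η) =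
      ∑ x ∈ X, χ (η a) * (h (shift x (permute π η)) - h (shift x η)) := fun η => by
    rw [hX₀ X (by intro x hx; simp [hX, hx]), Finset.mul_sum]
  simp only [hexp]
  rw [integral_finsetSum]
  · simp only [hterm]
    rw [Finset.sum_sub_distrib, hsum b, hsum a, sub_self]
    · intro y hy
      exact Finset.mem_union_right _ (Finset.mem_image_of_mem _ hy)
    · intro y hy
      exact Finset.mem_union_left _ (Finset.mem_union_right _ (Finset.mem_image_of_mem _ hy))
  · intro x _
    exact ((hχB a).mul ((hB.comp ((measurable_shift x).comp (measurable_permute π))).sub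
      (hB.comp (measurable_shift x)))).integrable α

theorem moment_zero (ψ : Fin 2 → SiteState → ℝ) (s : SiteState) : moment ψ 0 s = 0 := by
  simp [moment, coord]

theorem moment_e (ψ : Fin 2 → SiteState → ℝ) (i : Fin 2) (s : SiteState) :
    moment ψ (e i) s = ψ i s := by
  fin_cases i <;> simp [moment, coord, e, Fin.sum_univ_two]

theorem finSupp_rotation (i j : Fin 2) : FinSupp (rotation i j) :=
  (((finSupp_swap _ _).mul (finSupp_swap _ _)).mul (finSupp_swap _ _)).mul (finSupp_swap _ _)

theorem totalDiff_moment_rotation (ψ : Fin 2 → SiteState → ℝ) {i j : Fin 2} (hij : i ≠ j)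
    (η : Config) :
    totalDiff (fun x ζ => moment ψ x (ζ x)) η (permute (rotation i j) η) =
      (ψ i (η 0) - ψ i (η (e i))) + (ψ j (η (e i)) - ψ j (η (e j))) := by
  rw [totalDiff, finsum_eq_sum_of_support_subset (s := {0, e i, e j})]
  · rw [Finset.sum_insert, Finset.sum_pair (e_ne_e hij)]
    · simp only [moment_zero, moment_e, permute, rotation_left hij, rotation_right hij]
      ring
    · simp only [Finset.mem_insert, Finset.mem_singleton, not_or]
      exact ⟨(e_ne_zero i).symm, (e_ne_zero j).symm⟩
  · intro x hx
    by_contra hc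
    simp only [Finset.coe_insert, Finset.coe_singleton, Set.mem_insert_iff,
      Set.mem_singleton_iff, not_or] at hc
    exact hx (by simp only [permute, rotation_of_ne hc.1 hc.2.1 hc.2.2, sub_self])

/-- The part from `h` has mean zero. In the current part, exchanging `e i` and `e j` cancels the
terms with `ψ j`, and exchanging `0` and `e i` turns the rest into half a mean square. -/
theorem integral_site_mul_totalDiff_rotation {ω : Angle → ℝ} (hω : IsC2 ω) (α : GrandParam)
    {h : Config → ℝ} (hh : h ∈ weightedSpan ω) {ψ : Fin 2 → SiteState → ℝ}
    (hψ : ∀ i, ψ i ∈ siteSpan ω) {i j : Fin 2} (hij : i ≠ j) :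
    ∫ η, ψ i (η 0) * totalDiff (potential h ψ) η (permute (rotation i j) η) ∂grandMeasure α =
      (1 / 2) * ∫ η, (ψ i (η 0) - ψ i (η (e i))) ^ 2 ∂grandMeasure α := by
  have hS := fun m x => isBM_site hω (hψ m) x
  have hl := isUniformlyLocal_shift (weightedSpan_isLocal hh)
  have hrot := finSupp_rotation i j
  have hT : IsBM fun η => totalDiff (fun x ζ => h (shift x ζ)) η (permute (rotation i j) η) :=
    isBM_totalDiff hl (fun x => (isBM_of_weightedSpan hω hh).comp (measurable_shift x)) hrot
  set u : Config → ℝ := fun η => ψ i (η 0) with hu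
  set v : Config → ℝ := fun η => ψ i (η (e i)) with hv
  set w : Config → ℝ := fun η => ψ j (η (e i)) with hw
  set z : Config → ℝ := fun η => ψ j (η (e j)) with hz
  have huB : IsBM u := hS _ _
  have hvB : IsBM v := hS _ _
  have hwB : IsBM w := hS _ _
  have hzB : IsBM z := hS _ _
  have hsplit : ∀ η, u η * totalDiff (potential h ψ) η (permute (rotation i j) η) =
      u η * totalDiff (fun x ζ => h (shift x ζ)) η (permute (rotation i j) η) +
        ((u η * u η - u η * v η) + (u η * w η - u η * z η)) := fun η => by
    have h1 : totalDiff (potential h ψ) η (permute (rotation i j) η) =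
        totalDiff (fun x ζ => h (shift x ζ)) η (permute (rotation i j) η) +
          totalDiff (fun x ζ => moment ψ x (ζ x)) η (permute (rotation i j) η) :=
      totalDiff_add hl (isUniformlyLocal_site (moment ψ)) (hrot.finDiff η)
    rw [h1, totalDiff_moment_rotation ψ hij]
    ring
  have e1 : ∫ η, u η * w η ∂grandMeasure α = ∫ η, u η * z η ∂grandMeasure α := by
    rw [← integral_permute α (Equiv.swap (e i) (e j)) (huB.mul hzB)]
    refine integral_congr_ae (Filter.Eventually.of_forall fun η => ?_)
    simp only [hu, hw, hz, permute, Equiv.swap_apply_right,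
      Equiv.swap_apply_of_ne_of_ne (e_ne_zero i).symm (e_ne_zero j).symm]
  have e2 : ∫ η, v η * v η ∂grandMeasure α = ∫ η, u η * u η ∂grandMeasure α := by
    rw [← integral_permute α (Equiv.swap 0 (e i)) (huB.mul huB)]
    refine integral_congr_ae (Filter.Eventually.of_forall fun η => ?_)
    simp only [hu, hv, permute, Equiv.swap_apply_left]
  have e3 : ∫ η, (u η - v η) ^ 2 ∂grandMeasure α =
      (∫ η, u η * u η ∂grandMeasure α - 2 * ∫ η, u η * v η ∂grandMeasure α) +
        ∫ η, v η * v η ∂grandMeasure α := by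
    have hu2 : IsBM fun η => 2 * (u η * v η) := (isBM_const 2).mul (huB.mul hvB)
    rw [← integral_const_mul, ← integral_sub ((huB.mul huB).integrable α) (hu2.integrable α),
      ← integral_add (((huB.mul huB).sub hu2).integrable α) ((hvB.mul hvB).integrable α)]
    refine integral_congr_ae (Filter.Eventually.of_forall fun η => ?_)
    simp only
    ring
  have hA := (huB.mul huB).sub (huB.mul hvB)
  have hC := (huB.mul hwB).sub (huB.mul hzB)
  rw [integral_congr_ae (Filter.Eventually.of_forall hsplit), integral_add
    ((huB.mul hT).integrable α) ((hA.add hC).integrable α),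
    integral_add (hA.integrable α) (hC.integrable α),
    integral_sub ((huB.mul huB).integrable α) ((huB.mul hvB).integrable α),
    integral_sub ((huB.mul hwB).integrable α) ((huB.mul hzB).integrable α), e1, e3, e2,
    integral_site_mul_totalDiff_shift hω α hh (hψ i) hrot 0 (e i) (rotation_left hij)]
  ring

/-! ### The search for a hole -/

/-- The probability that a site is occupied. -/
def density (α : GrandParam) : ℝ≥0∞ := siteMeasure α {s | s ≠ SiteState.empty}

theorem measurableSet_ne_empty : MeasurableSet {s : SiteState | s ≠ SiteState.empty} := by
  have : {s : SiteState | s ≠ SiteState.empty} =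
      (fun s : SiteState => s.1.1) ⁻¹' {o | o ≠ none} := by
    ext s
    simp [SiteState.eq_empty_iff]
  rw [this]
  exact (measurable_fst.comp measurable_subtype_coe) trivial

/-- The first `K` sites of the ray are occupied. -/
def rayOccupied (i j : Fin 2) (K : ℕ) : Set Config :=
  {η | ∀ k < K, η (raySite i j k) ≠ SiteState.empty}

/-- The site number `K` of the ray is empty. -/
def rayHole (i j : Fin 2) (K : ℕ) : Set Config := {η | η (raySite i j K) = SiteState.empty}

theorem measurableSet_rayHole (i j : Fin 2) (K : ℕ) : MeasurableSet (rayHole i j K) := by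
  have := ((measurable_pi_apply (raySite i j K)) measurableSet_ne_empty.compl :
    MeasurableSet ((fun η : Config => η (raySite i j K)) ⁻¹' {s | s ≠ SiteState.empty}ᶜ))
  convert this using 1
  ext η
  simp [rayHole]

theorem rayOccupied_succ (i j : Fin 2) (K : ℕ) :
    rayOccupied i j (K + 1) = rayOccupied i j K \ rayHole i j K := by
  ext η
  simp only [rayOccupied, rayHole, Set.mem_sdiff, Set.mem_ofPred_eq, Nat.lt_succ_iff_lt_or_eq]
  constructor
  · exact fun h => ⟨fun k hk => h k (Or.inl hk), h K (Or.inr rfl)⟩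
  · rintro ⟨h, h'⟩ k (hk | rfl)
    exacts [h k hk, h']

theorem rayOccupied_zero (i j : Fin 2) : rayOccupied i j 0 = Set.univ := by
  ext η; simp [rayOccupied]

theorem measurableSet_rayOccupied (i j : Fin 2) (K : ℕ) :
    MeasurableSet (rayOccupied i j K) := by
  induction K with
  | zero => rw [rayOccupied_zero]; exact MeasurableSet.univ
  | succ K ih => rw [rayOccupied_succ]; exact ih.diff (measurableSet_rayHole i j K)

theorem measure_rayOccupied (α : GrandParam) (i j : Fin 2) (K : ℕ) :
    grandMeasure α (rayOccupied i j K) = density α ^ K := by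
  classical
  have : rayOccupied i j K = Set.pi (((Finset.range K).image (raySite i j) : Finset Z2) : Set Z2)
      fun _ => {s | s ≠ SiteState.empty} := by
    ext η
    simp [rayOccupied, Set.mem_pi]
  rw [this, grandMeasure, Measure.infinitePi_pi _ fun _ _ => measurableSet_ne_empty,
    Finset.prod_const, Finset.card_image_of_injective _ (raySite_injective i j),
    Finset.card_range, density]

theorem density_le_one (α : GrandParam) : density α ≤ 1 := prob_le_one

/-- The space is split according to the first hole on the ray. The event that it is the site number
`k` has probability at most `p^k`, so its contribution is of order `(2k+4) p^{k/2}` times the norm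
of the germ, which is summable for `p < 1`. The constant depends neither on `h` nor on `ψ`. -/
theorem abs_integral_rotation_le {ω : Angle → ℝ} (hω : IsC2 ω) (α : GrandParam)
    (hα : density α < 1) {χ : SiteState → ℝ} (hχ : χ ∈ siteSpan ω) :
    ∃ C : ℝ, ∀ h ∈ weightedSpan ω, ∀ ψ : Fin 2 → SiteState → ℝ, (∀ i, ψ i ∈ siteSpan ω) →
      ∀ i j : Fin 2, i ≠ j →
      |∫ η, χ (η 0) * totalDiff (potential h ψ) η (permute (rotation i j) η) ∂grandMeasure α| ≤
        C * (eLpNorm (germ h ψ) 2 (grandMeasure α)).toReal := by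
  obtain ⟨B, hB⟩ := siteSpan_bounded hω hχ
  have hB0 : 0 ≤ B := (abs_nonneg _).trans (hB SiteState.empty)
  set p : ℝ := (density α).toReal with hp
  have hp0 : 0 ≤ p := ENNReal.toReal_nonneg
  have hp1 : p < 1 := by
    have := (ENNReal.toReal_lt_toReal hα.ne_top ENNReal.one_ne_top).2 hα
    simpa using this
  set q : ℝ := √p with hq
  have hq0 : 0 ≤ q := Real.sqrt_nonneg p
  have hq1 : q < 1 := by rw [hq, Real.sqrt_lt' one_pos]; simpa using hp1
  have hsumm : Summable fun k : ℕ => (2 * (k : ℝ) + 4) * q ^ k := by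
    have hqn : ‖q‖ < 1 := by rwa [Real.norm_of_nonneg hq0]
    have h1 := (summable_pow_mul_geometric_of_norm_lt_one 1 hqn).mul_left 2
    have h2 := (summable_geometric_of_lt_one hq0 hq1).mul_left 4
    refine (h1.add h2).congr fun k => ?_
    ring
  refine ⟨B * ∑' k : ℕ, (2 * (k : ℝ) + 4) * q ^ k, fun h hh ψ hψ i j hij => ?_⟩
  set μ := grandMeasure α with hμ
  set δ := eLpNorm (germ h ψ) 2 μ with hδ
  have hδtop : δ ≠ ⊤ := (memLp_of_weightedSpan hω α (germ_mem_weightedSpan hh hψ)).2.ne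
  set Δ : Config → ℝ := fun η => totalDiff (potential h ψ) η (permute (rotation i j) η) with hΔ
  have hΔB : IsBM Δ := isBM_totalDiff (isUniformlyLocal_potential (weightedSpan_isLocal hh) ψ)
    (isBM_potential hω hh hψ) (finSupp_rotation i j)
  have hFB : IsBM fun η => χ (η 0) * Δ η := (isBM_site hω hχ 0).mul hΔB
  have hFint : Integrable (fun η => χ (η 0) * Δ η) μ := hFB.integrable α
  obtain ⟨D, hD⟩ := hFB.2
  have hreal : ∀ K, μ.real (rayOccupied i j K) = p ^ K := fun K => by
    rw [Measure.real, hμ, measure_rayOccupied, ENNReal.toReal_pow]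
  -- the contribution of the event that the first hole is the site number `k`
  have hhole : ∀ k, |∫ η in rayOccupied i j k ∩ rayHole i j k, χ (η 0) * Δ η ∂μ| ≤
      B * δ.toReal * ((2 * (k : ℝ) + 4) * q ^ k) := by
    intro k
    set A := rayOccupied i j k ∩ rayHole i j k with hA
    have hAm : MeasurableSet A :=
      (measurableSet_rayOccupied i j k).inter (measurableSet_rayHole i j k)
    have h1 := (holeBound_rotation hω α hh hψ hij k).bound A hAm fun η hη => hη.2
    have hμA : μ A ≤ density α ^ k :=
      (measure_mono Set.inter_subset_left).trans (measure_rayOccupied α i j k).le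
    have hdt : density α ^ k ≠ ⊤ := ENNReal.pow_ne_top hα.ne_top
    have hrhs : ((2 * k + 4 : ℕ) : ℝ≥0∞) * (δ * μ A ^ (1 / 2 : ℝ)) ≠ ⊤ :=
      ENNReal.mul_ne_top (ENNReal.natCast_ne_top _) (ENNReal.mul_ne_top hδtop
        (ENNReal.rpow_ne_top_of_nonneg (by norm_num) (measure_ne_top _ _)))
    have h2 : ∫ η in A, |Δ η| ∂μ ≤ (2 * (k : ℝ) + 4) * (δ.toReal * q ^ k) := by
      have h3 : ∫ η in A, |Δ η| ∂μ = (eLpNorm Δ 1 (μ.restrict A)).toReal := by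
        rw [eLpNorm_one_eq_lintegral_enorm]
        exact integral_norm_eq_lintegral_enorm hΔB.1.aestronglyMeasurable
      rw [h3]
      refine (ENNReal.toReal_mono hrhs h1).trans ?_
      rw [ENNReal.toReal_mul, ENNReal.toReal_mul, ENNReal.toReal_natCast, ← ENNReal.toReal_rpow]
      push_cast
      gcongr
      have h4 : (μ A).toReal ≤ p ^ k := by
        have := ENNReal.toReal_mono hdt hμA
        rwa [ENNReal.toReal_pow] at this
      rw [← Real.sqrt_eq_rpow]
      refine Real.sqrt_le_iff.2 ⟨by positivity, h4.trans (le_of_eq ?_)⟩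
      rw [← pow_mul, mul_comm k 2, pow_mul, hq, Real.sq_sqrt hp0]
    calc |∫ η in A, χ (η 0) * Δ η ∂μ| ≤ ∫ η in A, |χ (η 0) * Δ η| ∂μ := abs_integral_le_integral_abs
      _ ≤ ∫ η in A, B * |Δ η| ∂μ := by
        refine integral_mono hFint.abs.integrableOn
          ((hΔB.integrable α).abs.const_mul B).integrableOn fun η => ?_
        simp only [abs_mul]
        exact mul_le_mul_of_nonneg_right (hB _) (abs_nonneg _)
      _ = B * ∫ η in A, |Δ η| ∂μ := integral_const_mul _ _
      _ ≤ B * ((2 * (k : ℝ) + 4) * (δ.toReal * q ^ k)) := mul_le_mul_of_nonneg_left h2 hB0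
      _ = _ := by ring
  have hstep : ∀ K, ∫ η, χ (η 0) * Δ η ∂μ =
      ∑ k ∈ Finset.range K, ∫ η in rayOccupied i j k ∩ rayHole i j k, χ (η 0) * Δ η ∂μ +
        ∫ η in rayOccupied i j K, χ (η 0) * Δ η ∂μ := by
    intro K
    induction K with
    | zero => simp [rayOccupied_zero]
    | succ K ih =>
      rw [ih, Finset.sum_range_succ, add_assoc, rayOccupied_succ,
        integral_inter_add_sdiff (measurableSet_rayHole i j K) hFint.integrableOn]
  have hbound : ∀ K : ℕ, |∫ η, χ (η 0) * Δ η ∂μ| ≤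
      B * δ.toReal * (∑' k : ℕ, (2 * (k : ℝ) + 4) * q ^ k) + D * p ^ K := by
    intro K
    rw [hstep K]
    refine (abs_add_le _ _).trans (add_le_add ?_ ?_)
    · refine (Finset.abs_sum_le_sum_abs _ _).trans
        ((Finset.sum_le_sum fun k _ => hhole k).trans ?_)
      rw [← Finset.mul_sum]
      exact mul_le_mul_of_nonneg_left (hsumm.sum_le_tsum _ fun k _ => by positivity) (by positivity)
    · rw [← hreal K]
      have hD' : ∀ η ∈ rayOccupied i j K, ‖χ (η 0) * Δ η‖ ≤ D := fun η _ => hD η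
      exact norm_setIntegral_le_of_norm_le_const (f := fun η => χ (η 0) * Δ η)
        (measure_lt_top μ _) hD'
  -- The event that no hole is found among the first `K` sites is negligible for fixed `h`, as the
  -- integrand is bounded; its bound `D` depends on `h` but disappears in the limit.
  have hlim : Filter.Tendsto (fun K : ℕ => B * δ.toReal *
      (∑' k : ℕ, (2 * (k : ℝ) + 4) * q ^ k) + D * p ^ K) Filter.atTop
      (nhds (B * δ.toReal * (∑' k : ℕ, (2 * (k : ℝ) + 4) * q ^ k) + D * 0)) :=
    ((tendsto_pow_atTop_nhds_zero_of_lt_one hp0 hp1).const_mul D).const_add _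
  have := ge_of_tendsto' hlim hbound
  linarith

/-! ### The spaces of germs -/

/-- The classes in `L²` of the germs `∇Σ_h`, without the condition that `h` is centred. -/
def gradSpace (ω : Angle → ℝ) (α : GrandParam) : Submodule ℝ (L2 α) where
  carrier := {g | ∃ h ∈ weightedSpan ω, g =ᵐ[grandMeasure α] gradSum h}
  zero_mem' := ⟨0, (weightedSpan ω).zero_mem, by
    filter_upwards [Lp.coeFn_zero (EuclideanSpace ℝ (Fin 2)) 2 (grandMeasure α)] with η h
    rw [h, gradSum_zero]; rfl⟩
  add_mem' := by
    rintro f g ⟨h, hh, hf⟩ ⟨k, hk, hg⟩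
    refine ⟨h + k, add_mem hh hk, ?_⟩
    filter_upwards [Lp.coeFn_add f g, hf, hg] with η h1 h2 h3
    rw [h1, Pi.add_apply, h2, h3,
      gradSum_add (weightedSpan_isLocal hh) (weightedSpan_isLocal hk)]
  smul_mem' := by
    rintro a f ⟨h, hh, hf⟩
    refine ⟨a • h, (weightedSpan ω).smul_mem a hh, ?_⟩
    filter_upwards [Lp.coeFn_smul a f, hf] with η h1 h2
    rw [h1, Pi.smul_apply, h2, gradSum_smul]

theorem closure_exactGerms {ω : Angle → ℝ} (hω : IsC2 ω) (α : GrandParam) :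
    closure (exactGerms α ω) = closure (gradSpace ω α : Set (L2 α)) := by
  apply subset_antisymm
  · refine closure_mono ?_
    rintro g ⟨h, -, hT, hg⟩
    exact ⟨h, Tω_eq_weightedSpan hω ▸ hT, hg⟩
  · refine closure_minimal ?_ isClosed_closure
    rintro g ⟨h, hh, hg⟩
    rw [Metric.mem_closure_iff]
    intro ε hε
    obtain ⟨f, hfT, hfc, hf⟩ := exists_centered_approx hω hh (show 0 < ε / 4 by positivity)
    have hL := memLp_of_weightedSpan hω α (gradSum_mem_weightedSpan hfT)
    refine ⟨hL.toLp _, ⟨f, hfc, (Tω_eq_weightedSpan hω).symm ▸ hfT, hL.coeFn_toLp⟩, ?_⟩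
    rw [dist_eq_norm]
    have hbound : ∀ᵐ η ∂grandMeasure α, ‖(g - hL.toLp _) η‖ ≤ ε / 2 := by
      filter_upwards [Lp.coeFn_sub g (hL.toLp _), hg, hL.coeFn_toLp] with η h1 h2 h3
      rw [h1, Pi.sub_apply, h2, h3, EuclideanSpace.norm_eq, Fin.sum_univ_two]
      refine Real.sqrt_le_iff.2 ⟨by positivity, ?_⟩
      have h4 : ∀ i, ‖(gradSum h η - gradSum f η) i‖ ^ 2 ≤ (ε / 4) ^ 2 := fun i =>
        pow_le_pow_left₀ (norm_nonneg _) (hf η i) 2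
      nlinarith [h4 0, h4 1]
    have := Lp.norm_le_of_ae_bound (by positivity : (0 : ℝ) ≤ ε / 2) hbound
    have h1 : measureUnivNNReal (grandMeasure α) = 1 := by simp [measureUnivNNReal]
    rw [h1, NNReal.coe_one, Real.one_rpow, one_mul] at this
    linarith

theorem flow_add (ψ φ : Fin 2 → SiteState → ℝ) (η : Config) :
    flow (ψ + φ) η = flow ψ η + flow φ η := by
  ext i
  simp only [flow_apply, PiLp.add_apply, Pi.add_apply]
  ring

theorem flow_smul (a : ℝ) (ψ : Fin 2 → SiteState → ℝ) (η : Config) :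
    flow (a • ψ) η = a • flow ψ η := by
  ext i
  simp only [flow_apply, PiLp.smul_apply, Pi.smul_apply, smul_eq_mul]
  ring

theorem flow_zero (η : Config) : flow 0 η = 0 := by
  ext i
  simp [flow_apply]

theorem currentGerm_eq_flow (σ : Species) (Φ : Angle → ℝ) (i : Fin 2) :
    currentGerm σ Φ i = flow (Pi.single i fun s => Φ s.1.2 * s.count σ) := by
  funext η
  ext m
  rcases eq_or_ne m i with rfl | h
  · simp [currentGerm, flow_apply, numW, num]
  · simp [currentGerm, flow_apply, h]

theorem single_mem_siteSpan {ω : Angle → ℝ} {ψ : SiteState → ℝ} (hψ : ψ ∈ siteSpan ω)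
    (i m : Fin 2) : (Pi.single i ψ : Fin 2 → SiteState → ℝ) m ∈ siteSpan ω := by
  rcases eq_or_ne m i with rfl | h
  · simpa using hψ
  · simp [h]

theorem mem_currentForms_of_single {ω : Angle → ℝ} (hω : IsC2 ω) (α : GrandParam) (i : Fin 2)
    {ψ : SiteState → ℝ} (hψ : ψ ∈ siteSpan ω) (g : L2 α)
    (hg : g =ᵐ[grandMeasure α] flow (Pi.single i ψ)) : g ∈ currentForms α ω := by
  induction hψ using Submodule.span_induction generalizing g with
  | mem ψ h =>
    obtain ⟨σ, rfl | rfl⟩ := h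
    · refine Submodule.subset_span ⟨σ, i, Or.inl ?_⟩
      rw [currentGerm_eq_flow]
      simpa using hg
    · refine Submodule.subset_span ⟨σ, i, Or.inr ?_⟩
      rwa [currentGerm_eq_flow]
  | zero =>
    convert (currentForms α ω).zero_mem
    rw [Lp.eq_zero_iff_ae_eq_zero]
    filter_upwards [hg] with η h
    rw [h, Pi.single_zero, flow_zero]; rfl
  | add ψ φ hψ hφ ihψ ihφ =>
    have h1 := memLp_of_weightedSpan hω α (flow_mem_weightedSpan (single_mem_siteSpan hψ i))
    have h2 := memLp_of_weightedSpan hω α (flow_mem_weightedSpan (single_mem_siteSpan hφ i))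
    have : g = h1.toLp _ + h2.toLp _ := by
      refine Lp.ext ?_
      filter_upwards [hg, Lp.coeFn_add (h1.toLp _) (h2.toLp _), h1.coeFn_toLp, h2.coeFn_toLp]
        with η e1 e2 e3 e4
      rw [e1, e2, Pi.add_apply, e3, e4, ← flow_add, Pi.single_add]
    rw [this]
    exact add_mem (ihψ _ h1.coeFn_toLp) (ihφ _ h2.coeFn_toLp)
  | smul a ψ hψ ihψ =>
    have h1 := memLp_of_weightedSpan hω α (flow_mem_weightedSpan (single_mem_siteSpan hψ i))
    have : g = a • h1.toLp _ := by
      refine Lp.ext ?_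
      filter_upwards [hg, Lp.coeFn_smul a (h1.toLp _), h1.coeFn_toLp] with η e1 e2 e3
      rw [e1, e2, Pi.smul_apply, e3, ← flow_smul, Pi.single_smul]
    rw [this]
    exact Submodule.smul_mem _ a (ihψ _ h1.coeFn_toLp)

theorem mem_currentForms {ω : Angle → ℝ} (hω : IsC2 ω) {α : GrandParam} {g : L2 α} :
    g ∈ currentForms α ω ↔ ∃ ψ : Fin 2 → SiteState → ℝ, (∀ i, ψ i ∈ siteSpan ω) ∧
      g =ᵐ[grandMeasure α] flow ψ := by
  constructor
  · intro hg
    induction hg using Submodule.span_induction with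
    | mem g h =>
      obtain ⟨σ, i, h | h⟩ := h
      · refine ⟨_, single_mem_siteSpan (Submodule.subset_span ⟨σ, Or.inl rfl⟩) i, ?_⟩
        rw [currentGerm_eq_flow] at h
        simpa using h
      · refine ⟨_, single_mem_siteSpan (Submodule.subset_span ⟨σ, Or.inr rfl⟩) i, ?_⟩
        rwa [currentGerm_eq_flow] at h
    | zero =>
      refine ⟨0, fun i => (siteSpan ω).zero_mem, ?_⟩
      filter_upwards [Lp.coeFn_zero (EuclideanSpace ℝ (Fin 2)) 2 (grandMeasure α)] with η h
      rw [h, flow_zero]; rfl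
    | add f g _ _ hf hg =>
      obtain ⟨ψ, hψ, hf⟩ := hf
      obtain ⟨φ, hφ, hg⟩ := hg
      refine ⟨ψ + φ, fun i => add_mem (hψ i) (hφ i), ?_⟩
      filter_upwards [Lp.coeFn_add f g, hf, hg] with η h1 h2 h3
      rw [h1, Pi.add_apply, h2, h3, flow_add]
    | smul a f _ hf =>
      obtain ⟨ψ, hψ, hf⟩ := hf
      refine ⟨a • ψ, fun i => (siteSpan ω).smul_mem a (hψ i), ?_⟩
      filter_upwards [Lp.coeFn_smul a f, hf] with η h1 h2
      rw [h1, Pi.smul_apply, h2, flow_smul]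
  · rintro ⟨ψ, hψ, hg⟩
    have hL := fun i => memLp_of_weightedSpan hω α
      (flow_mem_weightedSpan (single_mem_siteSpan (hψ i) i))
    have : g = (hL 0).toLp _ + (hL 1).toLp _ := by
      refine Lp.ext ?_
      filter_upwards [hg, Lp.coeFn_add ((hL 0).toLp _) ((hL 1).toLp _), (hL 0).coeFn_toLp,
        (hL 1).coeFn_toLp] with η e1 e2 e3 e4
      rw [e1, e2, Pi.add_apply, e3, e4, ← flow_add]
      congr 1
      funext m
      fin_cases m <;> simp
    rw [this]
    exact add_mem (mem_currentForms_of_single hω α 0 (hψ 0) _ (hL 0).coeFn_toLp)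
      (mem_currentForms_of_single hω α 1 (hψ 1) _ (hL 1).coeFn_toLp)

theorem finiteDimensional_currentForms (α : GrandParam) (ω : Angle → ℝ) :
    FiniteDimensional ℝ (currentForms α ω) := by
  have hsub : ∀ f : Config → EuclideanSpace ℝ (Fin 2),
      {g : L2 α | g =ᵐ[grandMeasure α] f}.Finite := fun f =>
    Set.Subsingleton.finite fun g hg g' hg' =>
      Lp.ext (Filter.EventuallyEq.trans (show g =ᵐ[grandMeasure α] f from hg)
        (Filter.EventuallyEq.symm (show g' =ᵐ[grandMeasure α] f from hg')))
  refine FiniteDimensional.span_of_finite ℝ ?_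
  have : {g : L2 α | ∃ (σ : Species) (i : Fin 2), g =ᵐ[grandMeasure α]
      currentGerm σ (fun _ => 1) i ∨
      g =ᵐ[grandMeasure α] currentGerm σ ω i} =
      ⋃ (σ : Species) (i : Fin 2), ({g : L2 α | g =ᵐ[grandMeasure α] currentGerm σ (fun _ => 1) i} ∪
        {g : L2 α | g =ᵐ[grandMeasure α] currentGerm σ ω i}) := by
    ext g
    simp
  rw [this]
  exact Set.finite_iUnion fun σ => Set.finite_iUnion fun i => (hsub _).union (hsub _)

/-- One inclusion is the decomposition `IsClosedGerm.eq_germ`, the other the existence of the formal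
potential. No closure is involved. -/
theorem closedGerms_eq {ω : Angle → ℝ} (hω : IsC2 ω) (α : GrandParam) :
    closedGerms α ω = ((gradSpace ω α ⊔ currentForms α ω : Submodule ℝ (L2 α)) : Set (L2 α)) := by
  ext g
  rw [SetLike.mem_coe, Submodule.mem_sup]
  constructor
  · rintro ⟨U, hU, hT, hg⟩
    rw [Tω_eq_weightedSpan hω] at hT
    obtain ⟨h, hh, ψ, hψ, rfl⟩ := hU.eq_germ hω hT
    have h1 := memLp_of_weightedSpan hω α (gradSum_mem_weightedSpan hh)
    have h2 := memLp_of_weightedSpan hω α (flow_mem_weightedSpan hψ)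
    refine ⟨h1.toLp _, ⟨h, hh, h1.coeFn_toLp⟩, h2.toLp _,
      (mem_currentForms hω).2 ⟨ψ, hψ, h2.coeFn_toLp⟩, Lp.ext ?_⟩
    filter_upwards [hg, Lp.coeFn_add (h1.toLp _) (h2.toLp _), h1.coeFn_toLp, h2.coeFn_toLp]
      with η e1 e2 e3 e4
    rw [e1, e2, Pi.add_apply, e3, e4, germ]
  · rintro ⟨f, ⟨h, hh, hf⟩, k, hk, rfl⟩
    obtain ⟨ψ, hψ, hk⟩ := (mem_currentForms hω).1 hk
    refine ⟨germ h ψ, isClosedGerm_germ hω α hh hψ, fun i => ?_, ?_⟩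
    · rw [Tω_eq_weightedSpan hω]
      exact germ_mem_weightedSpan hh hψ i
    · filter_upwards [Lp.coeFn_add f k, hf, hk] with η e1 e2 e3
      rw [e1, Pi.add_apply, e2, e3, germ]

theorem ae_ne_empty_of_density {α : GrandParam} (hα : density α = 1) (x : Z2) :
    ∀ᵐ η ∂grandMeasure α, η x ≠ SiteState.empty := by
  have h := measurePreserving_eval_infinitePi (fun _ : Z2 => siteMeasure α) x
  have h1 : ∀ᵐ s ∂siteMeasure α, s ≠ SiteState.empty := by
    rw [ae_iff]
    exact (prob_compl_eq_zero_iff measurableSet_ne_empty).2 hα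
  exact h.quasiMeasurePreserving.ae h1

/-- A flow in the closure of the exact germs vanishes. -/
theorem eq_zero_of_mem_closure {ω : Angle → ℝ} (hω : IsC2 ω) {α : GrandParam} {g : L2 α}
    (hg : g ∈ closure (gradSpace ω α : Set (L2 α))) {ψ : Fin 2 → SiteState → ℝ}
    (hψ : ∀ i, ψ i ∈ siteSpan ω) (hgψ : g =ᵐ[grandMeasure α] flow ψ) : g = 0 := by
  have hψ0 : ∀ i, ψ i SiteState.empty = 0 := fun i => siteSpan_empty (hψ i)
  suffices hall : ∀ i, ∀ᵐ η ∂grandMeasure α, flow ψ η i = 0 by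
    rw [Lp.eq_zero_iff_ae_eq_zero]
    filter_upwards [hgψ, hall 0, hall 1] with η h h0 h1
    rw [h]
    ext i
    match i with
    | 0 => simpa using h0
    | 1 => simpa using h1
  intro i
  rcases (density_le_one α).lt_or_eq with hα | hα
  swap
  -- At density one the site `e i` is almost surely occupied, and the current is blocked.
  · filter_upwards [ae_ne_empty_of_density hα (e i)] with η h
    rw [flow_apply, occ_of_ne_empty h, sub_self, mul_zero]
  obtain ⟨j, hij⟩ : ∃ j, i ≠ j := by
    match i with
    | 0 => exact ⟨1, by decide⟩
    | 1 => exact ⟨0, by decide⟩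
  obtain ⟨C, hC⟩ := abs_integral_rotation_le hω α hα (hψ i)
  set v := ∫ η, (ψ i (η 0) - ψ i (η (e i))) ^ 2 ∂grandMeasure α with hv
  have hv0 : 0 ≤ v := integral_nonneg fun η => sq_nonneg _
  have hle : ∀ ε > 0, v ≤ 2 * |C| * ε := by
    intro ε hε
    obtain ⟨f, ⟨h, hh, hf⟩, hd⟩ := Metric.mem_closure_iff.1 hg ε hε
    -- With `-h` the norm of the germ is exactly the distance from the current `g` to the
    -- approximation `f`.
    have hn : -h ∈ weightedSpan ω := neg_mem hh
    have h1 := hC (-h) hn ψ hψ i j hij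
    rw [integral_site_mul_totalDiff_rotation hω α hn hψ hij, ← hv,
      abs_of_nonneg (by positivity)] at h1
    have h2 : (eLpNorm (germ (-h) ψ) 2 (grandMeasure α)).toReal = dist g f := by
      rw [dist_eq_norm, Lp.norm_def]
      congr 1
      refine eLpNorm_congr_ae ?_
      filter_upwards [Lp.coeFn_sub g f, hgψ, hf] with η e1 e2 e3
      rw [e1, Pi.sub_apply, e2, e3, germ, ← neg_one_smul ℝ h, gradSum_smul, neg_one_smul]
      abel
    rw [h2] at h1
    have h3 : C * dist g f ≤ |C| * ε :=
      mul_le_mul (le_abs_self C) hd.le dist_nonneg (abs_nonneg C)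
    linarith
  have hvz : v = 0 := by
    refine le_antisymm (le_of_forall_pos_le_add fun ε hε => ?_) hv0
    -- The added `1` keeps the denominator positive when `C = 0`.
    have h1 := hle (ε / (2 * |C| + 1)) (by positivity)
    have h2 : 2 * |C| * (ε / (2 * |C| + 1)) ≤ ε := by
      rw [← mul_div_assoc, div_le_iff₀ (by positivity)]
      nlinarith [abs_nonneg C]
    linarith
  have hB : IsBM fun η => (ψ i (η 0) - ψ i (η (e i))) ^ 2 := by
    have := (isBM_site hω (hψ i) 0).sub (isBM_site hω (hψ i) (e i))
    simpa only [sq] using this.mul this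
  have hae := (integral_eq_zero_iff_of_nonneg (fun η => sq_nonneg _) (hB.integrable α)).1 hvz
  filter_upwards [hae] with η hη
  have hη' : ψ i (η 0) = ψ i (η (e i)) := sub_eq_zero.1 (pow_eq_zero_iff two_ne_zero |>.1 hη)
  rw [flow_apply]
  by_cases he : η (e i) = SiteState.empty
  · rw [hη', he, hψ0, zero_mul]
  · rw [occ_of_ne_empty he, sub_self, mul_zero]

end ActivePassive

end

theorem proposition5p1 (α : GrandParam) (ω : Angle → ℝ) (hω : IsC2 ω) :
    ∃ T E : Submodule ℝ (L2 α),
      (T : Set (L2 α)) = closure (closedGerms α ω) ∧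
      (E : Set (L2 α)) = closure (exactGerms α ω) ∧
      E ⊔ currentForms α ω = T ∧
      Disjoint E (currentForms α ω) := by
  have hfin := finiteDimensional_currentForms α ω
  set S := gradSpace ω α with hS
  refine ⟨S.topologicalClosure ⊔ currentForms α ω, S.topologicalClosure, ?_, ?_, rfl, ?_⟩
  · rw [closedGerms_eq hω α]
    apply subset_antisymm
    · rw [← Submodule.topologicalClosure_coe]
      exact SetLike.coe_subset_coe.2 (sup_le (Submodule.topologicalClosure_mono le_sup_left)
        (le_sup_right.trans (Submodule.le_topologicalClosure _)))
    -- The sum of a closed subspace and a finite-dimensional one is closed, so no limits beyond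
    -- those of exact germs appear.
    · exact closure_minimal (SetLike.coe_subset_coe.2
        (sup_le_sup_right (Submodule.le_topologicalClosure _) _))
        (Submodule.isClosed_sup_finiteDimensional _ _ S.isClosed_topologicalClosure)
  · rw [Submodule.topologicalClosure_coe, closure_exactGerms hω α]
  · rw [Submodule.disjoint_def]
    intro g hg hJ
    obtain ⟨ψ, hψ, hgψ⟩ := (mem_currentForms hω).1 hJ
    exact eq_zero_of_mem_closure hω hg hψ hgψ
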